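/- Let $\mathbb O_{\mathbb C}=\mathbb O\otimes\mathbb C$ be the complexified octonions with basis $1,e_1,\dots,e_7$, where $e_i^2=-1$, $e_ie_j=-e_je_i$ for $i\ne j$, and the products are fixed by the seven relations $e_1e_2=-e_5$, $e_1e_3=-e_6$, $e_1e_4=-e_7$, $e_2e_3=-e_7$, $e_2e_4=e_6$, $e_3e_4=-e_5$, $e_5e_6=e_7$ and those obtained from each of them by cyclic permutation. Let $\mathbb G_2\subset \mathrm{SO}(7,\mathbb C)$ be the automorphism group of $\mathbb O_{\mathbb C}$ acting on $\mathbb C^7=\operatorname{Im}\mathbb O\otimes\mathbb C$, let $\langle\cdot,\cdot\rangle$ be the complex bilinear extension of the standard inner product of $\mathbb R^7$ (so that $\perp$ and "isotropic" refer to it), and let $x\cdot y\in\mathbb C^7$ be the imaginary part of the octonionic product of $x,y\in\mathbb C^7$. Put $\tau(g)=\bar g$ and $\sigma(g)=sgs^{-1}$ with $s=\operatorname{diag}(-1,-1,-1,-1,1,1,1)$; these define the symmetric space $G_2/\mathrm{SO}(4)$. Let $\mathcal L_-^{\tau,\sigma}(\mathbb G_2,\mathbb C^7)$ be the group of maps $g$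 from an open dense subset of $\mathbb{CP}^1$ to $\mathbb G_2$ (two maps being identified if they agree on an open dense set) that are holomorphic, extend to meromorphic maps $\mathbb{CP}^1\to\operatorname{End}(\mathbb C^7)$, are holomorphic at $\infty$ with $g(\infty)=e$, and satisfy $\tau(g(\bar\lambda))=g(\lambda)$ and $\sigma(g(-\lambda))=g(\lambda)$. For $\alpha\in\mathbb C\setminus\mathbb R$ and an isotropic line $L\subset\mathbb C^7$ let $$p_{\alpha,L}(\lambda)=\frac{\lambda-\bar\alpha}{\lambda-\alpha}\,\pi_{\bar L}+\pi_{(L\oplus\bar L)^\perp}+\frac{\lambda-\alpha}{\lambda-\bar\alpha}\,\pi_L ,$$ where $\pi_W$ is the hermitian orthogonal projection onto $W$. Call a pair $(L,K)$ of isotropic lines admissible if $K\subset\bar L^{\perp}$ and $\mathcal C=L\oplus\pi_{(L\oplus\bar L)^\perp}K$ is an isotropic $2$-plane with $\mathcal C\cdot\mathcal C=0$; for admissible pairs put $p_{\alpha,L,K}=p_{\alpha,L}\,p_{\alpha,K}$. For $\alpha\in\mathbb C\setminus(\mathbb R\cup i\mathbb R)$ and an admissible pair $(L,K)$ put $$q_{\alpha,L,K}=p_{-\alpha,(sL)',(sK)'}\;p_{\alpha,L,K},\qquad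 (sK)'=p_{\alpha,L,K}(-\alpha)\,sK,\qquad (sL)'=\bigl(p_{-\alpha,(sK)'}\;p_{\alpha,L,K}\;p_{-\alpha,sK}^{-1}\bigr)(-\alpha)\,sL,$$ where the last product is evaluated at its removable singularity $-\alpha$. **Theorem.** The elements $p_{\beta,M,N}$, with $\beta\in i\mathbb R\setminus\{0\}$ and $(M,N)$ an admissible pair such that $sM=\overline M$ and $sN=\overline N$, and the elements $q_{\alpha,L,K}$, with $\alpha\in\mathbb C\setminus(\mathbb R\cup i\mathbb R)$ and $(L,K)$ an admissible pair, belong to $\mathcal L_-^{\tau,\sigma}(\mathbb G_2,\mathbb C^7)$ and generate this group. -/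

import Mathlib

noncomputable section

open Filter Topology Matrix
open scoped ComplexConjugate

namespace G2Loop

/-! ## The complexified octonions and the group `𝔾₂` -/

/-- The product of the complexified octonions `𝕆 ⊗ ℂ`, with coordinates `x 0, …, x 7` with respect to
the basis `1, e₁, …, e₇`; here `e₁e₂ = -e₅`, `e₁e₃ = -e₆`, `e₁e₄ = -e₇`, `e₂e₃ = -e₇`, `e₂e₄ = e₆`,
`e₃e₄ = -e₅`, `e₅e₆ = e₇`, and so on. -/
def octMul (x y : Fin 8 → ℂ) : Fin 8 → ℂ :=
  ![x 0 * y 0 - x 1 * y 1 - x 2 * y 2 - x 3 * y 3 - x 4 * y 4 - x 5 * y 5 - x 6 * y 6 - x 7 * y 7,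
    x 0 * y 1 + x 1 * y 0 - x 2 * y 5 - x 3 * y 6 - x 4 * y 7 + x 5 * y 2 + x 6 * y 3 + x 7 * y 4,
    x 0 * y 2 + x 1 * y 5 + x 2 * y 0 - x 3 * y 7 + x 4 * y 6 - x 5 * y 1 - x 6 * y 4 + x 7 * y 3,
    x 0 * y 3 + x 1 * y 6 + x 2 * y 7 + x 3 * y 0 - x 4 * y 5 + x 5 * y 4 - x 6 * y 1 - x 7 * y 2,
    x 0 * y 4 + x 1 * y 7 - x 2 * y 6 + x 3 * y 5 + x 4 * y 0 - x 5 * y 3 + x 6 * y 2 - x 7 * y 1,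
    x 0 * y 5 - x 1 * y 2 + x 2 * y 1 - x 3 * y 4 + x 4 * y 3 + x 5 * y 0 + x 6 * y 7 - x 7 * y 6,
    x 0 * y 6 - x 1 * y 3 + x 2 * y 4 + x 3 * y 1 - x 4 * y 2 - x 5 * y 7 + x 6 * y 0 + x 7 * y 5,
    x 0 * y 7 - x 1 * y 4 - x 2 * y 3 + x 3 * y 2 + x 4 * y 1 + x 5 * y 6 - x 6 * y 5 + x 7 * y 0]

/-- `7 × 7` complex matrices, acting on `ℂ⁷ = Im 𝕆 ⊗ ℂ`. -/
abbrev Mat7 := Matrix (Fin 7) (Fin 7) ℂ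

/-- The map `x₀ + x ↦ x₀ + A x` of `𝕆 ⊗ ℂ = ℂ ⊕ ℂ⁷` defined by a `7 × 7` matrix `A`. -/
def octExt (A : Mat7) (x : Fin 8 → ℂ) : Fin 8 → ℂ :=
  Fin.cons (x 0) (A *ᵥ Fin.tail x)

lemma octExt_mul (A B : Mat7) (x : Fin 8 → ℂ) : octExt (A * B) x = octExt A (octExt B x) := by
  simp [octExt]

lemma octExt_one (x : Fin 8 → ℂ) : octExt 1 x = x := by
  simp [octExt]

/-- `𝔾₂`, the automorphism group of `𝕆 ⊗ ℂ`, in its representation on `ℂ⁷ = Im 𝕆 ⊗ ℂ`. -/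
def G2 : Subgroup (GL (Fin 7) ℂ) where
  carrier := {A | ∀ x y, octExt A.val (octMul x y) = octMul (octExt A.val x) (octExt A.val y)}
  mul_mem' {A B} hA hB x y := by
    rw [Units.val_mul]
    simp only [octExt_mul]
    rw [hB, hA]
  one_mem' x y := by
    simp only [Units.val_one, octExt_one]
  inv_mem' {A} hA x y := by
    have h1 : ∀ z, octExt A.val (octExt A⁻¹.val z) = z := fun z => by
      rw [← octExt_mul, Units.mul_inv, octExt_one]
    have h2 : ∀ z, octExt A⁻¹.val (octExt A.val z) = z := fun z => by
      rw [← octExt_mul, Units.inv_mul, octExt_one]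
    have h := hA (octExt A⁻¹.val x) (octExt A⁻¹.val y)
    rw [h1, h1] at h
    rw [← h, h2]

/-- The matrix `s = diag(-1, -1, -1, -1, 1, 1, 1)`. -/
def sMat : Mat7 := Matrix.diagonal ![-1, -1, -1, -1, 1, 1, 1]

lemma sMat_mul_self : sMat * sMat = 1 := by
  rw [sMat, Matrix.diagonal_mul_diagonal, ← Matrix.diagonal_one]
  congr 1
  ext i
  fin_cases i <;> simp

/-- `s` as an invertible matrix. -/
def sGL : GL (Fin 7) ℂ := ⟨sMat, sMat, sMat_mul_self, sMat_mul_self⟩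

/-- The antiholomorphic involution `τ(A) = Ā`. -/
def tau : GL (Fin 7) ℂ →* GL (Fin 7) ℂ := Matrix.GeneralLinearGroup.map (starRingEnd ℂ)

/-- The holomorphic involution `σ(A) = s A s⁻¹`. -/
def sigma : GL (Fin 7) ℂ →* GL (Fin 7) ℂ := (MulAut.conj sGL).toMonoidHom

/-! ## Loops -/

/-- The filter of all subsets of `ℂ` that contain an open and dense subset of `ℂ`. -/
def openDense : Filter ℂ where
  sets := {s | ∃ U ⊆ s, IsOpen U ∧ Dense U}
  univ_sets := ⟨Set.univ, subset_rfl, isOpen_univ, dense_univ⟩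
  sets_of_superset := fun ⟨U, hU, h⟩ hst => ⟨U, hU.trans hst, h⟩
  inter_sets := fun ⟨U, hU, hUo, hUd⟩ ⟨W, hW, hWo, hWd⟩ =>
    ⟨U ∩ W, Set.inter_subset_inter hU hW, hUo.inter hWo, hUd.inter_of_isOpen_left hWd hUo⟩

/-- The group of maps into `GL(7, ℂ)`, where maps that agree on an open and dense set are identified.
An open dense subset of `ℂℙ¹ = ℂ ∪ {∞}` and its trace on `ℂ` determine the same germs; the values
of a representative outside an open and dense set do not matter. -/
abbrev Loop := Germ openDense (GL (Fin 7) ℂ)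

/-- `f` is a holomorphic map into `𝔾₂` on some open and dense set. -/
def IsHolomorphicLoop (f : ℂ → GL (Fin 7) ℂ) : Prop :=
  ∃ U : Set ℂ, IsOpen U ∧ Dense U ∧ (∀ z ∈ U, f z ∈ G2) ∧
    ∀ i j, DifferentiableOn ℂ (fun z => (f z).val i j) U

/-- The matrix entries of `f` are meromorphic on `ℂℙ¹ = ℂ ∪ {∞}`. -/
def IsRational (f : ℂ → GL (Fin 7) ℂ) : Prop :=
  (∀ z, ∀ i j, MeromorphicAt (fun w => (f w).val i j) z) ∧
    ∀ i j, MeromorphicAt (fun w => (f w⁻¹).val i j) 0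

/-- The reality condition `τ(f(λ̄)) = f(λ)`. -/
def IsReal (f : ℂ → GL (Fin 7) ℂ) : Prop :=
  ∀ᶠ z in openDense, tau (f (conj z)) = f z

/-- The twisting condition `σ(f(-λ)) = f(λ)`. -/
def IsTwisted (f : ℂ → GL (Fin 7) ℂ) : Prop :=
  ∀ᶠ z in openDense, sigma (f (-z)) = f z

/-- The map `f` in the coordinate `w = 1/λ` at `∞`, with the value `e` at `w = 0`. -/
def atInfty (f : ℂ → GL (Fin 7) ℂ) : ℂ → GL (Fin 7) ℂ :=
  Function.update (fun w => f w⁻¹) 0 1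

/-- `f` is holomorphic at `∞` and `f(∞) = e`. -/
def IsNegative (f : ℂ → GL (Fin 7) ℂ) : Prop :=
  ∀ i j, AnalyticAt ℂ (fun w => (atInfty f w).val i j) 0

/-! ### Closure properties needed for the loop group -/

section Closure

/-- Entries of products stay in a subring of functions that contains the entries of the factors. -/
lemma entry_mul_mem (S : Subring (ℂ → ℂ)) (f g : ℂ → GL (Fin 7) ℂ)
    (hf : ∀ i j, (fun z => (f z).val i j) ∈ S) (hg : ∀ i j, (fun z => (g z).val i j) ∈ S)
    (i j : Fin 7) : (fun z => ((f * g) z).val i j) ∈ S := by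
  have h : (fun z => ((f * g) z).val i j)
      = ∑ k, (fun z => (f z).val i k) * (fun z => (g z).val k j) := by
    ext z
    simp [Matrix.mul_apply, Finset.sum_apply]
  rw [h]
  exact S.sum_mem fun k _ => S.mul_mem (hf i k) (hg k j)

lemma det_mem (S : Subring (ℂ → ℂ)) (F : ℂ → Mat7)
    (hF : ∀ i j, (fun z => F z i j) ∈ S) : (fun z => (F z).det) ∈ S := by
  have h : (fun z => (F z).det)
      = ∑ p : Equiv.Perm (Fin 7), ((Equiv.Perm.sign p : ℤ) : ℂ → ℂ) *
          ∏ i, (fun z => F z (p i) i) := by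
    ext z
    simp [Matrix.det_apply', Finset.sum_apply, Finset.prod_apply]
  rw [h]
  exact S.sum_mem fun p _ => S.mul_mem (intCast_mem S _) (S.prod_mem fun i _ => hF _ _)

lemma entry_inv_mem (S : Subring (ℂ → ℂ))
    (hS : ∀ u ∈ S, (∀ z, u z ≠ 0) → (fun z => (u z)⁻¹) ∈ S) (f : ℂ → GL (Fin 7) ℂ)
    (hf : ∀ i j, (fun z => (f z).val i j) ∈ S) (i j : Fin 7) :
    (fun z => ((f⁻¹) z).val i j) ∈ S := by
  have h : (fun z => ((f⁻¹) z).val i j)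
      = (fun z => ((f z).val.det)⁻¹) * fun z => ((f z).val.updateRow j (Pi.single i 1)).det := by
    ext z
    simp [Matrix.coe_units_inv, Matrix.inv_def, Matrix.adjugate_apply]
  rw [h]
  refine S.mul_mem (hS _ (det_mem S _ hf) fun z => ?_) (det_mem S _ fun k l => ?_)
  · exact ((Matrix.isUnit_iff_isUnit_det _).1 (f z).isUnit).ne_zero
  · by_cases hk : k = j
    · subst hk
      simp only [Matrix.updateRow_self]
      by_cases hl : l = i
      · subst hl
        simp only [Pi.single_eq_same]
        exact S.one_mem
      · simp only [Pi.single_apply, if_neg hl]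
        exact S.zero_mem
    · simpa [Matrix.updateRow_ne hk] using hf k l

/-- Functions holomorphic on `U`. -/
def holoRing (U : Set ℂ) : Subring (ℂ → ℂ) where
  carrier := {u | DifferentiableOn ℂ u U}
  mul_mem' hu hv := hu.mul hv
  one_mem' := differentiableOn_const 1
  add_mem' hu hv := hu.add hv
  zero_mem' := differentiableOn_const 0
  neg_mem' hu := hu.neg

/-- Functions meromorphic at `z`. -/
def meroRing (z : ℂ) : Subring (ℂ → ℂ) where
  carrier := {u | MeromorphicAt u z}
  mul_mem' hu hv := hu.mul hv
  one_mem' := MeromorphicAt.const 1 z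
  add_mem' hu hv := hu.add hv
  zero_mem' := MeromorphicAt.const 0 z
  neg_mem' hu := hu.neg

/-- Functions holomorphic at `z`. -/
def anaRing (z : ℂ) : Subring (ℂ → ℂ) where
  carrier := {u | AnalyticAt ℂ u z}
  mul_mem' hu hv := hu.mul hv
  one_mem' := analyticAt_const
  add_mem' hu hv := hu.add hv
  zero_mem' := analyticAt_const
  neg_mem' hu := hu.neg

lemma IsHolomorphicLoop.mul {f g : ℂ → GL (Fin 7) ℂ} (hf : IsHolomorphicLoop f)
    (hg : IsHolomorphicLoop g) : IsHolomorphicLoop (f * g) := by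
  obtain ⟨U, hUo, hUd, hU, hU'⟩ := hf
  obtain ⟨W, hWo, hWd, hW, hW'⟩ := hg
  refine ⟨U ∩ W, hUo.inter hWo, hUd.inter_of_isOpen_left hWd hUo,
    fun z hz => G2.mul_mem (hU z hz.1) (hW z hz.2), ?_⟩
  exact entry_mul_mem (holoRing (U ∩ W)) f g (fun i j => (hU' i j).mono Set.inter_subset_left)
    (fun i j => (hW' i j).mono Set.inter_subset_right)

lemma IsHolomorphicLoop.inv {f : ℂ → GL (Fin 7) ℂ} (hf : IsHolomorphicLoop f) :
    IsHolomorphicLoop f⁻¹ := by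
  obtain ⟨U, hUo, hUd, hU, hU'⟩ := hf
  refine ⟨U, hUo, hUd, fun z hz => G2.inv_mem (hU z hz), ?_⟩
  exact entry_inv_mem (holoRing U) (fun u hu h0 => DifferentiableOn.inv hu fun z _ => h0 z) f hU'

lemma IsHolomorphicLoop.one : IsHolomorphicLoop 1 :=
  ⟨Set.univ, isOpen_univ, dense_univ, fun _ _ => G2.one_mem, fun _ _ => differentiableOn_const _⟩

lemma IsRational.mul {f g : ℂ → GL (Fin 7) ℂ} (hf : IsRational f) (hg : IsRational g) :
    IsRational (f * g) :=
  ⟨fun z => entry_mul_mem (meroRing z) f g (hf.1 z) (hg.1 z),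
    entry_mul_mem (meroRing 0) (fun w => f w⁻¹) (fun w => g w⁻¹) hf.2 hg.2⟩

lemma IsRational.inv {f : ℂ → GL (Fin 7) ℂ} (hf : IsRational f) : IsRational f⁻¹ :=
  ⟨fun z => entry_inv_mem (meroRing z) (fun _ hu _ => MeromorphicAt.inv hu) f (hf.1 z),
    entry_inv_mem (meroRing 0) (fun _ hu _ => MeromorphicAt.inv hu) (fun w => f w⁻¹) hf.2⟩

lemma IsRational.one : IsRational 1 :=
  ⟨fun _ _ _ => MeromorphicAt.const _ _, fun _ _ => MeromorphicAt.const _ _⟩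

lemma atInfty_mul (f g : ℂ → GL (Fin 7) ℂ) : atInfty (f * g) = atInfty f * atInfty g := by
  ext1 w
  by_cases hw : w = 0 <;> simp [atInfty, hw]

lemma atInfty_inv (f : ℂ → GL (Fin 7) ℂ) : atInfty f⁻¹ = (atInfty f)⁻¹ := by
  ext1 w
  by_cases hw : w = 0 <;> simp [atInfty, hw]

lemma atInfty_one : atInfty 1 = 1 := by
  ext1 w
  by_cases hw : w = 0 <;> simp [atInfty, hw]

lemma IsNegative.mul {f g : ℂ → GL (Fin 7) ℂ} (hf : IsNegative f) (hg : IsNegative g) :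
    IsNegative (f * g) := by
  rw [IsNegative, atInfty_mul]
  exact entry_mul_mem (anaRing 0) _ _ hf hg

lemma IsNegative.inv {f : ℂ → GL (Fin 7) ℂ} (hf : IsNegative f) : IsNegative f⁻¹ := by
  rw [IsNegative, atInfty_inv]
  exact entry_inv_mem (anaRing 0) (fun _ hu h0 => AnalyticAt.inv hu (h0 0)) _ hf

lemma IsNegative.one : IsNegative 1 := by
  rw [IsNegative, atInfty_one]
  exact fun _ _ => analyticAt_const

lemma IsReal.mul {f g : ℂ → GL (Fin 7) ℂ} (hf : IsReal f) (hg : IsReal g) : IsReal (f * g) := by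
  filter_upwards [hf, hg] with z h1 h2
  simp [h1, h2]

lemma IsReal.inv {f : ℂ → GL (Fin 7) ℂ} (hf : IsReal f) : IsReal f⁻¹ := by
  filter_upwards [hf] with z h1
  rw [Pi.inv_apply, Pi.inv_apply, map_inv, h1]

lemma IsReal.one : IsReal 1 :=
  Eventually.of_forall fun _ => map_one tau

lemma IsTwisted.mul {f g : ℂ → GL (Fin 7) ℂ} (hf : IsTwisted f) (hg : IsTwisted g) :
    IsTwisted (f * g) := by
  filter_upwards [hf, hg] with z h1 h2
  rw [Pi.mul_apply, Pi.mul_apply, map_mul, h1, h2]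

lemma IsTwisted.inv {f : ℂ → GL (Fin 7) ℂ} (hf : IsTwisted f) : IsTwisted f⁻¹ := by
  filter_upwards [hf] with z h1
  rw [Pi.inv_apply, Pi.inv_apply, map_inv, h1]

lemma IsTwisted.one : IsTwisted 1 :=
  Eventually.of_forall fun _ => map_one sigma

end Closure

/-- The group `ℒ₋^{τ,σ}(𝔾₂, ℂ⁷)` of negative rational loops in `𝔾₂` that satisfy the reality and the
twisting condition. -/
def twistedLoopGroup : Subgroup Loop where
  carrier := {γ | ∃ f : ℂ → GL (Fin 7) ℂ, γ = (f : Loop) ∧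
    IsHolomorphicLoop f ∧ IsRational f ∧ IsReal f ∧ IsTwisted f ∧ IsNegative f}
  mul_mem' := by
    rintro _ _ ⟨f, rfl, h1, h2, h3, h4, h5⟩ ⟨g, rfl, k1, k2, k3, k4, k5⟩
    exact ⟨f * g, rfl, h1.mul k1, h2.mul k2, h3.mul k3, h4.mul k4, h5.mul k5⟩
  one_mem' := ⟨1, rfl, .one, .one, .one, .one, .one⟩
  inv_mem' := by
    rintro _ ⟨f, rfl, h1, h2, h3, h4, h5⟩
    exact ⟨f⁻¹, rfl, h1.inv, h2.inv, h3.inv, h4.inv, h5.inv⟩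

/-! ## Lines in `ℂ⁷` -/

/-- `ℂ⁷` with its standard hermitian inner product. -/
abbrev C7 := EuclideanSpace ℂ (Fin 7)

/-- Complex conjugation on `ℂ⁷`. -/
def conjMap : C7 →ₛₗ[starRingEnd ℂ] C7 where
  toFun x := WithLp.toLp 2 fun i => conj (x i)
  map_add' x y := by ext i; simp
  map_smul' c x := by ext i; simp

/-- The conjugate subspace `W̄`. -/
def conjSub (W : Submodule ℂ C7) : Submodule ℂ C7 := W.map conjMap

/-- The image `A W` of a subspace under a matrix. -/
def matSub (A : Mat7) (W : Submodule ℂ C7) : Submodule ℂ C7 := W.map (Matrix.toEuclideanLin A)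

/-- The complex bilinear extension of the standard inner product of `ℝ⁷`. -/
def bil (x y : C7) : ℂ := ∑ i, x i * y i

/-- The product on `ℂ⁷`: the imaginary part of the octonionic product. -/
def imMul (x y : C7) : Fin 7 → ℂ :=
  Fin.tail (octMul (Fin.cons 0 x.ofLp) (Fin.cons 0 y.ofLp))

/-- Isotropic subspaces with respect to the bilinear form. -/
def IsIsotropic (W : Submodule ℂ C7) : Prop := ∀ x ∈ W, ∀ y ∈ W, bil x y = 0

/-- Isotropic lines. -/
def IsIsotropicLine (L : Submodule ℂ C7) : Prop := Module.finrank ℂ L = 1 ∧ IsIsotropic L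

/-- Complex coassociative planes: isotropic `2`-planes `C` with `C · C = 0`. -/
def IsCoassociative (C : Submodule ℂ C7) : Prop :=
  Module.finrank ℂ C = 2 ∧ IsIsotropic C ∧ ∀ x ∈ C, ∀ y ∈ C, imMul x y = 0

/-- The matrix of the hermitian orthogonal projection `π_W` onto `W`. -/
def proj (W : Submodule ℂ C7) : Mat7 :=
  (Matrix.toEuclideanCLM (n := Fin 7) (𝕜 := ℂ)).symm W.starProjection

/-- The pairs of isotropic lines `L, K` for which `p_{α,L,K}` is defined: `K ⊂ L̄^⊥` (with respect to
the bilinear form) and `L ⊕ π_{(L ⊕ L̄)^⊥} K` is complex coassociative. The hermitian and the bilinear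
complement of the conjugation invariant subspace `L ⊕ L̄` are the same. -/
def IsPair (L K : Submodule ℂ C7) : Prop :=
  IsIsotropicLine L ∧ IsIsotropicLine K ∧ (∀ x ∈ K, ∀ y ∈ conjSub L, bil x y = 0) ∧
    IsCoassociative (L ⊔ matSub (proj (L ⊔ conjSub L)ᗮ) K)

/-! ## Simple elements -/

/-- `p_{α,L}(λ) = (λ-ᾱ)/(λ-α) π_{L̄} + π_{(L⊕L̄)^⊥} + (λ-α)/(λ-ᾱ) π_L`. -/
def pLine (α : ℂ) (L : Submodule ℂ C7) (z : ℂ) : Mat7 :=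
  ((z - conj α) / (z - α)) • proj (conjSub L) + proj (L ⊔ conjSub L)ᗮ +
    ((z - α) / (z - conj α)) • proj L

/-- `p_{α,L,K} = p_{α,L} p_{α,K}`. -/
def pPair (α : ℂ) (L K : Submodule ℂ C7) (z : ℂ) : Mat7 := pLine α L z * pLine α K z

/-- `p_{β,K} * h = p_{β,K} h p_{β,K'}⁻¹`, where `K' = h(β)⁻¹ K`. -/
def dress (β : ℂ) (K : Submodule ℂ C7) (h : ℂ → Mat7) (z : ℂ) : Mat7 :=
  pLine β K z * h z * (pLine β (matSub (h β)⁻¹ K) z)⁻¹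

/-- The value at `β` of the holomorphic extension of `p_{β,K} * h` over its removable singularity. -/
def dressAt (β : ℂ) (K : Submodule ℂ C7) (h : ℂ → Mat7) : Mat7 :=
  limUnder (𝓝[≠] β) (dress β K h)

/-- `(sK)' = p_{α,L,K}(-α) sK`. -/
def sKPrime (α : ℂ) (L K : Submodule ℂ C7) : Submodule ℂ C7 :=
  matSub (pPair α L K (-α)) (matSub sMat K)

/-- `(sL)' = (p_{-α,(sK)'} * p_{α,L,K})(-α) sL`. -/
def sLPrime (α : ℂ) (L K : Submodule ℂ C7) : Submodule ℂ C7 :=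
  matSub (dressAt (-α) (sKPrime α L K) (pPair α L K)) (matSub sMat L)

/-- `q_{α,L,K} = p_{-α,(sL)',(sK)'} p_{α,L,K}`. -/
def qPair (α : ℂ) (L K : Submodule ℂ C7) (z : ℂ) : Mat7 :=
  pPair (-α) (sLPrime α L K) (sKPrime α L K) z * pPair α L K z

/-- The first family: `p_{β,M,N}` with `β ∈ iℝ ∖ {0}`, `sM = M̄` and `sN = N̄`. -/
def pFamily : Set (ℂ → Mat7) :=
  {F | ∃ (β : ℂ) (M N : Submodule ℂ C7), β.re = 0 ∧ β.im ≠ 0 ∧ IsPair M N ∧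
    matSub sMat M = conjSub M ∧ matSub sMat N = conjSub N ∧ F = pPair β M N}

/-- The second family: `q_{α,L,K}` with `α ∈ ℂ ∖ (ℝ ∪ iℝ)`. -/
def qFamily : Set (ℂ → Mat7) :=
  {F | ∃ (α : ℂ) (L K : Submodule ℂ C7), α.re ≠ 0 ∧ α.im ≠ 0 ∧ IsPair L K ∧ F = qPair α L K}

/-- The loop `γ` is given by the matrix valued function `F` on an open and dense set. -/
def Represents (F : ℂ → Mat7) (γ : Loop) : Prop :=
  γ.map (fun A : GL (Fin 7) ℂ => A.val) = (F : Germ openDense Mat7)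

end G2Loop

end

/-!
Let `g` be a loop with a pole of order `n ≥ 1` at `α`. Since `g` preserves the bilinear form and the
octonionic product, the first two coefficients `A`, `B` of `(λ - α) ^ n g(λ)` satisfy quadratic
relations. They yield a hermitian orthonormal basis `m`, `k` of a complex coassociative plane and a
number `κ` such that `A x = a(x) m + b(x) k`, `⟨m, B x⟩ = -κ b(x)` and `⟨k, B x⟩ = κ a(x)` for all
`x`. For `L = ℂ (m + κ (α - ᾱ) k̄)` and `K = ℂ k` the terms of orders `n + 1` and `n` of
`p_{α,L,K} g` at `α` then cancel, so that the pole has become simpler. If `α` is imaginary, then `m`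
and `k` can be chosen real for `x ↦ s x̄`, and `p_{α,L,K}` satisfies the twisting condition;
otherwise `q_{α,L,K}` does, and its additional factor is regular at `α`.

The conditions on loops make the pole orders at `α`, `ᾱ`, `-α`, `-ᾱ` equal, so that multiplication
by one of these elements lowers all of them. A real point is never a pole, because there `A` would
be real with isotropic range, hence zero. After finitely many steps no pole is left, and by
Liouville's theorem the loop is constant.
-/

noncomputable section

open Filter Topology Matrix
open scoped ComplexConjugate

namespace G2Loop

/-! ### The cross product of `ℂ⁷` -/

/-- Vectors of `ℂ⁷` in coordinates, without the hermitian norm that `C7` carries. -/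
abbrev V7 := Fin 7 → ℂ

lemma cons_eq_vec (a : ℂ) (x : V7) :
    (Fin.cons a x : Fin 8 → ℂ) = ![a, x 0, x 1, x 2, x 3, x 4, x 5, x 6] := by
  ext i; fin_cases i <;> rfl

/-- The cross product of `ℂ⁷`: the imaginary part of the octonionic product, as a bilinear map. -/
def cross : V7 →ₗ[ℂ] V7 →ₗ[ℂ] V7 := by
  refine LinearMap.mk₂ ℂ (fun x y => Fin.tail (octMul (Fin.cons 0 x) (Fin.cons 0 y)))
      ?_ ?_ ?_ ?_ <;>
    intros <;> simp only [cons_eq_vec] <;> ext i <;> fin_cases i <;>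
      simp [octMul, Fin.tail] <;> ring

local infixl:74 " ⨯₇ " => cross

lemma cross_eq_vec (x y : V7) : x ⨯₇ y =
    ![- x 1 * y 4 - x 2 * y 5 - x 3 * y 6 + x 4 * y 1 + x 5 * y 2 + x 6 * y 3,
      x 0 * y 4 - x 2 * y 6 + x 3 * y 5 - x 4 * y 0 - x 5 * y 3 + x 6 * y 2,
      x 0 * y 5 + x 1 * y 6 - x 3 * y 4 + x 4 * y 3 - x 5 * y 0 - x 6 * y 1,
      x 0 * y 6 - x 1 * y 5 + x 2 * y 4 - x 4 * y 2 + x 5 * y 1 - x 6 * y 0,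
      - x 0 * y 1 + x 1 * y 0 - x 2 * y 3 + x 3 * y 2 + x 5 * y 6 - x 6 * y 5,
      - x 0 * y 2 + x 1 * y 3 + x 2 * y 0 - x 3 * y 1 - x 4 * y 6 + x 6 * y 4,
      - x 0 * y 3 - x 1 * y 2 + x 2 * y 1 + x 3 * y 0 + x 4 * y 5 - x 5 * y 4] := by
  simp only [cross, LinearMap.mk₂_apply, cons_eq_vec]
  ext i
  fin_cases i <;> simp [octMul, Fin.tail]

lemma dotProduct_eq_sum (x y : V7) : x ⬝ᵥ y =
    x 0 * y 0 + x 1 * y 1 + x 2 * y 2 + x 3 * y 3 + x 4 * y 4 + x 5 * y 5 + x 6 * y 6 := by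
  simp [dotProduct, Fin.sum_univ_succ]; ring

lemma cross_anticomm (x y : V7) : x ⨯₇ y = -(y ⨯₇ x) := by
  simp only [cross_eq_vec]; ext i; fin_cases i <;> simp <;> ring

lemma cross_self (x : V7) : x ⨯₇ x = 0 := self_eq_neg.1 (cross_anticomm x x)

lemma cross_dotProduct (x y z : V7) : x ⨯₇ y ⬝ᵥ z = x ⬝ᵥ y ⨯₇ z := by
  simp only [cross_eq_vec, dotProduct_eq_sum]; simp; ring

lemma dotProduct_cross_self (x y : V7) : x ⬝ᵥ x ⨯₇ y = 0 := by
  rw [← cross_dotProduct, cross_self, zero_dotProduct]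

lemma cross_cross_add_cross_cross (x y z : V7) : x ⨯₇ (y ⨯₇ z) + y ⨯₇ (x ⨯₇ z) =
    (-2 * (x ⬝ᵥ y)) • z + (x ⬝ᵥ z) • y + (y ⬝ᵥ z) • x := by
  simp only [cross_eq_vec, dotProduct_eq_sum]; ext i; fin_cases i <;> simp <;> ring

lemma cross_cross_self (x z : V7) : x ⨯₇ (x ⨯₇ z) = (-(x ⬝ᵥ x)) • z + (x ⬝ᵥ z) • x := by
  have h := cross_cross_add_cross_cross x x z
  refine smul_right_injective V7 (two_ne_zero (α := ℂ)) ?_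
  linear_combination (norm := module) h

lemma star_cross (x y : V7) : star (x ⨯₇ y) = star x ⨯₇ star y := by
  simp only [cross_eq_vec]; ext i; fin_cases i <;> simp

lemma continuous_cross : Continuous fun p : V7 × V7 => p.1 ⨯₇ p.2 := by
  exact (LinearMap.toContinuousBilinearMap cross).continuous₂

/-! ### Matrices that preserve the product -/

/-- `A` preserves the bilinear form and the cross product. For invertible matrices this is
membership in `G2`; the notion is needed for matrix valued functions, whose values are only
invertible at most points. -/
structure IsG2 (A : Mat7) : Prop where
  dot : ∀ x y : V7, A *ᵥ x ⬝ᵥ A *ᵥ y = x ⬝ᵥ y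
  cross : ∀ x y : V7, (A *ᵥ x) ⨯₇ (A *ᵥ y) = A *ᵥ (x ⨯₇ y)

lemma octMul_cons (a b : ℂ) (x y : V7) : octMul (Fin.cons a x) (Fin.cons b y) =
    Fin.cons (a * b - x ⬝ᵥ y) (a • y + b • x + x ⨯₇ y) := by
  simp only [cons_eq_vec, cross_eq_vec, dotProduct_eq_sum]
  ext i
  fin_cases i <;> simp [octMul] <;> ring

lemma mem_G2_iff (A : GL (Fin 7) ℂ) : A ∈ G2 ↔ IsG2 A.val := by
  have octExt_cons (a : ℂ) (x : V7) :
      octExt A.val (Fin.cons a x) = Fin.cons a (A.val *ᵥ x) := by simp [octExt]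
  constructor
  · intro h
    have h' (x y : V7) := h (Fin.cons 0 x) (Fin.cons 0 y)
    simp only [octMul_cons, octExt_cons, Fin.cons_inj] at h'
    exact ⟨fun x y => by simpa using (h' x y).1.symm, fun x y => by simpa using (h' x y).2.symm⟩
  · intro h x y
    rw [← Fin.cons_self_tail x, ← Fin.cons_self_tail y]
    simp only [octMul_cons, octExt_cons, h.dot, h.cross, mulVec_add, mulVec_smul]

lemma forall_mulVec_dotProduct_mulVec_iff {n R : Type*} [Fintype n] [DecidableEq n] [CommRing R]
    (A : Matrix n n R) : (∀ x y, A *ᵥ x ⬝ᵥ A *ᵥ y = x ⬝ᵥ y) ↔ Aᵀ * A = 1 := by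
  have dot_eq (x y : n → R) : A *ᵥ x ⬝ᵥ A *ᵥ y = ((Aᵀ * A) *ᵥ x) ⬝ᵥ y := by
    rw [dotProduct_mulVec, ← mulVec_transpose, mulVec_mulVec]
  simp only [dot_eq, ext_iff_mulVec, one_mulVec]
  exact forall_congr' fun x => dotProduct_eq_iff

namespace IsG2

lemma one : IsG2 1 := ⟨by simp, by simp⟩

lemma mul {A B : Mat7} (hA : IsG2 A) (hB : IsG2 B) : IsG2 (A * B) :=
  ⟨fun x y => by rw [← mulVec_mulVec, ← mulVec_mulVec, hA.dot, hB.dot],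
   fun x y => by simp only [← mulVec_mulVec]; rw [hA.cross, hB.cross]⟩

lemma transpose_mul {A : Mat7} (hA : IsG2 A) : Aᵀ * A = 1 :=
  (forall_mulVec_dotProduct_mulVec_iff A).1 hA.dot

lemma mul_transpose {A : Mat7} (hA : IsG2 A) : A * Aᵀ = 1 := mul_eq_one_comm.1 hA.transpose_mul

lemma transpose {A : Mat7} (hA : IsG2 A) : IsG2 Aᵀ where
  dot := (forall_mulVec_dotProduct_mulVec_iff _).2 (by rw [transpose_transpose, hA.mul_transpose])
  cross x y := by
    have h := hA.cross (Aᵀ *ᵥ x) (Aᵀ *ᵥ y)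
    simp only [mulVec_mulVec, hA.mul_transpose, one_mulVec] at h
    rw [h, mulVec_mulVec, hA.transpose_mul, one_mulVec]

end IsG2

lemma sMat_mulVec (x : V7) : sMat *ᵥ x = ![-x 0, -x 1, -x 2, -x 3, x 4, x 5, x 6] := by
  ext i; fin_cases i <;> simp [sMat, Matrix.mulVec_diagonal]

lemma isG2_sMat : IsG2 sMat where
  dot x y := by simp only [sMat_mulVec, dotProduct_eq_sum]; simp
  cross x y := by simp only [sMat_mulVec, cross_eq_vec]; ext i; fin_cases i <;> simp <;> ring

/-! ### Isotropic subspaces -/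

section LinearAlgebra

variable {K V V' n : Type*} [Field K] [AddCommGroup V] [Module K V] [FiniteDimensional K V]
  [AddCommGroup V'] [Module K V'] [Fintype n]

open Module

lemma finrank_le_finrank_map_add_finrank_ker (f : V →ₗ[K] V') (W : Submodule K V) :
    finrank K W ≤ finrank K (W.map f) + finrank K (LinearMap.ker f) := by
  have h := LinearMap.finrank_range_add_finrank_ker (f.domRestrict W)
  have hker : finrank K (LinearMap.ker (f.domRestrict W)) ≤ finrank K (LinearMap.ker f) := by
    rw [LinearMap.ker_domRestrict, ← Submodule.finrank_map_subtype_eq]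
    exact Submodule.finrank_mono (Submodule.map_comap_le _ _)
  rw [LinearMap.range_domRestrict] at h
  omega

lemma finrank_le_finrank_inf_ker_add_one (φ : Dual K V) (W : Submodule K V) :
    finrank K W ≤ finrank K (W ⊓ LinearMap.ker φ : Submodule K V) + 1 := by
  have h := LinearMap.finrank_range_add_finrank_ker (φ.domRestrict W)
  have hrange : finrank K (LinearMap.range (φ.domRestrict W)) ≤ 1 := by
    simpa using Submodule.finrank_le (LinearMap.range (φ.domRestrict W))
  rw [LinearMap.ker_domRestrict, ← Submodule.finrank_map_subtype_eq,
    Submodule.map_comap_subtype] at h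
  omega

lemma two_mul_finrank_le_card_of_dotProduct_eq_zero {W : Submodule K (n → K)}
    (hW : ∀ x ∈ W, ∀ y ∈ W, x ⬝ᵥ y = 0) : 2 * finrank K W ≤ Fintype.card n := by
  classical
  have hle : W.map (dotProductEquiv K n).toLinearMap ≤ W.dualAnnihilator := by
    rintro _ ⟨x, hx, rfl⟩
    exact (Submodule.mem_dualAnnihilator _).2 (hW x hx)
  have h := Submodule.finrank_mono hle
  have hsum := Subspace.finrank_add_finrank_dualAnnihilator_eq W
  rw [LinearEquiv.finrank_map_eq] at h
  rw [finrank_fintype_fun_eq_card] at hsum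
  omega

lemma mem_span_singleton_of_dotProduct_eq_zero {l v : n → K}
    (h : ∀ y, l ⬝ᵥ y = 0 → v ⬝ᵥ y = 0) : v ∈ K ∙ l := by
  classical
  have hspan := mem_span_of_iInf_ker_le_ker (L := fun _ : Unit => dotProductEquiv K n l)
    (K := dotProductEquiv K n v) fun y hy => by
      simp only [Submodule.mem_iInf, LinearMap.mem_ker, forall_const] at hy ⊢
      exact h y hy
  rw [Set.range_const] at hspan
  obtain ⟨c, hc⟩ := Submodule.mem_span_singleton.1 hspan
  rw [← map_smul] at hc
  exact Submodule.mem_span_singleton.2 ⟨c, (dotProductEquiv K n).injective hc⟩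

/-- The hyperplane orthogonal to `m` with respect to the bilinear form. -/
def dotOrthogonal (m : n → K) : Submodule K (n → K) := LinearMap.ker (dotProductBilin K K m)

@[simp] lemma mem_dotOrthogonal {m x : n → K} : x ∈ dotOrthogonal m ↔ m ⬝ᵥ x = 0 := Iff.rfl

lemma card_le_finrank_dotOrthogonal_add_one (m : n → K) :
    Fintype.card n ≤ finrank K (dotOrthogonal m) + 1 := by
  have h := finrank_le_finrank_inf_ker_add_one (dotProductBilin K K m) ⊤
  rwa [top_inf_eq, finrank_top, finrank_fintype_fun_eq_card] at h

end LinearAlgebra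

/-! ### Null vectors -/

lemma cross_cross_of_null {l k : V7} (hlk : l ⨯₇ k = 0) (h0 : l ⬝ᵥ k = 0) (z : V7) :
    l ⨯₇ (k ⨯₇ z) = (2 * (l ⬝ᵥ z)) • k - (k ⬝ᵥ z) • l := by
  have h := cross_cross_add_cross_cross l z k
  rw [hlk, map_zero, add_zero, cross_anticomm z k, map_neg, h0, neg_eq_iff_eq_neg,
    dotProduct_comm z k] at h
  rw [h]; module

lemma derivation_of_null {l k : V7} (hlk : l ⨯₇ k = 0) (h0 : l ⬝ᵥ k = 0) (x y : V7) :
    (k ⬝ᵥ x ⨯₇ y) • l - (l ⬝ᵥ x ⨯₇ y) • k =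
      ((k ⬝ᵥ x) • l - (l ⬝ᵥ x) • k) ⨯₇ y + x ⨯₇ ((k ⬝ᵥ y) • l - (l ⬝ᵥ y) • k) := by
  have hl_dot : l ⬝ᵥ k ⨯₇ y = 0 := by rw [← cross_dotProduct, hlk, zero_dotProduct]
  have hx_dot : x ⬝ᵥ k ⨯₇ y = -(k ⬝ᵥ x ⨯₇ y) := by
    rw [← cross_dotProduct, cross_anticomm, neg_dotProduct, cross_dotProduct]
  -- Expand `l · (k · (x · y))` both directly and after moving first `k` and then `l` past `x`.
  have hkxy : k ⨯₇ (x ⨯₇ y) =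
      -(x ⨯₇ (k ⨯₇ y)) + ((-2 * (k ⬝ᵥ x)) • y + (k ⬝ᵥ y) • x + (x ⬝ᵥ y) • k) := by
    rw [← cross_cross_add_cross_cross]; abel
  have hlxky : l ⨯₇ (x ⨯₇ (k ⨯₇ y)) = -(x ⨯₇ (l ⨯₇ (k ⨯₇ y))) +
      ((-2 * (l ⬝ᵥ x)) • k ⨯₇ y + (l ⬝ᵥ k ⨯₇ y) • x + (x ⬝ᵥ k ⨯₇ y) • l) := by
    rw [← cross_cross_add_cross_cross]; abel
  have h := cross_cross_of_null hlk h0 (x ⨯₇ y)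
  rw [hkxy] at h
  simp only [map_add, map_neg, map_smul, map_sub, hlxky, cross_cross_of_null hlk h0, hl_dot,
    hx_dot, hlk] at h
  simp only [map_sub, map_smul, LinearMap.sub_apply, LinearMap.smul_apply]
  rw [cross_anticomm x l] at h ⊢
  refine smul_right_injective V7 (two_ne_zero (α := ℂ)) ?_
  linear_combination (norm := module) h

lemma cross_cross_cross_of_isotropic {l x y : V7} (hl : l ⬝ᵥ l = 0) (hx : l ⬝ᵥ x = 0)
    (hy : l ⬝ᵥ y = 0) : (l ⨯₇ x) ⨯₇ (l ⨯₇ y) = (2 * (l ⬝ᵥ x ⨯₇ y)) • l := by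
  have hlx : l ⨯₇ x ⬝ᵥ l = 0 := by rw [dotProduct_comm, dotProduct_cross_self]
  have hylx : y ⨯₇ (l ⨯₇ x) = (x ⬝ᵥ y) • l - l ⨯₇ (y ⨯₇ x) := by
    have h := cross_cross_add_cross_cross y l x
    rw [dotProduct_comm y l, hy, hx, dotProduct_comm y x] at h
    linear_combination (norm := module) h
  have h := cross_cross_add_cross_cross (l ⨯₇ x) l y
  rw [cross_anticomm (l ⨯₇ x) y, hylx, hlx, hy, map_neg, map_sub, map_smul, cross_self,
    cross_cross_self, hl, cross_anticomm y x, dotProduct_neg, cross_dotProduct] at h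
  linear_combination (norm := module) h

/-- The annihilator `{x | m · x = 0}` of a vector. -/
def annihilator (m : V7) : Submodule ℂ V7 := LinearMap.ker (cross m)

@[simp] lemma mem_annihilator {m x : V7} : x ∈ annihilator m ↔ m ⨯₇ x = 0 := Iff.rfl

section IsotropicVector

variable {m : V7} (hm0 : m ≠ 0) (hm : m ⬝ᵥ m = 0)

include hm in
lemma cross_mem_annihilator {x : V7} (hx : m ⬝ᵥ x = 0) : m ⨯₇ x ∈ annihilator m := by
  simp [cross_cross_self, hm, hx]

include hm0 hm

lemma dotProduct_eq_zero_of_mem_annihilator {x : V7} (hx : x ∈ annihilator m) : m ⬝ᵥ x = 0 := by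
  have h := cross_cross_self m x
  rw [mem_annihilator.1 hx, map_zero, hm, neg_zero, zero_smul, zero_add] at h
  exact (smul_eq_zero.1 h.symm).resolve_right hm0

lemma annihilator_isotropic {x y : V7} (hx : x ∈ annihilator m) (hy : y ∈ annihilator m) :
    x ⬝ᵥ y = 0 := by
  have h := cross_cross_add_cross_cross x y m
  rw [cross_anticomm y m, cross_anticomm x m, mem_annihilator.1 hx, mem_annihilator.1 hy,
    dotProduct_comm x m, dotProduct_comm y m, dotProduct_eq_zero_of_mem_annihilator hm0 hm hx,
    dotProduct_eq_zero_of_mem_annihilator hm0 hm hy] at h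
  simpa [hm0] using h.symm

lemma finrank_annihilator : Module.finrank ℂ (annihilator m) = 3 := by
  have hle : 2 * Module.finrank ℂ (annihilator m) ≤ 7 :=
    two_mul_finrank_le_card_of_dotProduct_eq_zero fun x hx y hy =>
      annihilator_isotropic hm0 hm hx hy
  have hmap : (dotOrthogonal m).map (cross m) ≤ annihilator m := by
    rintro _ ⟨x, hx, rfl⟩
    exact cross_mem_annihilator hm hx
  have hmap := Submodule.finrank_mono hmap
  have hker : Module.finrank ℂ (dotOrthogonal m) ≤
      Module.finrank ℂ ((dotOrthogonal m).map (cross m)) + Module.finrank ℂ (annihilator m) :=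
    finrank_le_finrank_map_add_finrank_ker (cross m) (dotOrthogonal m)
  have hdim : 7 ≤ Module.finrank ℂ (dotOrthogonal m) + 1 :=
    card_le_finrank_dotOrthogonal_add_one m
  omega

lemma exists_cross_notMem_span : ∃ x, m ⬝ᵥ x = 0 ∧ m ⨯₇ x ∉ ℂ ∙ m := by
  by_contra! h
  have hmap : (dotOrthogonal m).map (cross m) ≤ ℂ ∙ m := by
    rintro _ ⟨x, hx, rfl⟩
    exact h x hx
  have hmap := Submodule.finrank_mono hmap
  rw [finrank_span_singleton hm0] at hmap
  have hker : Module.finrank ℂ (dotOrthogonal m) ≤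
      Module.finrank ℂ ((dotOrthogonal m).map (cross m)) + Module.finrank ℂ (annihilator m) :=
    finrank_le_finrank_map_add_finrank_ker (cross m) (dotOrthogonal m)
  have hdim : 7 ≤ Module.finrank ℂ (dotOrthogonal m) + 1 :=
    card_le_finrank_dotOrthogonal_add_one m
  have hann := finrank_annihilator hm0 hm
  omega

end IsotropicVector

lemma finrank_le_two_of_null {W : Submodule ℂ V7} (hdot : ∀ x ∈ W, ∀ y ∈ W, x ⬝ᵥ y = 0)
    (hcross : ∀ x ∈ W, ∀ y ∈ W, x ⨯₇ y = 0) : Module.finrank ℂ W ≤ 2 := by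
  by_contra! hW
  obtain ⟨l, hlW, hl0⟩ : ∃ l ∈ W, l ≠ 0 := by
    apply Submodule.exists_mem_ne_zero_of_ne_bot
    rintro rfl
    simp at hW
  have hl := hdot l hlW l hlW
  have hWann : W = annihilator l :=
    Submodule.eq_of_le_of_finrank_le (fun x hx => hcross l hlW x hx)
      ((finrank_annihilator hl0 hl).trans_le hW)
  obtain ⟨x, hx, hxl⟩ := exists_cross_notMem_span hl0 hl
  refine hxl (mem_span_singleton_of_dotProduct_eq_zero fun y hy => ?_)
  have h := hcross _ (hWann ▸ cross_mem_annihilator hl hx) _ (hWann ▸ cross_mem_annihilator hl hy)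
  rw [cross_cross_cross_of_isotropic hl hx hy] at h
  rw [cross_dotProduct]
  simpa [hl0] using h

/-! ### Coassociative frames and their special linear groups -/

/-- A hermitian orthonormal basis `l`, `k` of a complex coassociative plane, that is of an
isotropic plane on which the cross product vanishes. -/
structure IsCoassociativeFrame (l k : V7) : Prop where
  dot_ll : l ⬝ᵥ l = 0
  dot_kk : k ⬝ᵥ k = 0
  dot_lk : l ⬝ᵥ k = 0
  star_dot_ll : star l ⬝ᵥ l = 1
  star_dot_kk : star k ⬝ᵥ k = 1
  star_dot_lk : star l ⬝ᵥ k = 0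
  cross_lk : l ⨯₇ k = 0

namespace IsCoassociativeFrame

variable {l k : V7}

lemma dot_kl (h : IsCoassociativeFrame l k) : k ⬝ᵥ l = 0 := by rw [dotProduct_comm, h.dot_lk]

lemma star_dot_kl (h : IsCoassociativeFrame l k) : star k ⬝ᵥ l = 0 := by
  rw [star_dotProduct, h.star_dot_lk, star_zero]

protected lemma star (h : IsCoassociativeFrame l k) : IsCoassociativeFrame (star l) (star k) where
  dot_ll := by rw [star_dotProduct_star, h.dot_ll, star_zero]
  dot_kk := by rw [star_dotProduct_star, h.dot_kk, star_zero]
  dot_lk := by rw [star_dotProduct_star, h.dot_kl, star_zero]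
  star_dot_ll := by rw [star_star, dotProduct_comm, h.star_dot_ll]
  star_dot_kk := by rw [star_star, dotProduct_comm, h.star_dot_kk]
  star_dot_lk := by rw [star_star, dotProduct_comm, h.star_dot_kl]
  cross_lk := by rw [← star_cross, h.cross_lk, star_zero]

protected lemma swap (h : IsCoassociativeFrame l k) : IsCoassociativeFrame k l :=
  ⟨h.dot_kk, h.dot_ll, h.dot_kl, h.star_dot_kk, h.star_dot_ll, h.star_dot_kl, by
    rw [cross_anticomm, h.cross_lk, neg_zero]⟩

lemma dot_star_ll (h : IsCoassociativeFrame l k) : l ⬝ᵥ star l = 1 := by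
  rw [dotProduct_comm, h.star_dot_ll]

lemma dot_star_lk (h : IsCoassociativeFrame l k) : l ⬝ᵥ star k = 0 := by
  rw [dotProduct_comm, h.star_dot_kl]

lemma dot_star_kl (h : IsCoassociativeFrame l k) : k ⬝ᵥ star l = 0 := by
  rw [dotProduct_comm, h.star_dot_lk]

lemma dot_star_kk (h : IsCoassociativeFrame l k) : k ⬝ᵥ star k = 1 := by
  rw [dotProduct_comm, h.star_dot_kk]

lemma mulVec {A : Mat7} (h : IsCoassociativeFrame l k) (hA : IsG2 A)
    (hreal : ∀ x, star (A *ᵥ x) = A *ᵥ star x) : IsCoassociativeFrame (A *ᵥ l) (A *ᵥ k) where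
  dot_ll := by rw [hA.dot, h.dot_ll]
  dot_kk := by rw [hA.dot, h.dot_kk]
  dot_lk := by rw [hA.dot, h.dot_lk]
  star_dot_ll := by rw [hreal, hA.dot, h.star_dot_ll]
  star_dot_kk := by rw [hreal, hA.dot, h.star_dot_kk]
  star_dot_lk := by rw [hreal, hA.dot, h.star_dot_lk]
  cross_lk := by rw [hA.cross, h.cross_lk, mulVec_zero]

end IsCoassociativeFrame

lemma isG2_one_add_smul_of_null {l k : V7} (hll : l ⬝ᵥ l = 0) (hkk : k ⬝ᵥ k = 0)
    (hlk : l ⬝ᵥ k = 0) (hcross : l ⨯₇ k = 0) (b : ℂ) :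
    IsG2 (1 + b • (vecMulVec l k - vecMulVec k l)) := by
  have happly (x : V7) : (1 + b • (vecMulVec l k - vecMulVec k l)) *ᵥ x =
      x + b • ((k ⬝ᵥ x) • l - (l ⬝ᵥ x) • k) := by
    simp [add_mulVec, smul_mulVec, sub_mulVec, vecMulVec_mulVec]
  constructor
  · intro x y
    simp only [happly, dotProduct_add, add_dotProduct, smul_dotProduct, dotProduct_smul,
      sub_dotProduct, dotProduct_sub, hll, hkk, hlk, dotProduct_comm k l, dotProduct_comm x l,
      dotProduct_comm x k, smul_eq_mul]
    ring
  · intro x y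
    rw [happly, happly, happly, derivation_of_null hcross hlk]
    simp only [map_add, map_smul, map_sub, LinearMap.add_apply, LinearMap.smul_apply,
      LinearMap.sub_apply, cross_self, hcross, cross_anticomm k l]
    module

/-- The matrix `!![a, b; c, d]`, acting on `ℂ⁷` through a coassociative frame `l, k`. It is the
identity on the orthogonal complement of `l, k, l̄, k̄` and maps `l ↦ a l + c k̄`,
`k̄ ↦ b l + d k̄`, `k ↦ a k - c l̄`, `l̄ ↦ d l̄ - b k`. -/
def slElement (l k : V7) (a b c d : ℂ) : Mat7 :=
  1 + (a - 1) • (vecMulVec l (star l) + vecMulVec k (star k)) +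
    (d - 1) • (vecMulVec (star l) l + vecMulVec (star k) k) +
    b • (vecMulVec l k - vecMulVec k l) +
    c • (vecMulVec (star k) (star l) - vecMulVec (star l) (star k))

lemma slElement_mulVec (l k : V7) (a b c d : ℂ) (x : V7) : slElement l k a b c d *ᵥ x =
    x + (a - 1) • ((star l ⬝ᵥ x) • l + (star k ⬝ᵥ x) • k) +
    (d - 1) • ((l ⬝ᵥ x) • star l + (k ⬝ᵥ x) • star k) +
    b • ((k ⬝ᵥ x) • l - (l ⬝ᵥ x) • k) +
    c • ((star l ⬝ᵥ x) • star k - (star k ⬝ᵥ x) • star l) := by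
  simp [slElement, add_mulVec, smul_mulVec, sub_mulVec, vecMulVec_mulVec]

lemma star_slElement_mulVec (l k : V7) (a b : ℂ) (x : V7) :
    star (slElement l k a b (-star b) (star a) *ᵥ x) =
      slElement l k a b (-star b) (star a) *ᵥ star x := by
  simp only [slElement_mulVec, star_add, star_sub, star_smul, star_neg, star_one, star_star,
    ← star_dotProduct_star, dotProduct_comm (star x)]
  module

namespace IsCoassociativeFrame

variable {l k : V7}

lemma slElement_mul_slElement (h : IsCoassociativeFrame l k) (a b c d a' b' c' d' : ℂ) :
    slElement l k a b c d * slElement l k a' b' c' d' =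
      slElement l k (a * a' + b * c') (a * b' + b * d') (c * a' + d * c') (c * b' + d * d') := by
  refine Matrix.mulVec_injective (funext fun x => ?_)
  rw [← mulVec_mulVec]
  simp only [slElement_mulVec l k, dotProduct_add, dotProduct_sub, dotProduct_smul, h.dot_ll,
    h.dot_kk, h.dot_lk, h.dot_kl, h.star_dot_ll, h.star_dot_kk, h.star_dot_lk, h.star_dot_kl,
    h.dot_star_ll, h.dot_star_lk, h.dot_star_kl, h.dot_star_kk, h.star.dot_ll, h.star.dot_kk,
    h.star.dot_lk, h.star.dot_kl, smul_eq_mul]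
  module

lemma isG2_slElement_upper (h : IsCoassociativeFrame l k) (b : ℂ) :
    IsG2 (slElement l k 1 b 0 1) := by
  simpa [slElement] using isG2_one_add_smul_of_null h.dot_ll h.dot_kk h.dot_lk h.cross_lk b

lemma isG2_slElement_lower (h : IsCoassociativeFrame l k) (c : ℂ) :
    IsG2 (slElement l k 1 0 c 1) := by
  have hcross : star k ⨯₇ star l = 0 := by rw [cross_anticomm, h.star.cross_lk, neg_zero]
  simpa [slElement] using
    isG2_one_add_smul_of_null h.star.dot_kk h.star.dot_ll h.star.dot_kl hcross c

lemma isG2_slElement (h : IsCoassociativeFrame l k) {a b c d : ℂ} (hdet : a * d - b * c = 1) :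
    IsG2 (slElement l k a b c d) := by
  -- Transvections generate the special linear group.
  have of_ne_zero {a b c d : ℂ} (hdet : a * d - b * c = 1) (hc : c ≠ 0) :
      IsG2 (slElement l k a b c d) := by
    have hprod := ((h.isG2_slElement_upper ((a - 1) / c)).mul (h.isG2_slElement_lower c)).mul
      (h.isG2_slElement_upper ((d - 1) / c))
    rw [h.slElement_mul_slElement, h.slElement_mul_slElement] at hprod
    convert hprod using 1
    congr 1 <;> field_simp
    · ring
    · linear_combination -hdet
    · ring
    · ring
  rcases eq_or_ne c 0 with rfl | hc
  · have hd : d ≠ 0 := by rintro rfl; simp at hdet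
    have hprod := (of_ne_zero (a := a + b) (b := b) (d := d) (by linear_combination hdet) hd).mul
      (h.isG2_slElement_lower (-1))
    rw [h.slElement_mul_slElement] at hprod
    convert hprod using 1
    congr 1 <;> ring
  · exact of_ne_zero hdet hc

end IsCoassociativeFrame

/-! ### Simple elements -/

section SimpleElement

variable {n : Type*} [Fintype n]

lemma star_dotProduct_self_eq_norm_sq (w : n → ℂ) :
    star w ⬝ᵥ w = (‖(WithLp.toLp 2 w : EuclideanSpace ℂ n)‖ : ℂ) ^ 2 := by
  have hinner := inner_self_eq_norm_sq_to_K (𝕜 := ℂ) (WithLp.toLp 2 w)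
  rwa [EuclideanSpace.inner_eq_star_dotProduct, dotProduct_comm] at hinner

lemma star_dotProduct_self_ne_zero {w : n → ℂ} (hw : w ≠ 0) : star w ⬝ᵥ w ≠ 0 := by
  rw [star_dotProduct_self_eq_norm_sq]
  simpa using hw

lemma ne_zero_of_star_dotProduct_self {w : n → ℂ} (hw : star w ⬝ᵥ w = 1) : w ≠ 0 := by
  rintro rfl; simp at hw

lemma exists_ofReal_smul_unit {w : n → ℂ} (hw : w ≠ 0) :
    ∃ r : ℝ, r ≠ 0 ∧ star ((r : ℂ) • w) ⬝ᵥ ((r : ℂ) • w) = 1 := by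
  have hnorm : ‖(WithLp.toLp 2 w : EuclideanSpace ℂ n)‖ ≠ 0 := by simpa using hw
  refine ⟨_, inv_ne_zero hnorm, ?_⟩
  have hnormC : (‖(WithLp.toLp 2 w : EuclideanSpace ℂ n)‖ : ℂ) ≠ 0 := by exact_mod_cast hnorm
  rw [star_smul, smul_dotProduct, dotProduct_smul, star_dotProduct_self_eq_norm_sq,
    RCLike.star_def, Complex.conj_ofReal, Complex.ofReal_inv, smul_eq_mul, smul_eq_mul]
  field_simp

lemma star_dotProduct_star_eq_zero {w : n → ℂ} (hw : w ⬝ᵥ w = 0) : star w ⬝ᵥ star w = 0 := by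
  rw [star_dotProduct_star, hw, star_zero]

lemma star_mulVec_eq_map_star_mulVec (A : Matrix n n ℂ) (x : n → ℂ) :
    star (A *ᵥ x) = A.map star *ᵥ star x := by
  rw [star_mulVec, ← mulVec_transpose, conjTranspose_transpose]

variable [DecidableEq n]

/-- The simple element of an isotropic vector `w`, with eigenvalues `u` on `w̄` and `u⁻¹` on `w`.
It only depends on the line of `w`. -/
def simpleElement (w : n → ℂ) (u : ℂ) : Matrix n n ℂ :=
  1 + ((u - 1) / (star w ⬝ᵥ w)) • vecMulVec (star w) w +
    ((u⁻¹ - 1) / (star w ⬝ᵥ w)) • vecMulVec w (star w)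

lemma simpleElement_mulVec (w : n → ℂ) (u : ℂ) (x : n → ℂ) : simpleElement w u *ᵥ x =
    x + ((u - 1) / (star w ⬝ᵥ w) * (w ⬝ᵥ x)) • star w +
      ((u⁻¹ - 1) / (star w ⬝ᵥ w) * (star w ⬝ᵥ x)) • w := by
  simp [simpleElement, add_mulVec, smul_mulVec, vecMulVec_mulVec, smul_smul]

lemma simpleElement_one (w : n → ℂ) : simpleElement w 1 = 1 := by simp [simpleElement]

lemma simpleElement_mul_simpleElement {w : n → ℂ} (hw : w ≠ 0) (hiso : w ⬝ᵥ w = 0) {u v : ℂ}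
    (hu : u ≠ 0) (hv : v ≠ 0) :
    simpleElement w u * simpleElement w v = simpleElement w (u * v) := by
  have hnorm := star_dotProduct_self_ne_zero hw
  refine Matrix.mulVec_injective (funext fun x => ?_)
  rw [← mulVec_mulVec]
  simp only [simpleElement_mulVec w, dotProduct_add, dotProduct_smul, hiso,
    star_dotProduct_star_eq_zero hiso, dotProduct_comm w (star w), smul_eq_mul]
  match_scalars
  · ring
  · field_simp; ring
  · field_simp; ring

lemma transpose_simpleElement (w : n → ℂ) (u : ℂ) :
    (simpleElement w u)ᵀ = simpleElement w u⁻¹ := by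
  simp only [simpleElement, transpose_add, transpose_smul, transpose_one, transpose_vecMulVec,
    inv_inv]
  abel

lemma simpleElement_star (w : n → ℂ) (u : ℂ) : simpleElement (star w) u = simpleElement w u⁻¹ := by
  simp only [simpleElement, star_star, inv_inv, dotProduct_comm w (star w)]
  abel

lemma map_star_simpleElement (w : n → ℂ) (u : ℂ) :
    (simpleElement w u).map star = simpleElement w (star u)⁻¹ := by
  have hnorm : star (star w ⬝ᵥ w) = star w ⬝ᵥ w := by rw [← star_dotProduct]
  ext i j
  simp only [RCLike.star_def] at hnorm
  simp only [simpleElement, vecMulVec_apply, one_apply, map_apply, Matrix.add_apply,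
    Matrix.smul_apply, apply_ite, Pi.star_apply, RCLike.star_def, smul_eq_mul, map_add, map_mul,
    map_div₀, map_sub, map_inv₀, map_one, map_zero, Complex.conj_conj, hnorm, inv_inv]
  ring

lemma simpleElement_smul {c : ℂ} (hc : c ≠ 0) (w : n → ℂ) (u : ℂ) :
    simpleElement (c • w) u = simpleElement w u := by
  have hstar : star c ≠ 0 := star_ne_zero.2 hc
  have cancel (x y : ℂ) : x / (c * (star c * y)) * (star c * c) = x / y := by field_simp
  simp only [simpleElement, star_smul, smul_dotProduct, dotProduct_smul, smul_vecMulVec,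
    vecMulVec_smul, smul_smul, smul_eq_mul, mul_comm c (star c), cancel]

lemma mul_simpleElement_mul_transpose {A : Matrix n n ℂ} (hA : Aᵀ * A = 1)
    (hreal : A.map star = A) (w : n → ℂ) (u : ℂ) :
    A * simpleElement w u * Aᵀ = simpleElement (A *ᵥ w) u := by
  have hstar : star (A *ᵥ w) = A *ᵥ star w := by rw [star_mulVec_eq_map_star_mulVec, hreal]
  have hnorm : star (A *ᵥ w) ⬝ᵥ A *ᵥ w = star w ⬝ᵥ w := by
    rw [hstar, (forall_mulVec_dotProduct_mulVec_iff A).2 hA]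
  rw [simpleElement, simpleElement, hnorm, hstar]
  simp only [mul_add, add_mul, mul_one, mul_eq_one_comm.1 hA, mul_smul_comm, smul_mul_assoc,
    mul_vecMulVec, vecMulVec_mul, vecMul_transpose]

end SimpleElement

lemma one_add_mul_star_ne_zero (c : ℂ) : 1 + c * star c ≠ 0 := by
  have hpos : (0 : ℝ) < 1 + Complex.normSq c := by linarith [Complex.normSq_nonneg c]
  rw [RCLike.star_def, Complex.mul_conj]
  exact_mod_cast hpos.ne'

namespace IsCoassociativeFrame

variable {l k : V7}

lemma simpleElement_mul_simpleElement (h : IsCoassociativeFrame l k) (c : ℂ) {u : ℂ}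
    (hu : u ≠ 0) : simpleElement l u * simpleElement (k + c • star l) u =
      slElement l k ((u⁻¹ + c * star c) / (1 + c * star c))
        ((star c - star c * u⁻¹) / (1 + c * star c)) ((u * c - c) / (1 + c * star c))
        ((u + c * star c) / (1 + c * star c)) := by
  have hnorm := one_add_mul_star_ne_zero c
  refine Matrix.mulVec_injective (funext fun x => ?_)
  rw [← mulVec_mulVec]
  simp only [simpleElement_mulVec _ u, slElement_mulVec l k, star_add, star_smul, star_star,
    dotProduct_add, add_dotProduct, smul_dotProduct, dotProduct_smul, h.dot_ll, h.dot_lk,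
    h.star_dot_ll, h.star_dot_kk, h.star_dot_lk, h.dot_star_ll, h.dot_star_lk, h.star.dot_ll,
    h.star.dot_lk, h.star.dot_kl, smul_eq_mul, mul_zero, mul_one, add_zero, zero_add]
  generalize star c = c' at *
  match_scalars <;> field_simp <;> ring

lemma isG2_simpleElement_mul_simpleElement (h : IsCoassociativeFrame l k) (c : ℂ) {u : ℂ}
    (hu : u ≠ 0) : IsG2 (simpleElement l u * simpleElement (k + c • star l) u) := by
  have hnorm := one_add_mul_star_ne_zero c
  rw [h.simpleElement_mul_simpleElement c hu]
  apply h.isG2_slElement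
  field_simp
  ring

end IsCoassociativeFrame

/-! ### Lines in coordinates -/

/-- The line spanned by a vector. -/
def line (w : V7) : Submodule ℂ C7 := ℂ ∙ (WithLp.toLp 2 w : C7)

lemma mem_line {w : V7} {x : C7} : x ∈ line w ↔ ∃ c : ℂ, x.ofLp = c • w := by
  rw [line, Submodule.mem_span_singleton]
  exact exists_congr fun c => by
    rw [eq_comm, ← WithLp.toLp_smul, ← WithLp.ofLp_injective 2 |>.eq_iff]

lemma toLp_mem_line (w : V7) : (WithLp.toLp 2 w : C7) ∈ line w :=
  Submodule.mem_span_singleton_self _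

lemma conjSub_line (w : V7) : conjSub (line w) = line (star w) := by
  rw [conjSub, line, Submodule.map_span, Set.image_singleton]
  rfl

lemma matSub_line (A : Mat7) (w : V7) : matSub A (line w) = line (A *ᵥ w) := by
  rw [matSub, line, Submodule.map_span, Set.image_singleton]
  rfl

lemma line_zero : line 0 = ⊥ := by simp [line]

lemma line_smul {c : ℂ} (hc : c ≠ 0) (w : V7) : line (c • w) = line w := by
  rw [line, line, WithLp.toLp_smul]
  exact Submodule.span_singleton_smul_eq (IsUnit.mk0 c hc) _

lemma exists_smul_of_line_eq {v w : V7} (hv : v ≠ 0) (h : line v = line w) :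
    ∃ c : ℂ, c ≠ 0 ∧ v = c • w := by
  obtain ⟨c, hc⟩ := mem_line.1 (h ▸ toLp_mem_line v)
  refine ⟨c, ?_, hc⟩
  rintro rfl
  exact hv (by simpa using hc)

lemma finrank_line {w : V7} (hw : w ≠ 0) : Module.finrank ℂ (line w) = 1 :=
  finrank_span_singleton (by simpa using hw)

lemma bil_eq_dotProduct (x y : C7) : bil x y = x.ofLp ⬝ᵥ y.ofLp := rfl

lemma imMul_eq_cross (x y : C7) : imMul x y = x.ofLp ⨯₇ y.ofLp := rfl

lemma inner_eq_star_dotProduct (x y : C7) : inner ℂ x y = star x.ofLp ⬝ᵥ y.ofLp := by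
  rw [EuclideanSpace.inner_eq_star_dotProduct, dotProduct_comm]

lemma proj_eq_of_mem_orthogonal {W : Submodule ℂ C7} {P : Mat7}
    (hmem : ∀ x : C7, (WithLp.toLp 2 (P *ᵥ x.ofLp) : C7) ∈ W)
    (hperp : ∀ x : C7, x - WithLp.toLp 2 (P *ᵥ x.ofLp) ∈ Wᗮ) : proj W = P := by
  rw [proj, ← StarAlgEquiv.symm_apply_apply (toEuclideanCLM (n := Fin 7) (𝕜 := ℂ)) P]
  congr 1
  ext1 x
  rw [Submodule.eq_starProjection_of_mem_orthogonal (hmem x) (hperp x)]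
  rfl

lemma proj_line {w : V7} (hw : w ≠ 0) :
    proj (line w) = (1 / (star w ⬝ᵥ w)) • vecMulVec w (star w) := by
  have hnorm := star_dotProduct_self_ne_zero hw
  have happly (x : V7) : ((1 / (star w ⬝ᵥ w)) • vecMulVec w (star w)) *ᵥ x =
      (1 / (star w ⬝ᵥ w) * (star w ⬝ᵥ x)) • w := by
    simp [smul_mulVec, vecMulVec_mulVec, smul_smul]
  apply proj_eq_of_mem_orthogonal
  · intro x
    exact mem_line.2 ⟨_, happly _⟩
  · intro x
    rw [line, Submodule.mem_orthogonal_singleton_iff_inner_right, inner_eq_star_dotProduct,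
      WithLp.ofLp_sub, dotProduct_sub, happly, dotProduct_smul, smul_eq_mul]
    field_simp
    ring

lemma proj_line_sup_star_orthogonal {w : V7} (hw : w ≠ 0) (hiso : w ⬝ᵥ w = 0) :
    proj (line w ⊔ line (star w))ᗮ = 1 - (1 / (star w ⬝ᵥ w)) • vecMulVec w (star w)
      - (1 / (star w ⬝ᵥ w)) • vecMulVec (star w) w := by
  have hnorm := star_dotProduct_self_ne_zero hw
  have happly (x : V7) : (1 - (1 / (star w ⬝ᵥ w)) • vecMulVec w (star w)
      - (1 / (star w ⬝ᵥ w)) • vecMulVec (star w) w) *ᵥ x =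
      x - ((1 / (star w ⬝ᵥ w) * (star w ⬝ᵥ x)) • w +
        (1 / (star w ⬝ᵥ w) * (w ⬝ᵥ x)) • star w) := by
    simp only [sub_mulVec, smul_mulVec, vecMulVec_mulVec, one_mulVec, op_smul_eq_smul, smul_smul]
    abel
  apply proj_eq_of_mem_orthogonal
  · intro x
    rw [← Submodule.inf_orthogonal, Submodule.mem_inf, line, line,
      Submodule.mem_orthogonal_singleton_iff_inner_right,
      Submodule.mem_orthogonal_singleton_iff_inner_right, inner_eq_star_dotProduct,
      inner_eq_star_dotProduct]
    simp only [happly, dotProduct_sub, dotProduct_add, dotProduct_smul, hiso,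
      star_dotProduct_star_eq_zero hiso, dotProduct_comm w (star w), star_star, smul_eq_mul]
    constructor <;> field_simp <;> ring
  · intro x
    rw [Submodule.orthogonal_orthogonal, happly, WithLp.toLp_sub, WithLp.toLp_ofLp, sub_sub_cancel,
      WithLp.toLp_add]
    exact Submodule.add_mem_sup (mem_line.2 ⟨_, rfl⟩) (mem_line.2 ⟨_, rfl⟩)

lemma pLine_line {w : V7} (hw : w ≠ 0) (hiso : w ⬝ᵥ w = 0) (α z : ℂ) :
    pLine α (line w) z = simpleElement w ((z - conj α) / (z - α)) := by
  rw [pLine, conjSub_line, proj_line_sup_star_orthogonal hw hiso, proj_line hw,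
    proj_line (star_ne_zero.2 hw), simpleElement, inv_div, star_star, dotProduct_comm w (star w)]
  module

lemma pPair_line_line {v w : V7} (hv : v ≠ 0) (hv_iso : v ⬝ᵥ v = 0) (hw : w ≠ 0)
    (hw_iso : w ⬝ᵥ w = 0) (α z : ℂ) : pPair α (line v) (line w) z =
      simpleElement v ((z - conj α) / (z - α)) * simpleElement w ((z - conj α) / (z - α)) := by
  rw [pPair, pLine_line hv hv_iso, pLine_line hw hw_iso]

/-! ### Admissible pairs and frames -/

lemma isIsotropicLine_line {w : V7} (hw : w ≠ 0) (hiso : w ⬝ᵥ w = 0) :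
    IsIsotropicLine (line w) := by
  refine ⟨finrank_line hw, fun x hx y hy => ?_⟩
  obtain ⟨a, ha⟩ := mem_line.1 hx
  obtain ⟨b, hb⟩ := mem_line.1 hy
  rw [bil_eq_dotProduct, ha, hb, smul_dotProduct, dotProduct_smul, hiso, smul_zero, smul_zero]

lemma IsIsotropicLine.exists_unit {L : Submodule ℂ C7} (hL : IsIsotropicLine L) :
    ∃ w : V7, star w ⬝ᵥ w = 1 ∧ w ⬝ᵥ w = 0 ∧ L = line w := by
  have hL0 : L ≠ ⊥ := by rintro rfl; simpa using hL.1
  obtain ⟨v, hvL, hv0⟩ := Submodule.exists_mem_ne_zero_of_ne_bot hL0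
  have hv0' : v.ofLp ≠ 0 := by simpa using hv0
  obtain ⟨r, hr, hunit⟩ := exists_ofReal_smul_unit hv0'
  refine ⟨_, hunit, ?_, ?_⟩
  · have hiso : v.ofLp ⬝ᵥ v.ofLp = 0 := hL.2 v hvL v hvL
    simp [hiso]
  · rw [line_smul (Complex.ofReal_ne_zero.2 hr)]
    refine (Submodule.eq_of_le_of_finrank_eq ?_ ((finrank_line hv0').trans hL.1.symm)).symm
    exact (Submodule.span_singleton_le_iff_mem _ _).2 hvL

lemma mem_line_sup_line {l k : V7} {x : C7} :
    x ∈ line l ⊔ line k ↔ ∃ a b : ℂ, x.ofLp = a • l + b • k := by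
  rw [line, line, ← Submodule.span_union, Set.singleton_union, Submodule.mem_span_pair]
  exact exists_congr fun a => exists_congr fun b => by
    rw [eq_comm, ← WithLp.toLp_smul, ← WithLp.toLp_smul, ← WithLp.toLp_add,
      ← WithLp.ofLp_injective 2 |>.eq_iff]

lemma finrank_line_sup_line {l k : V7} (hl : l ≠ 0) (hk : k ≠ 0) (hlk : star l ⬝ᵥ k = 0) :
    Module.finrank ℂ ↥(line l ⊔ line k) = 2 := by
  have hortho : line l ⟂ line k := by
    rw [line, line, Submodule.isOrtho_span]
    rintro _ rfl _ rfl
    rwa [inner_eq_star_dotProduct]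
  have h := Submodule.finrank_sup_add_finrank_inf_eq (line l) (line k)
  rwa [hortho.disjoint.eq_bot, finrank_bot, finrank_line hl, finrank_line hk] at h

lemma isCoassociative_line_sup_line_iff {l k : V7} (hl : star l ⬝ᵥ l = 1) (hk : star k ⬝ᵥ k = 1)
    (hlk : star l ⬝ᵥ k = 0) :
    IsCoassociative (line l ⊔ line k) ↔ IsCoassociativeFrame l k := by
  constructor
  · rintro ⟨-, hiso, hcross⟩
    have hl_mem : WithLp.toLp 2 l ∈ line l ⊔ line k := Submodule.mem_sup_left (toLp_mem_line l)
    have hk_mem : WithLp.toLp 2 k ∈ line l ⊔ line k := Submodule.mem_sup_right (toLp_mem_line k)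
    have dot {x y : V7} (hx : WithLp.toLp 2 x ∈ line l ⊔ line k)
        (hy : WithLp.toLp 2 y ∈ line l ⊔ line k) : x ⬝ᵥ y = 0 :=
      (bil_eq_dotProduct _ _).symm.trans (hiso _ hx _ hy)
    exact ⟨dot hl_mem hl_mem, dot hk_mem hk_mem, dot hl_mem hk_mem, hl, hk, hlk,
      (imMul_eq_cross _ _).symm.trans (hcross _ hl_mem _ hk_mem)⟩
  · intro h
    refine ⟨finrank_line_sup_line (ne_zero_of_star_dotProduct_self hl)
      (ne_zero_of_star_dotProduct_self hk) hlk, fun x hx y hy => ?_, fun x hx y hy => ?_⟩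
    all_goals
      obtain ⟨a, b, hxab⟩ := mem_line_sup_line.1 hx
      obtain ⟨a', b', hyab⟩ := mem_line_sup_line.1 hy
    · rw [bil_eq_dotProduct, hxab, hyab]
      simp [h.dot_ll, h.dot_lk, h.dot_kl, h.dot_kk]
    · rw [imMul_eq_cross, hxab, hyab]
      simp [cross_self, h.cross_lk, cross_anticomm k l]

namespace IsCoassociativeFrame

variable {l k : V7}

lemma add_smul_star_ne_zero (h : IsCoassociativeFrame l k) (c : ℂ) : k + c • star l ≠ 0 := by
  intro h0
  have hdot := congrArg (star k ⬝ᵥ ·) h0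
  simp [h.star_dot_kk, h.star.dot_kl] at hdot

lemma add_smul_star_isotropic (h : IsCoassociativeFrame l k) (c : ℂ) :
    (k + c • star l) ⬝ᵥ (k + c • star l) = 0 := by
  simp [h.dot_kk, h.dot_star_kl, h.star_dot_lk, h.star.dot_ll]

lemma isPair (h : IsCoassociativeFrame l k) (c : ℂ) :
    IsPair (line l) (line (k + c • star l)) := by
  have hl := ne_zero_of_star_dotProduct_self h.star_dot_ll
  refine ⟨isIsotropicLine_line hl h.dot_ll,
    isIsotropicLine_line (h.add_smul_star_ne_zero c) (h.add_smul_star_isotropic c),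
    fun x hx y hy => ?_, ?_⟩
  · rw [conjSub_line] at hy
    obtain ⟨a, ha⟩ := mem_line.1 hx
    obtain ⟨b, hb⟩ := mem_line.1 hy
    rw [bil_eq_dotProduct, ha, hb]
    simp [h.dot_star_kl, h.star.dot_ll]
  · have hproj : (1 - (1 / (star l ⬝ᵥ l)) • vecMulVec l (star l)
        - (1 / (star l ⬝ᵥ l)) • vecMulVec (star l) l) *ᵥ (k + c • star l) = k := by
      simp only [sub_mulVec, smul_mulVec, vecMulVec_mulVec, one_mulVec, dotProduct_add,
        dotProduct_smul, h.star_dot_ll, h.star_dot_lk, h.star.dot_ll, h.dot_lk, h.dot_star_ll,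
        op_smul_eq_smul]
      module
    rw [conjSub_line, proj_line_sup_star_orthogonal hl h.dot_ll, matSub_line, hproj]
    exact (isCoassociative_line_sup_line_iff h.star_dot_ll h.star_dot_kk h.star_dot_lk).2 h

end IsCoassociativeFrame

lemma exists_frame_of_isPair {L K : Submodule ℂ C7} (h : IsPair L K) :
    ∃ (l k : V7) (c : ℂ), IsCoassociativeFrame l k ∧ L = line l ∧ K = line (k + c • star l) := by
  obtain ⟨hL, hK, hperp, hcoass⟩ := h
  obtain ⟨l, hl, hl_iso, rfl⟩ := hL.exists_unit
  obtain ⟨w, -, -, rfl⟩ := hK.exists_unit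
  have hl0 := ne_zero_of_star_dotProduct_self hl
  rw [conjSub_line] at hperp hcoass
  have hlw : star l ⬝ᵥ w = 0 := by
    rw [dotProduct_comm]
    exact hperp _ (toLp_mem_line w) _ (toLp_mem_line (star l))
  have hproj : (1 - (1 / (star l ⬝ᵥ l)) • vecMulVec l (star l) -
      (1 / (star l ⬝ᵥ l)) • vecMulVec (star l) l) *ᵥ w = w - (l ⬝ᵥ w) • star l := by
    simp only [sub_mulVec, smul_mulVec, vecMulVec_mulVec, one_mulVec, hlw, hl, op_smul_eq_smul]
    module
  rw [proj_line_sup_star_orthogonal hl0 hl_iso, matSub_line, hproj] at hcoass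
  have hv0 : w - (l ⬝ᵥ w) • star l ≠ 0 := by
    intro hv0
    have hfinrank := hcoass.1
    rw [hv0, line_zero, sup_bot_eq, finrank_line hl0] at hfinrank
    omega
  obtain ⟨r, hr, hk⟩ := exists_ofReal_smul_unit hv0
  have hrC := Complex.ofReal_ne_zero.2 hr
  have hlk : star l ⬝ᵥ ((r : ℂ) • (w - (l ⬝ᵥ w) • star l)) = 0 := by
    simp [hlw, star_dotProduct_star_eq_zero hl_iso]
  rw [← line_smul hrC (w - _), isCoassociative_line_sup_line_iff hl hk hlk] at hcoass
  refine ⟨l, _, r * (l ⬝ᵥ w), hcoass, rfl, ?_⟩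
  rw [← line_smul hrC w]
  congr 1
  module

lemma exists_ofReal_sq_eq_one_add_mul_star (c : ℂ) :
    ∃ r : ℝ, (r : ℂ) ≠ 0 ∧ (r : ℂ) ^ 2 = 1 + c * star c := by
  have hpos : (0 : ℝ) < 1 + Complex.normSq c := by linarith [Complex.normSq_nonneg c]
  refine ⟨√(1 + Complex.normSq c), Complex.ofReal_ne_zero.2 (Real.sqrt_pos.2 hpos).ne', ?_⟩
  rw [← Complex.ofReal_pow, Real.sq_sqrt hpos.le, RCLike.star_def, Complex.mul_conj]
  push_cast; rfl

namespace IsCoassociativeFrame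

variable {l k : V7}

lemma rotate (h : IsCoassociativeFrame l k) {c : ℂ} {r : ℝ} (hr : (r : ℂ) ≠ 0)
    (hrc : (r : ℂ) ^ 2 = 1 + c * star c) :
    IsCoassociativeFrame ((r : ℂ)⁻¹ • (l + c • star k)) ((r : ℂ)⁻¹ • (k - c • star l)) := by
  -- The rotation of the frame is the action of a unitary matrix of determinant `1`.
  have hG2 : IsG2 (slElement l k (r : ℂ)⁻¹ (-(star c / r)) (-star (-(star c / r)))
      (star (r : ℂ)⁻¹)) := by
    apply h.isG2_slElement
    simp only [star_inv₀, star_neg, star_div₀, RCLike.star_def, Complex.conj_ofReal,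
      Complex.conj_conj]
    rw [RCLike.star_def] at hrc
    field_simp
    linear_combination -hrc
  convert h.mulVec hG2 (star_slElement_mulVec _ _ _ _) using 1
  · simp only [slElement_mulVec, h.dot_ll, h.star_dot_ll, h.star_dot_kl, h.dot_kl, star_neg,
      star_div₀, RCLike.star_def, Complex.conj_ofReal, Complex.conj_conj]
    module
  · simp only [slElement_mulVec, h.dot_kk, h.star_dot_kk, h.star_dot_lk, h.dot_lk, star_neg,
      star_div₀, RCLike.star_def, Complex.conj_ofReal, Complex.conj_conj]
    module

lemma isPair_add_smul_star (h : IsCoassociativeFrame l k) (c : ℂ) :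
    IsPair (line (l + c • star k)) (line k) := by
  obtain ⟨r, hr, hrc⟩ := exists_ofReal_sq_eq_one_add_mul_star c
  have hpair := (h.rotate hr hrc).isPair c
  have hk : (r : ℂ)⁻¹ • (k - c • star l) + c • star ((r : ℂ)⁻¹ • (l + c • star k)) =
      (r : ℂ) • k := by
    simp only [star_smul, star_inv₀, RCLike.star_def, Complex.conj_ofReal, star_add, star_star]
    rw [RCLike.star_def] at hrc
    match_scalars
    · field_simp
      linear_combination -hrc
    · ring
  rwa [line_smul (inv_ne_zero hr), hk, line_smul hr] at hpair

end IsCoassociativeFrame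

/-! ### The split real structure -/

/-- The antilinear involution `x ↦ s x̄`. Its fixed points form a real structure of `ℂ⁷` that is
compatible with the twisting condition. -/
def sConj (x : V7) : V7 := sMat *ᵥ star x

lemma star_sMat_mulVec (x : V7) : star (sMat *ᵥ x) = sMat *ᵥ star x := by
  rw [sMat_mulVec, sMat_mulVec]; ext i; fin_cases i <;> simp

lemma sMat_mulVec_sMat_mulVec (x : V7) : sMat *ᵥ (sMat *ᵥ x) = x := by
  rw [mulVec_mulVec, sMat_mul_self, one_mulVec]

lemma sConj_sConj (x : V7) : sConj (sConj x) = x := by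
  rw [sConj, sConj, star_sMat_mulVec, star_star, sMat_mulVec_sMat_mulVec]

lemma sConj_add (x y : V7) : sConj (x + y) = sConj x + sConj y := by simp [sConj, mulVec_add]

lemma sConj_smul (c : ℂ) (x : V7) : sConj (c • x) = star c • sConj x := by
  simp [sConj, mulVec_smul]

lemma sConj_dotProduct_sConj (x y : V7) : sConj x ⬝ᵥ sConj y = star (x ⬝ᵥ y) := by
  rw [sConj, sConj, isG2_sMat.dot, star_dotProduct_star, dotProduct_comm]

lemma sConj_cross (x y : V7) : sConj (x ⨯₇ y) = sConj x ⨯₇ sConj y := by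
  rw [sConj, sConj, sConj, isG2_sMat.cross, star_cross]

lemma star_sConj_dotProduct_sConj (x y : V7) :
    star (sConj x) ⬝ᵥ sConj y = star (star x ⬝ᵥ y) := by
  rw [← star_dotProduct, dotProduct_comm, sConj, sConj, star_sMat_mulVec, isG2_sMat.dot, star_star,
    dotProduct_comm, dotProduct_comm]

lemma sConj_mem_dotOrthogonal_star {m w : V7} (hm : sConj m = m)
    (hw : w ∈ dotOrthogonal (star m)) : sConj w ∈ dotOrthogonal (star m) := by
  rw [mem_dotOrthogonal] at *
  conv_lhs => rw [← hm]
  rw [star_sConj_dotProduct_sConj, hw, star_zero]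

lemma exists_unit_mem {W : Submodule ℂ V7} (hW : W ≠ ⊥) :
    ∃ v ∈ W, star v ⬝ᵥ v = 1 ∧ ((∀ w ∈ W, sConj w ∈ W) → sConj v = v) := by
  obtain ⟨w, hw, hw0⟩ := Submodule.exists_mem_ne_zero_of_ne_bot hW
  obtain ⟨v, hv, hv0, hv_fixed⟩ :
      ∃ v ∈ W, v ≠ 0 ∧ ((∀ w ∈ W, sConj w ∈ W) → sConj v = v) := by
    by_cases hinv : ∀ w ∈ W, sConj w ∈ W
    · -- `w + s w̄` is fixed; if it vanishes, then `i w` is fixed.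
      by_cases hsum : w + sConj w = 0
      · refine ⟨Complex.I • w, W.smul_mem _ hw, by simpa using hw0, fun _ => ?_⟩
        rw [sConj_smul, ← neg_eq_of_add_eq_zero_right hsum]
        simp
      · refine ⟨_, W.add_mem hw (hinv w hw), hsum, fun _ => ?_⟩
        rw [sConj_add, sConj_sConj, add_comm]
    · exact ⟨w, hw, hw0, fun h => absurd h hinv⟩
  obtain ⟨r, -, hunit⟩ := exists_ofReal_smul_unit hv0
  refine ⟨_, W.smul_mem _ hv, hunit, fun h => ?_⟩
  rw [sConj_smul, hv_fixed h, RCLike.star_def, Complex.conj_ofReal]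

lemma eq_add_of_orthonormal_of_finrank_le_two {n : Type*} [Fintype n] {W : Submodule ℂ (n → ℂ)}
    (hW : Module.finrank ℂ W ≤ 2) {m k : n → ℂ} (hmW : m ∈ W) (hkW : k ∈ W)
    (hm : star m ⬝ᵥ m = 1) (hk : star k ⬝ᵥ k = 1) (hmk : star m ⬝ᵥ k = 0) {w : n → ℂ}
    (hw : w ∈ W) : w = (star m ⬝ᵥ w) • m + (star k ⬝ᵥ w) • k := by
  have hkm : star k ⬝ᵥ m = 0 := by rw [star_dotProduct, hmk, star_zero]
  have hindep : LinearIndependent ℂ ![m, k] := by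
    refine LinearIndependent.pair_iff.2 fun a b hab => ⟨?_, ?_⟩
    · simpa [hm, hmk] using congrArg (star m ⬝ᵥ ·) hab
    · simpa [hk, hkm] using congrArg (star k ⬝ᵥ ·) hab
  have hle : Submodule.span ℂ {m, k} ≤ W := Submodule.span_le.2 (by
    rintro x (rfl | rfl) <;> assumption)
  have hspan : Module.finrank ℂ (Submodule.span ℂ {m, k}) = 2 := by
    have hrange : Set.range ![m, k] = {m, k} := by simp [Matrix.range_cons, Set.pair_comm]
    rw [← hrange, finrank_span_eq_card hindep, Fintype.card_fin]
  rw [← Submodule.eq_of_le_of_finrank_le hle (hW.trans hspan.ge), Submodule.mem_span_pair] at hw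
  obtain ⟨a, b, rfl⟩ := hw
  simp [hm, hk, hmk, hkm]

/-! ### Leading coefficients at a pole -/

/-- The relations between the first two coefficients `A`, `B` of `t ^ n • g` for a loop `g` in `𝔾₂`
with a pole of order `n ≥ 1` at `t = 0`. For `n = 1` the cross product of the residue appears at the
order of the second coefficient, which is `ε = 1`; otherwise `ε = 0`. -/
structure IsLeading (A B : Mat7) (ε : ℂ) : Prop where
  ne_zero : A ≠ 0
  dot₀ : ∀ x y : V7, A *ᵥ x ⬝ᵥ A *ᵥ y = 0
  mul_transpose : A * Aᵀ = 0
  dot₁ : ∀ x y : V7, A *ᵥ x ⬝ᵥ B *ᵥ y + B *ᵥ x ⬝ᵥ A *ᵥ y = 0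
  cross₀ : ∀ x y : V7, (A *ᵥ x) ⨯₇ (A *ᵥ y) = 0
  cross₁ : ∀ x y : V7, (A *ᵥ x) ⨯₇ (B *ᵥ y) + (B *ᵥ x) ⨯₇ (A *ᵥ y) = ε • (A *ᵥ (x ⨯₇ y))

/-- A coassociative frame `m, k` whose span contains the range of the leading coefficient `A`,
together with the number `κ` that determines the pairing of the span with the second
coefficient `B`. -/
structure IsAdaptedFrame (A B : Mat7) (m k : V7) (κ : ℂ) : Prop where
  frame : IsCoassociativeFrame m k
  mulVec_eq : ∀ x, A *ᵥ x = (star m ⬝ᵥ A *ᵥ x) • m + (star k ⬝ᵥ A *ᵥ x) • k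
  dot_fst : ∀ x, m ⬝ᵥ B *ᵥ x = -κ * (star k ⬝ᵥ A *ᵥ x)
  dot_snd : ∀ x, k ⬝ᵥ B *ᵥ x = κ * (star m ⬝ᵥ A *ᵥ x)

/-- The matrix `A` commutes with the real structure `sConj` up to the factor `e`. -/
def IsSConjSemiinvariant (e : ℂ) (A : Mat7) : Prop := ∀ x, sConj (A *ᵥ x) = e • (A *ᵥ sConj x)

lemma IsSConjSemiinvariant.sConj_mem_range {e : ℂ} {A : Mat7} (hA : IsSConjSemiinvariant e A)
    {w : V7} (hw : w ∈ LinearMap.range A.mulVecLin) : sConj w ∈ LinearMap.range A.mulVecLin := by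
  obtain ⟨x, rfl⟩ := hw
  exact ⟨e • sConj x, by rw [mulVecLin_apply, mulVecLin_apply, mulVec_smul, hA]⟩

lemma IsAdaptedFrame.star_eq_neg {A B : Mat7} {m k x₀ : V7} {κ : ℂ}
    (h : IsAdaptedFrame A B m k κ) (hx₀ : A *ᵥ x₀ = m) (hm : sConj m = m) (hk : sConj k = k)
    {e : ℂ} (he : e * e = 1) (hA : IsSConjSemiinvariant e A) (hB : IsSConjSemiinvariant (-e) B) :
    star κ = -κ := by
  have hκ : k ⬝ᵥ B *ᵥ x₀ = κ := by rw [h.dot_snd, hx₀, h.frame.star_dot_ll, mul_one]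
  have hAx₀ : A *ᵥ sConj x₀ = e • m := by
    rw [← hm, ← hx₀, hA, smul_smul, he, one_smul]
  calc star κ = k ⬝ᵥ (-e) • (B *ᵥ sConj x₀) := by rw [← hκ, ← sConj_dotProduct_sConj, hk, hB]
    _ = -(e * e) * κ := by
      rw [dotProduct_smul, h.dot_snd, hAx₀, dotProduct_smul, h.frame.star_dot_ll]
      simp only [smul_eq_mul]
      ring
    _ = -κ := by rw [he, neg_one_mul]

namespace IsLeading

variable {A B : Mat7} {ε : ℂ} (h : IsLeading A B ε)
include h

lemma dot_self (x : V7) : A *ᵥ x ⬝ᵥ B *ᵥ x = 0 := by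
  have hx := h.dot₁ x x
  rw [dotProduct_comm (B *ᵥ x)] at hx
  linear_combination hx / 2

lemma range_ne_bot : LinearMap.range A.mulVecLin ≠ ⊥ := by
  intro hrange
  refine h.ne_zero (Matrix.mulVec_injective (funext fun x => ?_))
  rw [zero_mulVec]
  exact LinearMap.congr_fun (LinearMap.range_eq_bot.1 hrange) x

lemma finrank_range_le_two : Module.finrank ℂ (LinearMap.range A.mulVecLin) ≤ 2 := by
  refine finrank_le_two_of_null ?_ ?_ <;> rintro _ ⟨x, rfl⟩ _ ⟨y, rfl⟩
  exacts [h.dot₀ x y, h.cross₀ x y]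

lemma isAdaptedFrame_of_orthonormal {x₀ y₀ m k : V7} (hx₀ : A *ᵥ x₀ = m) (hy₀ : A *ᵥ y₀ = k)
    (hm : star m ⬝ᵥ m = 1) (hk : star k ⬝ᵥ k = 1) (hmk : star m ⬝ᵥ k = 0) :
    IsAdaptedFrame A B m k (k ⬝ᵥ B *ᵥ x₀) := by
  have hA (x : V7) : A *ᵥ x = (star m ⬝ᵥ A *ᵥ x) • m + (star k ⬝ᵥ A *ᵥ x) • k :=
    eq_add_of_orthonormal_of_finrank_le_two h.finrank_range_le_two ⟨x₀, hx₀⟩ ⟨y₀, hy₀⟩ hm hk hmk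
      ⟨x, rfl⟩
  have hmB (x : V7) : m ⬝ᵥ B *ᵥ x = -(k ⬝ᵥ B *ᵥ x₀) * (star k ⬝ᵥ A *ᵥ x) := by
    have hdot := h.dot₁ x x₀
    have hself := h.dot_self x₀
    rw [hx₀, hA x, add_dotProduct, smul_dotProduct, smul_dotProduct, dotProduct_comm (B *ᵥ x),
      smul_eq_mul, smul_eq_mul] at hdot
    rw [hx₀] at hself
    linear_combination hdot - (star m ⬝ᵥ A *ᵥ x) * hself
  have hkB (x : V7) : k ⬝ᵥ B *ᵥ x = (k ⬝ᵥ B *ᵥ x₀) * (star m ⬝ᵥ A *ᵥ x) := by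
    have hdot := h.dot₁ x y₀
    have hself := h.dot_self y₀
    rw [hy₀, hA x, add_dotProduct, smul_dotProduct, smul_dotProduct, hmB y₀, hy₀, hk,
      dotProduct_comm (B *ᵥ x), smul_eq_mul, smul_eq_mul] at hdot
    rw [hy₀] at hself
    linear_combination hdot - (star k ⬝ᵥ A *ᵥ x) * hself
  refine ⟨⟨?_, ?_, ?_, hm, hk, hmk, ?_⟩, hA, hmB, hkB⟩
  · simpa only [hx₀] using h.dot₀ x₀ x₀
  · simpa only [hy₀] using h.dot₀ y₀ y₀
  · simpa only [hx₀, hy₀] using h.dot₀ x₀ y₀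
  · simpa only [hx₀, hy₀] using h.cross₀ x₀ y₀

lemma exists_isAdaptedFrame_of_finrank_eq_two
    (hrank : Module.finrank ℂ (LinearMap.range A.mulVecLin) = 2) {x₀ m : V7} (hx₀ : A *ᵥ x₀ = m)
    (hm : star m ⬝ᵥ m = 1) :
    ∃ k κ, IsAdaptedFrame A B m k κ ∧
      ∀ e, IsSConjSemiinvariant e A → sConj m = m → sConj k = k := by
  have hbot : LinearMap.range A.mulVecLin ⊓ dotOrthogonal (star m) ≠ ⊥ := by
    have hle : Module.finrank ℂ (LinearMap.range A.mulVecLin) ≤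
        Module.finrank ℂ ↥(LinearMap.range A.mulVecLin ⊓ dotOrthogonal (star m)) + 1 :=
      finrank_le_finrank_inf_ker_add_one _ _
    rw [← Submodule.one_le_finrank_iff]
    omega
  obtain ⟨k, ⟨⟨y₀, hy₀⟩, hmk⟩, hk, hk_real⟩ := exists_unit_mem hbot
  exact ⟨k, _, h.isAdaptedFrame_of_orthonormal hx₀ hy₀ hm hk hmk, fun e hA hm_real =>
    hk_real fun w hw => ⟨hA.sConj_mem_range hw.1, sConj_mem_dotOrthogonal_star hm_real hw.2⟩⟩

/-! ### Leading coefficients of rank one -/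

lemma eps_eq_zero_of_range_le_line {m : V7} (hm : ∀ x, A *ᵥ x = (star m ⬝ᵥ A *ᵥ x) • m) :
    ε = 0 := by
  by_contra hε
  set v := Aᵀ *ᵥ star m with hv
  have hdot (x : V7) : star m ⬝ᵥ A *ᵥ x = v ⬝ᵥ x := by
    rw [hv, mulVec_transpose, dotProduct_mulVec]
  have hv0 : v ≠ 0 := by
    intro h0
    refine h.ne_zero (Matrix.mulVec_injective (funext fun x => ?_))
    rw [hm, hdot, h0, zero_dotProduct, zero_smul, zero_mulVec]
  have hvv : v ⬝ᵥ v = 0 := by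
    rw [← hdot, hv, mulVec_mulVec, h.mul_transpose, zero_mulVec, dotProduct_zero]
  have hker (x : V7) (hx : v ⬝ᵥ x = 0) : A *ᵥ x = 0 := by rw [hm, hdot, hx, zero_smul]
  -- The kernel `v^⊥` of `A` would be closed under the cross product, so `v × v^⊥ ⊆ ℂ v`.
  obtain ⟨x, hx, hxv⟩ := exists_cross_notMem_span hv0 hvv
  refine hxv (mem_span_singleton_of_dotProduct_eq_zero fun y hy => ?_)
  have hcross := h.cross₁ x y
  rw [hker x hx, hker y hy, map_zero, LinearMap.zero_apply, map_zero, add_zero] at hcross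
  rw [cross_dotProduct, ← hdot, (smul_eq_zero.1 hcross.symm).resolve_left hε, dotProduct_zero]

variable {x₀ m : V7} (hx₀ : A *ᵥ x₀ = m) (hm : star m ⬝ᵥ m = 1)
  (hrange : ∀ x, A *ᵥ x = (star m ⬝ᵥ A *ᵥ x) • m)

include hx₀ in
lemma dot_eq_zero : m ⬝ᵥ m = 0 := by simpa only [hx₀] using h.dot₀ x₀ x₀

include hx₀ hm hrange

lemma dot_mulVec_eq_zero_of_mem_annihilator {k : V7} (hk : k ∈ annihilator m)
    (hkB : k ⬝ᵥ B *ᵥ x₀ = 0) (x : V7) : k ⬝ᵥ B *ᵥ x = 0 := by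
  set z := x - (star m ⬝ᵥ A *ᵥ x) • x₀ with hz
  have hAz : A *ᵥ z = 0 := by rw [hz, mulVec_sub, mulVec_smul, hx₀, ← hrange, sub_self]
  have hBz : B *ᵥ z ∈ annihilator m := by
    have hcross := h.cross₁ x₀ z
    rwa [hx₀, hAz, map_zero, add_zero, h.eps_eq_zero_of_range_le_line hrange, zero_smul] at hcross
  have hdot := annihilator_isotropic (ne_zero_of_star_dotProduct_self hm) (h.dot_eq_zero hx₀) hk hBz
  rwa [hz, mulVec_sub, mulVec_smul, dotProduct_sub, dotProduct_smul, hkB, smul_zero,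
    sub_zero] at hdot

lemma isAdaptedFrame_of_mem_annihilator {k : V7} (hk : k ∈ annihilator m)
    (hk1 : star k ⬝ᵥ k = 1) (hmk : star m ⬝ᵥ k = 0) (hkB : k ⬝ᵥ B *ᵥ x₀ = 0) :
    IsAdaptedFrame A B m k 0 := by
  have hm0 := ne_zero_of_star_dotProduct_self hm
  have hmm := h.dot_eq_zero hx₀
  have hkm : star k ⬝ᵥ m = 0 := by rw [star_dotProduct, hmk, star_zero]
  have hmB₀ : m ⬝ᵥ B *ᵥ x₀ = 0 := by simpa only [hx₀] using h.dot_self x₀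
  refine ⟨⟨hmm, annihilator_isotropic hm0 hmm hk hk,
    dotProduct_eq_zero_of_mem_annihilator hm0 hmm hk, hm, hk1, hmk, hk⟩,
    fun x => ?_, fun x => ?_, fun x => ?_⟩
  · rw [hrange x, dotProduct_smul, dotProduct_smul, hkm, hm, smul_zero, zero_smul, add_zero,
      smul_eq_mul, mul_one]
  · rw [h.dot_mulVec_eq_zero_of_mem_annihilator hx₀ hm hrange (cross_self m) hmB₀, neg_zero,
      zero_mul]
  · rw [h.dot_mulVec_eq_zero_of_mem_annihilator hx₀ hm hrange hk hkB, zero_mul]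

lemma exists_isAdaptedFrame_of_range_le_line :
    ∃ k κ, IsAdaptedFrame A B m k κ ∧ ∀ e, IsSConjSemiinvariant (-e) B →
      sConj m = m → sConj k = k := by
  have hm0 := ne_zero_of_star_dotProduct_self hm
  have hbot : annihilator m ⊓ dotOrthogonal (star m) ⊓ dotOrthogonal (B *ᵥ x₀) ≠ ⊥ := by
    have h₁ : Module.finrank ℂ (annihilator m) ≤
        Module.finrank ℂ ↥(annihilator m ⊓ dotOrthogonal (star m)) + 1 :=
      finrank_le_finrank_inf_ker_add_one _ _
    have h₂ : Module.finrank ℂ ↥(annihilator m ⊓ dotOrthogonal (star m)) ≤ Module.finrank ℂ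
        ↥(annihilator m ⊓ dotOrthogonal (star m) ⊓ dotOrthogonal (B *ᵥ x₀)) + 1 :=
      finrank_le_finrank_inf_ker_add_one _ _
    rw [finrank_annihilator hm0 (h.dot_eq_zero hx₀)] at h₁
    rw [← Submodule.one_le_finrank_iff]
    omega
  obtain ⟨k, ⟨⟨hk, hmk⟩, hkB⟩, hk1, hk_real⟩ := exists_unit_mem hbot
  rw [SetLike.mem_coe, mem_dotOrthogonal, dotProduct_comm] at hkB
  refine ⟨k, 0, h.isAdaptedFrame_of_mem_annihilator hx₀ hm hrange hk hk1 hmk hkB,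
    fun e hB hm_real => hk_real ?_⟩
  rintro w ⟨⟨hw, hmw⟩, hwB⟩
  rw [SetLike.mem_coe, mem_dotOrthogonal, dotProduct_comm] at hwB
  refine ⟨⟨?_, sConj_mem_dotOrthogonal_star hm_real hmw⟩, ?_⟩
  · rw [SetLike.mem_coe, mem_annihilator, ← hm_real, ← sConj_cross, mem_annihilator.1 hw]
    simp [sConj]
  · rw [SetLike.mem_coe, mem_dotOrthogonal, ← sConj_sConj (B *ᵥ x₀), sConj_dotProduct_sConj, hB,
      smul_dotProduct, dotProduct_comm,
      h.dot_mulVec_eq_zero_of_mem_annihilator hx₀ hm hrange hw hwB, smul_zero, star_zero]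

omit hx₀ hm hrange

theorem exists_isAdaptedFrame :
    ∃ m k κ, IsAdaptedFrame A B m k κ ∧ ∀ e, e * e = 1 → IsSConjSemiinvariant e A →
      IsSConjSemiinvariant (-e) B → sConj m = m ∧ sConj k = k ∧ star κ = -κ := by
  obtain ⟨m, hmA, hm, hm_real⟩ := exists_unit_mem h.range_ne_bot
  obtain ⟨x₀, hx₀ : A *ᵥ x₀ = m⟩ := hmA
  obtain ⟨k, κ, hframe, hk_real⟩ : ∃ k κ, IsAdaptedFrame A B m k κ ∧ ∀ e,
      IsSConjSemiinvariant e A → IsSConjSemiinvariant (-e) B → sConj m = m → sConj k = k := by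
    rcases h.finrank_range_le_two.eq_or_lt with hrank | hrank
    · obtain ⟨k, κ, hframe, hk⟩ := h.exists_isAdaptedFrame_of_finrank_eq_two hrank hx₀ hm
      exact ⟨k, κ, hframe, fun e hA _ => hk e hA⟩
    · have hspan : ℂ ∙ m = LinearMap.range A.mulVecLin := by
        refine Submodule.eq_of_le_of_finrank_le
          ((Submodule.span_singleton_le_iff_mem _ _).2 ⟨x₀, hx₀⟩) ?_
        rw [finrank_span_singleton (ne_zero_of_star_dotProduct_self hm)]
        exact Nat.lt_succ_iff.1 hrank
      have hrange (x : V7) : A *ᵥ x = (star m ⬝ᵥ A *ᵥ x) • m := by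
        obtain ⟨a, ha⟩ := Submodule.mem_span_singleton.1 (hspan.ge ⟨x, rfl⟩ : A *ᵥ x ∈ ℂ ∙ m)
        rw [← ha, dotProduct_smul, hm, smul_eq_mul, mul_one]
      obtain ⟨k, κ, hframe, hk⟩ := h.exists_isAdaptedFrame_of_range_le_line hx₀ hm hrange
      exact ⟨k, κ, hframe, fun e _ => hk e⟩
  refine ⟨m, k, κ, hframe, fun e he hA hB => ?_⟩
  have hm_real := hm_real fun w => hA.sConj_mem_range
  have hk_real := hk_real e hA hB hm_real
  exact ⟨hm_real, hk_real, hframe.star_eq_neg hx₀ hm_real hk_real he hA hB⟩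

end IsLeading

/-! ### Functions near a point, up to an open and dense set -/

/-- The filter generated by the traces near `b` of the sets that contain an open and dense set. A
germ of loops has a well-defined germ along it, although its values at `b` are arbitrary. -/
def nhdsOpenDense (b : ℂ) : Filter ℂ := 𝓝 b ⊓ openDense

lemma eventually_nhdsOpenDense {b : ℂ} {P : ℂ → Prop} : (∀ᶠ z in nhdsOpenDense b, P z) ↔
    ∃ U W : Set ℂ, IsOpen U ∧ b ∈ U ∧ IsOpen W ∧ Dense W ∧ ∀ z ∈ U, z ∈ W → P z := by
  rw [nhdsOpenDense, Filter.eventually_inf]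
  constructor
  · rintro ⟨s, hs, t, ⟨W, hWt, hWo, hWd⟩, h⟩
    obtain ⟨U, hUs, hUo, hbU⟩ := mem_nhds_iff.1 hs
    exact ⟨U, W, hUo, hbU, hWo, hWd, fun z hz hz' => h z ⟨hUs hz, hWt hz'⟩⟩
  · rintro ⟨U, W, hUo, hbU, hWo, hWd, h⟩
    exact ⟨U, hUo.mem_nhds hbU, W, ⟨W, subset_rfl, hWo, hWd⟩, fun z hz => h z hz.1 hz.2⟩

instance (b : ℂ) : (nhdsOpenDense b).NeBot := by
  rw [← Filter.frequently_true_iff_neBot]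
  intro h
  obtain ⟨U, W, hUo, hbU, -, hWd, h⟩ := eventually_nhdsOpenDense.1 h
  obtain ⟨z, hz, hz'⟩ := hWd.inter_open_nonempty U hUo ⟨b, hbU⟩
  exact h z hz hz' trivial

lemma nhdsOpenDense_le_nhds (b : ℂ) : nhdsOpenDense b ≤ 𝓝 b := inf_le_left

lemma nhdsOpenDense_le_openDense (b : ℂ) : nhdsOpenDense b ≤ openDense := inf_le_right

lemma compl_mem_openDense_of_finite {P : Set ℂ} (hP : P.Finite) : Pᶜ ∈ openDense :=
  ⟨Pᶜ, subset_rfl, hP.isClosed.isOpen_compl, hP.countable.dense_compl ℂ⟩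

lemma eventually_nhdsOpenDense_ne (a b : ℂ) : ∀ᶠ z in nhdsOpenDense b, z ≠ a :=
  nhdsOpenDense_le_openDense b (compl_mem_openDense_of_finite (Set.finite_singleton a))

lemma nhdsOpenDense_le_nhdsNE (b : ℂ) : nhdsOpenDense b ≤ 𝓝[≠] b :=
  le_inf (nhdsOpenDense_le_nhds b) (le_principal_iff.2 (eventually_nhdsOpenDense_ne b b))

lemma eventually_eventually_nhdsOpenDense {b : ℂ} {P : ℂ → Prop}
    (h : ∀ᶠ z in nhdsOpenDense b, P z) : ∀ᶠ b' in 𝓝 b, ∀ᶠ z in nhdsOpenDense b', P z := by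
  obtain ⟨U, W, hUo, hbU, hWo, hWd, h⟩ := eventually_nhdsOpenDense.1 h
  filter_upwards [hUo.mem_nhds hbU] with b' hb'
  exact eventually_nhdsOpenDense.2 ⟨U, W, hUo, hb', hWo, hWd, h⟩

lemma eventually_openDense_of_nhdsOpenDense {P : ℂ → Prop}
    (h : ∀ b, ∀ᶠ z in nhdsOpenDense b, P z) : ∀ᶠ z in openDense, P z := by
  choose U W hUo hbU hWo hWd h using fun b => eventually_nhdsOpenDense.1 (h b)
  refine ⟨⋃ b, U b ∩ W b, ?_, isOpen_iUnion fun b => (hUo b).inter (hWo b), ?_⟩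
  · intro z hz
    obtain ⟨b, hz⟩ := Set.mem_iUnion.1 hz
    exact h b z hz.1 hz.2
  · rw [dense_iff_inter_open]
    rintro O hO ⟨b, hb⟩
    obtain ⟨z, hz, hz'⟩ := (hWd b).inter_open_nonempty (O ∩ U b) (hO.inter (hUo b)) ⟨b, hb, hbU b⟩
    exact ⟨z, hz.1, Set.mem_iUnion.2 ⟨b, hz.2, hz'⟩⟩

lemma tendsto_openDense (e : ℂ ≃ₜ ℂ) : Tendsto e openDense openDense := by
  rintro s ⟨U, hU, hUo, hUd⟩
  exact ⟨e ⁻¹' U, Set.preimage_mono hU, hUo.preimage e.continuous, hUd.preimage e.isOpenMap⟩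

lemma tendsto_nhdsOpenDense (e : ℂ ≃ₜ ℂ) (b : ℂ) :
    Tendsto e (nhdsOpenDense b) (nhdsOpenDense (e b)) :=
  tendsto_inf.2 ⟨(e.continuous.tendsto b).mono_left inf_le_left,
    (tendsto_openDense e).mono_left inf_le_right⟩

lemma tendsto_conj_openDense : Tendsto (conj : ℂ → ℂ) openDense openDense :=
  tendsto_openDense Complex.conjCLE.toHomeomorph

lemma tendsto_neg_openDense : Tendsto (fun z : ℂ => -z) openDense openDense :=
  tendsto_openDense (Homeomorph.neg ℂ)

lemma tendsto_conj_nhdsOpenDense (b : ℂ) :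
    Tendsto (conj : ℂ → ℂ) (nhdsOpenDense (conj b)) (nhdsOpenDense b) := by
  have h : Tendsto (conj : ℂ → ℂ) (nhdsOpenDense (conj b)) (nhdsOpenDense (conj (conj b))) :=
    tendsto_nhdsOpenDense Complex.conjCLE.toHomeomorph (conj b)
  rwa [Complex.conj_conj] at h

lemma tendsto_neg_nhdsOpenDense (b : ℂ) :
    Tendsto (fun z : ℂ => -z) (nhdsOpenDense (-b)) (nhdsOpenDense b) := by
  simpa using tendsto_nhdsOpenDense (Homeomorph.neg ℂ) (-b)

/-! ### Regular functions -/

/-- `f` agrees along `l` with a function that is analytic at `b`. -/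
def RegularAt (l : Filter ℂ) (f : ℂ → ℂ) (b : ℂ) : Prop :=
  ∃ h : ℂ → ℂ, AnalyticAt ℂ h b ∧ f =ᶠ[l] h

namespace RegularAt

variable {l : Filter ℂ} {f g : ℂ → ℂ} {b : ℂ}

lemma congr (hf : RegularAt l f b) (h : g =ᶠ[l] f) : RegularAt l g b :=
  let ⟨u, hu, hfu⟩ := hf
  ⟨u, hu, h.trans hfu⟩

lemma mono {l' : Filter ℂ} (hf : RegularAt l f b) (hl : l' ≤ l) : RegularAt l' f b :=
  let ⟨u, hu, hfu⟩ := hf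
  ⟨u, hu, hl hfu⟩

lemma of_analyticAt (hf : AnalyticAt ℂ f b) : RegularAt l f b := ⟨f, hf, EventuallyEq.rfl⟩

lemma const (c : ℂ) : RegularAt l (fun _ => c) b := of_analyticAt analyticAt_const

lemma add (hf : RegularAt l f b) (hg : RegularAt l g b) : RegularAt l (fun z => f z + g z) b :=
  let ⟨_, hu, hfu⟩ := hf
  let ⟨_, hv, hgv⟩ := hg
  ⟨_, hu.add hv, hfu.add hgv⟩

lemma mul (hf : RegularAt l f b) (hg : RegularAt l g b) : RegularAt l (fun z => f z * g z) b :=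
  let ⟨_, hu, hfu⟩ := hf
  let ⟨_, hv, hgv⟩ := hg
  ⟨_, hu.mul hv, hfu.mul hgv⟩

lemma sum {ι : Type*} (s : Finset ι) {F : ι → ℂ → ℂ} (h : ∀ i ∈ s, RegularAt l (F i) b) :
    RegularAt l (fun z => ∑ i ∈ s, F i z) b := by
  classical
  induction s using Finset.induction_on with
  | empty => simpa only [Finset.sum_empty] using const 0
  | insert i s hi ih =>
    simp only [Finset.sum_insert hi]
    exact (h i (Finset.mem_insert_self i s)).add
      (ih fun j hj => h j (Finset.mem_insert_of_mem hj))

lemma sub_pow (a : ℂ) (n : ℕ) : RegularAt l (fun z => (z - a) ^ n) b :=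
  of_analyticAt ((analyticAt_id.sub analyticAt_const).pow n)

lemma sub_const (a : ℂ) : RegularAt l (fun z => z - a) b :=
  of_analyticAt (analyticAt_id.sub analyticAt_const)

lemma inv_sub {a : ℂ} (h : b ≠ a) : RegularAt l (fun z => (z - a)⁻¹) b :=
  of_analyticAt ((analyticAt_id.sub analyticAt_const).inv (sub_ne_zero.2 h))

end RegularAt

lemma exists_eq_add_mul_of_analyticAt {f : ℂ → ℂ} {b : ℂ} (hf : AnalyticAt ℂ f b) :
    ∃ g : ℂ → ℂ, AnalyticAt ℂ g b ∧ ∀ z, f z = f b + (z - b) * g z := by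
  obtain ⟨p, hp⟩ := hf
  refine ⟨dslope f b, ⟨_, hp.has_fpower_series_dslope_fslope⟩, fun z => ?_⟩
  rw [← smul_eq_mul, sub_smul_dslope, add_sub_cancel]

lemma RegularAt.exists_expansion {l : Filter ℂ} {f : ℂ → ℂ} {b : ℂ} (hf : RegularAt l f b) :
    ∃ (a c : ℂ) (R : ℂ → ℂ), AnalyticAt ℂ R b ∧
      ∀ᶠ z in l, f z = a + (z - b) * c + (z - b) ^ 2 * R z := by
  obtain ⟨h, hh, hfh⟩ := hf
  obtain ⟨g, hg, hhg⟩ := exists_eq_add_mul_of_analyticAt hh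
  obtain ⟨R, hR, hgR⟩ := exists_eq_add_mul_of_analyticAt hg
  refine ⟨h b, g b, R, hR, ?_⟩
  filter_upwards [hfh] with z hz
  rw [hz, hhg, hgR]
  ring

lemma RegularAt.inv_sub_mul {l : Filter ℂ} [l.NeBot] {f : ℂ → ℂ} {b : ℂ} (hl : l ≤ 𝓝[≠] b)
    (hf : RegularAt l f b) (hlim : Tendsto f l (𝓝 0)) :
    RegularAt l (fun z => (z - b)⁻¹ * f z) b := by
  obtain ⟨h, hh, hfh⟩ := hf
  obtain ⟨g, hg, hhg⟩ := exists_eq_add_mul_of_analyticAt hh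
  have hb : h b = 0 := tendsto_nhds_unique_of_eventuallyEq
    (hh.continuousAt.tendsto.mono_left (hl.trans nhdsWithin_le_nhds)) hlim hfh.symm
  refine ⟨g, hg, ?_⟩
  filter_upwards [hfh, hl self_mem_nhdsWithin] with z hz hzb
  rw [hz, hhg, hb, zero_add, inv_mul_cancel_left₀ (sub_ne_zero.2 hzb)]

lemma analyticAt_conj_conj {f : ℂ → ℂ} {b : ℂ} (hf : AnalyticAt ℂ f b) :
    AnalyticAt ℂ (fun z => conj (f (conj z))) (conj b) := by
  rw [Complex.analyticAt_iff_eventually_differentiableAt] at *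
  have hconj : Tendsto (conj : ℂ → ℂ) (𝓝 (conj b)) (𝓝 b) := by
    simpa using Complex.continuous_conj.tendsto (conj b)
  filter_upwards [hconj.eventually hf] with z hz
  simpa [Function.comp_def] using hz.conj_conj

lemma RegularAt.conj_conj {f : ℂ → ℂ} {b : ℂ} (hf : RegularAt (nhdsOpenDense b) f b) :
    RegularAt (nhdsOpenDense (conj b)) (fun z => conj (f (conj z))) (conj b) := by
  obtain ⟨h, hh, hfh⟩ := hf
  refine ⟨_, analyticAt_conj_conj hh, ?_⟩
  filter_upwards [(tendsto_conj_nhdsOpenDense b).eventually hfh] with z hz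
  rw [hz]

lemma RegularAt.neg_arg {l l' : Filter ℂ} {f : ℂ → ℂ} {b : ℂ} (hf : RegularAt l f b)
    (hl : Tendsto (fun z => -z) l' l) : RegularAt l' (fun z => f (-z)) (-b) := by
  obtain ⟨h, hh, hfh⟩ := hf
  refine ⟨fun z => h (-z), ?_, hl.eventually hfh⟩
  exact AnalyticAt.comp (g := h) (by rwa [neg_neg]) analyticAt_id.neg

lemma exists_differentiable_of_regularAt {f : ℂ → ℂ} (h : ∀ b, RegularAt (nhdsOpenDense b) f b) :
    ∃ H : ℂ → ℂ, Differentiable ℂ H ∧ (∀ b, Tendsto f (nhdsOpenDense b) (𝓝 (H b))) ∧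
      f =ᶠ[openDense] H := by
  choose u hu hfu using h
  have tendsto_of_eventuallyEq : ∀ {b : ℂ} {v : ℂ → ℂ}, ContinuousAt v b →
      f =ᶠ[nhdsOpenDense b] v → Tendsto f (nhdsOpenDense b) (𝓝 (v b)) := fun hv hfv =>
    (hv.tendsto.mono_left (nhdsOpenDense_le_nhds _)).congr' hfv.symm
  have hlim : ∀ b, Tendsto f (nhdsOpenDense b) (𝓝 (u b b)) := fun b =>
    tendsto_of_eventuallyEq (hu b).continuousAt (hfu b)
  have hdiag : ∀ b, ∀ᶠ b' in 𝓝 b, u b' b' = u b b' := fun b => by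
    filter_upwards [eventually_eventually_nhdsOpenDense (hfu b), (hu b).eventually_analyticAt]
      with b' hfb' hub'
    exact tendsto_nhds_unique (hlim b') (tendsto_of_eventuallyEq hub'.continuousAt hfb')
  refine ⟨fun b => u b b, fun b => (hu b).differentiableAt.congr_of_eventuallyEq (hdiag b), hlim,
    eventually_openDense_of_nhdsOpenDense fun b => ?_⟩
  filter_upwards [hfu b, nhdsOpenDense_le_nhds b (hdiag b)] with z hz hz'
  rw [hz, ← hz']

lemma eventually_eq_const_of_regularAt {f : ℂ → ℂ} {c : ℂ}
    (h : ∀ b, RegularAt (nhdsOpenDense b) f b)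
    (hc : Tendsto f (cocompact ℂ ⊓ openDense) (𝓝 c)) : ∀ᶠ z in openDense, f z = c := by
  obtain ⟨H, hH, hlim, hfH⟩ := exists_differentiable_of_regularAt h
  suffices hcocompact : Tendsto H (cocompact ℂ) (𝓝 c) by
    filter_upwards [hfH] with z hz
    rw [hz, hH.apply_eq_of_tendsto_cocompact z hcocompact]
  rw [(closed_nhds_basis c).tendsto_right_iff]
  rintro V ⟨hV, hVc⟩
  obtain ⟨s, hs, t, ht, hfV⟩ := Filter.eventually_inf.1 (hc.eventually hV)
  obtain ⟨K, hK, hKs⟩ := mem_cocompact.1 hs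
  filter_upwards [hK.compl_mem_cocompact] with b hb
  refine hVc.mem_of_tendsto (hlim b) ?_
  filter_upwards [nhdsOpenDense_le_nhds b (hK.isClosed.isOpen_compl.mem_nhds hb),
    nhdsOpenDense_le_openDense b ht] with z hzK hzt
  exact hfV z ⟨hKs hzK, hzt⟩

/-! ### Second order expansions -/

/-- `F z = a + (z - b) • c + O((z - b) ^ 2)` near `b`, up to an open and dense set. -/
def HasExpansionAt {E : Type*} [AddCommGroup E] [Module ℂ E] [TopologicalSpace E] (F : ℂ → E)
    (b : ℂ) (a c : E) : Prop :=
  ∃ R : ℂ → E, ContinuousAt R b ∧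
    ∀ᶠ z in nhdsOpenDense b, F z = a + (z - b) • c + (z - b) ^ 2 • R z

namespace HasExpansionAt

variable {E : Type*} [AddCommGroup E] [Module ℂ E] [TopologicalSpace E] {F G : ℂ → E} {b : ℂ}
  {a c a' c' : E}

lemma congr (h : HasExpansionAt F b a c) (hGF : ∀ᶠ z in nhdsOpenDense b, G z = F z) :
    HasExpansionAt G b a c := by
  obtain ⟨R, hR, hF⟩ := h
  refine ⟨R, hR, ?_⟩
  filter_upwards [hF, hGF] with z hz hz'
  rw [hz', hz]

lemma const (x : E) : HasExpansionAt (fun _ => x) b x 0 :=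
  ⟨fun _ => 0, continuousAt_const, Eventually.of_forall fun z => by simp⟩

lemma tendsto [IsTopologicalAddGroup E] [ContinuousSMul ℂ E] (h : HasExpansionAt F b a c) :
    Tendsto F (nhdsOpenDense b) (𝓝 a) := by
  obtain ⟨R, hR, hF⟩ := h
  have hcont : ContinuousAt (fun z => a + (z - b) • c + (z - b) ^ 2 • R z) b := by fun_prop
  have hlim := hcont.tendsto.mono_left (nhdsOpenDense_le_nhds b)
  simp only [sub_self, zero_smul, add_zero, ne_eq, OfNat.ofNat_ne_zero, not_false_eq_true,
    zero_pow] at hlim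
  exact hlim.congr' (EventuallyEq.symm hF)

lemma const_smul [ContinuousSMul ℂ E] (h : HasExpansionAt F b a c) (e : ℂ) :
    HasExpansionAt (fun z => e • F z) b (e • a) (e • c) := by
  obtain ⟨R, hR, hF⟩ := h
  refine ⟨fun z => e • R z, hR.const_smul e, ?_⟩
  filter_upwards [hF] with z hz
  rw [hz, smul_add, smul_add, smul_comm e, smul_comm e]

lemma sub_smul [IsTopologicalAddGroup E] [ContinuousSMul ℂ E] (h : HasExpansionAt F b a c) :
    HasExpansionAt (fun z => (z - b) • F z) b 0 a := by
  obtain ⟨R, hR, hF⟩ := h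
  refine ⟨fun z => c + (z - b) • R z, by fun_prop, ?_⟩
  filter_upwards [hF] with z hz
  rw [hz]
  module

lemma sub_pow_succ_smul [IsTopologicalAddGroup E] [ContinuousSMul ℂ E]
    (h : HasExpansionAt F b a c) (k : ℕ) :
    HasExpansionAt (fun z => (z - b) ^ (k + 1) • F z) b 0 (if k = 0 then a else 0) := by
  induction k with
  | zero => simpa using h.sub_smul
  | succ k ih =>
    simpa only [pow_succ' _ (k + 1), mul_smul, Nat.add_eq_zero_iff, one_ne_zero, and_false,
      if_false] using ih.sub_smul

lemma unique [IsTopologicalAddGroup E] [ContinuousSMul ℂ E] [T2Space E]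
    (h : HasExpansionAt F b a c) (h' : HasExpansionAt F b a' c') : a = a' ∧ c = c' := by
  obtain ⟨R, hR, hF⟩ := h
  obtain ⟨R', hR', hF'⟩ := h'
  have eq_of_eventuallyEq : ∀ {u v : ℂ → E}, ContinuousAt u b → ContinuousAt v b →
      u =ᶠ[nhdsOpenDense b] v → u b = v b := fun hu hv huv =>
    tendsto_nhds_unique_of_eventuallyEq (hu.tendsto.mono_left (nhdsOpenDense_le_nhds b))
      (hv.tendsto.mono_left (nhdsOpenDense_le_nhds b)) huv
  have ha : a = a' := by
    have := eq_of_eventuallyEq (u := fun z => a + (z - b) • c + (z - b) ^ 2 • R z)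
      (v := fun z => a' + (z - b) • c' + (z - b) ^ 2 • R' z) (by fun_prop) (by fun_prop)
      (by filter_upwards [hF, hF'] with z hz hz'; rw [← hz, hz'])
    simpa using this
  have hc : (fun z => c + (z - b) • R z) =ᶠ[nhdsOpenDense b] fun z => c' + (z - b) • R' z := by
    filter_upwards [hF, hF', eventually_nhdsOpenDense_ne b b] with z hz hz' hzb
    refine smul_right_injective _ (sub_ne_zero.2 hzb) (add_left_cancel (a := a) ?_)
    calc a + (z - b) • (c + (z - b) • R z) = F z := by rw [hz]; module
      _ = a + (z - b) • (c' + (z - b) • R' z) := by rw [hz', ha]; module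
  exact ⟨ha, by simpa using eq_of_eventuallyEq (by fun_prop) (by fun_prop) hc⟩

lemma star [StarAddMonoid E] [StarModule ℂ E] [ContinuousStar E] (h : HasExpansionAt F b a c) :
    HasExpansionAt (fun z => star (F (conj z))) (conj b) (star a) (star c) := by
  obtain ⟨R, hR, hF⟩ := h
  refine ⟨fun z => Star.star (R (conj z)), ?_, ?_⟩
  · exact (ContinuousAt.comp (g := R) (by rwa [Complex.conj_conj])
      Complex.continuous_conj.continuousAt).star
  · filter_upwards [(tendsto_conj_nhdsOpenDense b).eventually hF] with z hz
    simp [hz, ← starRingEnd_apply]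

lemma neg_arg (h : HasExpansionAt F b a c) :
    HasExpansionAt (fun z => F (-z)) (-b) a (-c) := by
  obtain ⟨R, hR, hF⟩ := h
  refine ⟨fun z => R (-z), ContinuousAt.comp (g := R) (by rwa [neg_neg]) (by fun_prop), ?_⟩
  filter_upwards [(tendsto_neg_nhdsOpenDense b).eventually hF] with z hz
  rw [hz]
  module

lemma mulVec {m n : Type*} [Fintype n] {F : ℂ → Matrix m n ℂ} {A B : Matrix m n ℂ}
    (h : HasExpansionAt F b A B) (x : n → ℂ) :
    HasExpansionAt (fun z => F z *ᵥ x) b (A *ᵥ x) (B *ᵥ x) := by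
  obtain ⟨R, hR, hF⟩ := h
  refine ⟨fun z => R z *ᵥ x,
    (continuous_id.matrix_mulVec continuous_const).continuousAt.comp hR, ?_⟩
  filter_upwards [hF] with z hz
  rw [hz, add_mulVec, add_mulVec, smul_mulVec, smul_mulVec]

lemma const_mulVec {m n : Type*} [Fintype n] {f : ℂ → n → ℂ} {a c : n → ℂ} (A : Matrix m n ℂ)
    (h : HasExpansionAt f b a c) : HasExpansionAt (fun z => A *ᵥ f z) b (A *ᵥ a) (A *ᵥ c) := by
  obtain ⟨R, hR, hf⟩ := h
  refine ⟨fun z => A *ᵥ R z,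
    (continuous_const.matrix_mulVec continuous_id).continuousAt.comp hR, ?_⟩
  filter_upwards [hf] with z hz
  rw [hz, mulVec_add, mulVec_add, mulVec_smul, mulVec_smul]

lemma transpose {m n : Type*} {F : ℂ → Matrix m n ℂ} {A B : Matrix m n ℂ}
    (h : HasExpansionAt F b A B) : HasExpansionAt (fun z => (F z)ᵀ) b Aᵀ Bᵀ := by
  obtain ⟨R, hR, hF⟩ := h
  refine ⟨fun z => (R z)ᵀ, continuous_id.matrix_transpose.continuousAt.comp hR, ?_⟩
  filter_upwards [hF] with z hz
  rw [hz, transpose_add, transpose_add, transpose_smul, transpose_smul]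

lemma bilin {E₁ E₂ : Type*} [AddCommGroup E₁] [Module ℂ E₁] [TopologicalSpace E₁]
    [IsTopologicalAddGroup E] [ContinuousSMul ℂ E] [AddCommGroup E₂] [Module ℂ E₂]
    [TopologicalSpace E₂] (β : E₁ →ₗ[ℂ] E₂ →ₗ[ℂ] E)
    (hβ : Continuous fun p : E₁ × E₂ => β p.1 p.2) {F₁ : ℂ → E₁} {F₂ : ℂ → E₂} {a₁ c₁ : E₁}
    {a₂ c₂ : E₂} (h₁ : HasExpansionAt F₁ b a₁ c₁) (h₂ : HasExpansionAt F₂ b a₂ c₂) :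
    HasExpansionAt (fun z => β (F₁ z) (F₂ z)) b (β a₁ a₂) (β a₁ c₂ + β c₁ a₂) := by
  obtain ⟨R₁, hR₁, hF₁⟩ := h₁
  obtain ⟨R₂, hR₂, hF₂⟩ := h₂
  have hβR : ∀ {u : ℂ → E₁} {v : ℂ → E₂}, ContinuousAt u b → ContinuousAt v b →
      ContinuousAt (fun z => β (u z) (v z)) b := fun hu hv =>
    hβ.continuousAt.comp (hu.prodMk hv)
  refine ⟨fun z => β a₁ (R₂ z) + β c₁ c₂ + β (R₁ z) a₂ +
    (z - b) • (β c₁ (R₂ z) + β (R₁ z) c₂) + (z - b) ^ 2 • β (R₁ z) (R₂ z), ?_, ?_⟩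
  · have := hβR (continuousAt_const (y := a₁)) hR₂
    have := hβR hR₁ (continuousAt_const (y := a₂))
    have := hβR (continuousAt_const (y := c₁)) hR₂
    have := hβR hR₁ (continuousAt_const (y := c₂))
    have := hβR hR₁ hR₂
    fun_prop
  · filter_upwards [hF₁, hF₂] with z hz₁ hz₂
    rw [hz₁, hz₂]
    simp only [map_add, map_smul, LinearMap.add_apply, LinearMap.smul_apply]
    module

end HasExpansionAt

/-! ### Regular matrix valued functions -/

/-- All entries of `F` are regular at `b`. -/
def MatrixRegularAt {m n : Type*} (l : Filter ℂ) (F : ℂ → Matrix m n ℂ) (b : ℂ) : Prop :=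
  ∀ i j, RegularAt l (fun z => F z i j) b

namespace MatrixRegularAt

variable {m n p : Type*} {l : Filter ℂ} {F G : ℂ → Matrix m n ℂ} {b : ℂ}

lemma congr (hF : MatrixRegularAt l F b) (h : ∀ᶠ z in l, G z = F z) : MatrixRegularAt l G b :=
  fun i j => (hF i j).congr (h.mono fun z hz => by simp only [hz])

lemma mono {l' : Filter ℂ} (hF : MatrixRegularAt l F b) (hl : l' ≤ l) : MatrixRegularAt l' F b :=
  fun i j => (hF i j).mono hl

lemma const (A : Matrix m n ℂ) : MatrixRegularAt l (fun _ => A) b := fun i j =>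
  RegularAt.const (A i j)

lemma add (hF : MatrixRegularAt l F b) (hG : MatrixRegularAt l G b) :
    MatrixRegularAt l (fun z => F z + G z) b :=
  fun i j => (hF i j).add (hG i j)

lemma mul [Fintype n] {G : ℂ → Matrix n p ℂ} (hF : MatrixRegularAt l F b)
    (hG : MatrixRegularAt l G b) : MatrixRegularAt l (fun z => F z * G z) b := fun i j => by
  simp only [mul_apply]
  exact RegularAt.sum _ fun k _ => (hF i k).mul (hG k j)

lemma smul {f : ℂ → ℂ} (hf : RegularAt l f b) (hF : MatrixRegularAt l F b) :
    MatrixRegularAt l (fun z => f z • F z) b :=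
  fun i j => hf.mul (hF i j)

lemma transpose (hF : MatrixRegularAt l F b) : MatrixRegularAt l (fun z => (F z)ᵀ) b :=
  fun i j => hF j i

lemma conj_conj (hF : MatrixRegularAt (nhdsOpenDense b) F b) :
    MatrixRegularAt (nhdsOpenDense (conj b)) (fun z => (F (conj z)).map star) (conj b) :=
  fun i j => (hF i j).conj_conj

lemma neg_arg {l' : Filter ℂ} (hF : MatrixRegularAt l F b) (hl : Tendsto (fun z => -z) l' l) :
    MatrixRegularAt l' (fun z => F (-z)) (-b) :=
  fun i j => (hF i j).neg_arg hl

lemma inv_sub_smul [l.NeBot] (hl : l ≤ 𝓝[≠] b) (hF : MatrixRegularAt l F b)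
    (hlim : Tendsto F l (𝓝 0)) : MatrixRegularAt l (fun z => (z - b)⁻¹ • F z) b := fun i j =>
  (hF i j).inv_sub_mul hl (tendsto_pi_nhds.1 (tendsto_pi_nhds.1 hlim i) j)

lemma exists_tendsto (hF : MatrixRegularAt l F b) (hl : l ≤ 𝓝 b) : ∃ A, Tendsto F l (𝓝 A) := by
  choose u hu hFu using hF
  exact ⟨of fun i j => u i j b, tendsto_pi_nhds.2 fun i => tendsto_pi_nhds.2 fun j =>
    ((hu i j).continuousAt.tendsto.mono_left hl).congr' (hFu i j).symm⟩

lemma continuousAt (hF : MatrixRegularAt ⊤ F b) : ContinuousAt F b :=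
  continuousAt_pi.2 fun i => continuousAt_pi.2 fun j =>
    let ⟨_, hu, hFu⟩ := hF i j
    hu.continuousAt.congr (hFu.filter_mono le_top).symm

lemma exists_expansion [Finite m] [Finite n] (hF : MatrixRegularAt l F b) :
    ∃ (A B : Matrix m n ℂ) (R : ℂ → Matrix m n ℂ), MatrixRegularAt l R b ∧ ContinuousAt R b ∧
      ∀ᶠ z in l, F z = A + (z - b) • B + (z - b) ^ 2 • R z := by
  choose A B R hR h using fun i j => (hF i j).exists_expansion
  refine ⟨of A, of B, fun z => of fun i j => R i j z, fun i j => .of_analyticAt (hR i j),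
    continuousAt_pi.2 fun i => continuousAt_pi.2 fun j => (hR i j).continuousAt, ?_⟩
  filter_upwards [eventually_all.2 fun i => eventually_all.2 fun j => h i j] with z hz
  ext i j
  simpa using hz i j

lemma eventually_eq_one [DecidableEq n] [Finite n] {F : ℂ → Matrix n n ℂ}
    (h : ∀ b, MatrixRegularAt (nhdsOpenDense b) F b)
    (hlim : Tendsto F (cocompact ℂ ⊓ openDense) (𝓝 1)) : ∀ᶠ z in openDense, F z = 1 := by
  have hentries : ∀ᶠ z in openDense, ∀ i j, F z i j = (1 : Matrix n n ℂ) i j :=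
    eventually_all.2 fun i => eventually_all.2 fun j => eventually_eq_const_of_regularAt
      (fun b => h b i j) (((continuous_id.matrix_elem i j).tendsto (1 : Matrix n n ℂ)).comp hlim)
  filter_upwards [hentries] with z hz
  ext i j
  exact hz i j

end MatrixRegularAt

/-! ### Pole orders -/

/-- The loop `σ(F(-λ))` of the twisting condition. -/
def twist (F : ℂ → Mat7) (z : ℂ) : Mat7 := sMat * F (-z) * sMat

lemma twist_mul (F G : ℂ → Mat7) : twist (fun z => F z * G z) = fun z => twist F z * twist G z := by
  funext z
  simp only [twist, Matrix.mul_assoc]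
  rw [← Matrix.mul_assoc sMat sMat, sMat_mul_self, Matrix.one_mul]

lemma MatrixRegularAt.twist {l l' : Filter ℂ} {F : ℂ → Mat7} {b : ℂ} (hF : MatrixRegularAt l F b)
    (hl : Tendsto (fun z => -z) l' l) : MatrixRegularAt l' (twist F) (-b) :=
  ((MatrixRegularAt.const sMat).mul (hF.neg_arg hl)).mul (.const sMat)

/-- `g` has a pole of order at most `k` at `b`. -/
def PoleLE {m n : Type*} (g : ℂ → Matrix m n ℂ) (b : ℂ) (k : ℕ) : Prop :=
  MatrixRegularAt (nhdsOpenDense b) (fun z => (z - b) ^ k • g z) b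

namespace PoleLE

variable {m n : Type*} {g g' : ℂ → Matrix m n ℂ} {b : ℂ} {k : ℕ}

lemma mono {k' : ℕ} (h : PoleLE g b k) (hk : k ≤ k') : PoleLE g b k' := by
  refine (MatrixRegularAt.smul (.sub_pow b (k' - k)) h).congr (Eventually.of_forall fun z => ?_)
  rw [smul_smul, ← pow_add, Nat.sub_add_cancel hk]

lemma congr (h : PoleLE g b k) (hg : ∀ᶠ z in nhdsOpenDense b, g' z = g z) : PoleLE g' b k :=
  MatrixRegularAt.congr h (hg.mono fun z hz => by rw [hz])

lemma of_tendsto_zero (h : PoleLE g b (k + 1))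
    (hlim : Tendsto (fun z => (z - b) ^ (k + 1) • g z) (nhdsOpenDense b) (𝓝 0)) :
    PoleLE g b k := by
  refine (MatrixRegularAt.inv_sub_smul (nhdsOpenDense_le_nhdsNE b) h hlim).congr ?_
  filter_upwards [eventually_nhdsOpenDense_ne b b] with z hz
  rw [pow_succ', mul_smul, inv_smul_smul₀ (sub_ne_zero.2 hz)]

lemma mul_left {p : Type*} [Fintype m] {P : ℂ → Matrix p m ℂ} (h : PoleLE g b k)
    (hP : MatrixRegularAt (nhdsOpenDense b) P b) : PoleLE (fun z => P z * g z) b k :=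
  (hP.mul h).congr (Eventually.of_forall fun z => by rw [Matrix.mul_smul])

lemma transpose (h : PoleLE g b k) : PoleLE (fun z => (g z)ᵀ) b k :=
  (MatrixRegularAt.transpose h).congr (.of_forall fun z => by rw [transpose_smul])

lemma zero_iff : PoleLE g b 0 ↔ MatrixRegularAt (nhdsOpenDense b) g b := by
  simp [PoleLE]

lemma at_conj (h : PoleLE g b k) (hg : ∀ᶠ z in openDense, (g (conj z)).map star = g z) :
    PoleLE g (conj b) k := by
  refine (MatrixRegularAt.conj_conj h).congr ?_
  filter_upwards [nhdsOpenDense_le_openDense _ hg] with z hz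
  rw [← hz]
  ext i j
  simp

lemma at_neg {g : ℂ → Mat7} (h : PoleLE g b k) (hg : twist g =ᶠ[openDense] g) :
    PoleLE g (-b) k := by
  refine (MatrixRegularAt.smul (.const ((-1) ^ k))
    (MatrixRegularAt.twist h (tendsto_neg_nhdsOpenDense b))).congr ?_
  filter_upwards [nhdsOpenDense_le_openDense _ hg] with z hz
  rw [← hz, twist, twist, Matrix.mul_smul, Matrix.smul_mul, smul_smul, ← mul_pow]
  congr 2
  ring

end PoleLE

/-! ### Relations between leading coefficients -/

lemma dotProduct_eq_zero_of_hasExpansionAt {n : Type*} [Fintype n] {g : ℂ → Matrix n n ℂ}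
    {A B : Matrix n n ℂ} {b : ℂ} {k : ℕ}
    (hg : ∀ᶠ z in nhdsOpenDense b, ∀ x y, g z *ᵥ x ⬝ᵥ g z *ᵥ y = x ⬝ᵥ y)
    (h : HasExpansionAt (fun z => (z - b) ^ (k + 1) • g z) b A B) (x y : n → ℂ) :
    A *ᵥ x ⬝ᵥ A *ᵥ y = 0 ∧ A *ᵥ x ⬝ᵥ B *ᵥ y + B *ᵥ x ⬝ᵥ A *ᵥ y = 0 := by
  have hdot := (h.mulVec x).bilin (dotProductBilin ℂ ℂ)
    (by simp only [dotProductBilin_apply_apply]; fun_prop) (h.mulVec y)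
  have hconst : HasExpansionAt (fun z => (z - b) ^ (2 * k + 1 + 1) • (x ⬝ᵥ y)) b 0 0 := by
    simpa using (HasExpansionAt.const (x ⬝ᵥ y)).sub_pow_succ_smul (b := b) (2 * k + 1)
  refine hdot.unique (hconst.congr ?_)
  filter_upwards [hg] with z hz
  simp only [dotProductBilin_apply_apply, smul_mulVec, smul_dotProduct, dotProduct_smul, hz,
    smul_eq_mul]
  ring

lemma cross_eq_of_hasExpansionAt {g : ℂ → Mat7} {A B : Mat7} {b : ℂ} {k : ℕ}
    (hg : ∀ᶠ z in nhdsOpenDense b, IsG2 (g z))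
    (h : HasExpansionAt (fun z => (z - b) ^ (k + 1) • g z) b A B) (x y : V7) :
    (A *ᵥ x) ⨯₇ (A *ᵥ y) = 0 ∧ (A *ᵥ x) ⨯₇ (B *ᵥ y) + (B *ᵥ x) ⨯₇ (A *ᵥ y) =
      (if k = 0 then 1 else 0 : ℂ) • (A *ᵥ (x ⨯₇ y)) := by
  have hcross := (h.mulVec x).bilin cross continuous_cross (h.mulVec y)
  rw [ite_smul, one_smul, zero_smul]
  refine hcross.unique (((h.mulVec (x ⨯₇ y)).sub_pow_succ_smul k).congr ?_)
  filter_upwards [hg] with z hz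
  simp only [smul_mulVec, map_smul, LinearMap.smul_apply, hz.cross]

lemma isLeading_of_hasExpansionAt {g : ℂ → Mat7} {A B : Mat7} {b : ℂ} {k : ℕ}
    (hg : ∀ᶠ z in nhdsOpenDense b, IsG2 (g z))
    (h : HasExpansionAt (fun z => (z - b) ^ (k + 1) • g z) b A B) (hA : A ≠ 0) :
    IsLeading A B (if k = 0 then 1 else 0) := by
  have hdot := dotProduct_eq_zero_of_hasExpansionAt (hg.mono fun z hz => hz.dot) h
  have hdot_transpose := dotProduct_eq_zero_of_hasExpansionAt (g := fun z => (g z)ᵀ)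
    (hg.mono fun z hz => hz.transpose.dot) h.transpose
  have hcross := cross_eq_of_hasExpansionAt hg h
  refine ⟨hA, fun x y => (hdot x y).1, ?_, fun x y => (hdot x y).2, fun x y => (hcross x y).1,
    fun x y => (hcross x y).2⟩
  ext i j
  simpa [mul_apply, dotProduct] using (hdot_transpose (Pi.single i 1) (Pi.single j 1)).1

lemma sConj_mulVec_of_map_star {M M' : Mat7} (h : M.map star = sMat * M' * sMat) (x : V7) :
    sConj (M *ᵥ x) = M' *ᵥ sConj x := by
  rw [sConj, star_mulVec_eq_map_star_mulVec, h, ← mulVec_mulVec, ← mulVec_mulVec,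
    sMat_mulVec_sMat_mulVec, sConj]

lemma isSConjSemiinvariant_of_hasExpansionAt {g : ℂ → Mat7} {A B : Mat7} {α : ℂ} {k : ℕ}
    (hα : α.re = 0) (hg : ∀ᶠ z in nhdsOpenDense α, (g (-conj z)).map star = sMat * g z * sMat)
    (h : HasExpansionAt (fun z => (z - α) ^ k • g z) α A B) :
    IsSConjSemiinvariant ((-1) ^ k) A ∧ IsSConjSemiinvariant (-(-1) ^ k) B := by
  have hconjα : conj α = -α := by apply Complex.ext <;> simp [hα]
  have hunique (x : V7) : sConj (A *ᵥ x) = (-1 : ℂ) ^ k • (A *ᵥ sConj x) ∧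
      -sConj (B *ᵥ x) = (-1 : ℂ) ^ k • (B *ᵥ sConj x) := by
    have hreflect := ((h.mulVec x).star.neg_arg).const_mulVec sMat
    rw [hconjα, neg_neg, mulVec_neg] at hreflect
    refine hreflect.unique (((h.mulVec (sConj x)).const_smul ((-1) ^ k)).congr ?_)
    filter_upwards [hg] with z hz
    have hfactor : star (-conj z - α) = -1 * (z - α) := by
      rw [RCLike.star_def, map_sub, map_neg, Complex.conj_conj, hconjα]
      ring
    rw [← sConj, smul_mulVec, sConj_smul, map_neg, sConj_mulVec_of_map_star hz, star_pow, hfactor,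
      mul_pow, smul_mulVec, mul_smul]
  refine ⟨fun x => (hunique x).1, fun x => ?_⟩
  rw [neg_smul, ← (hunique x).2, neg_neg]

/-! ### Lowering the order of a pole -/

/-- The coefficient of the product of the simple elements of `m + c k̄` and `k` in its simple pole,
up to a scalar, for a coassociative frame `m, k`. -/
def frameResidue (m k : V7) (c : ℂ) : Mat7 :=
  vecMulVec (star m) m + vecMulVec (star k) k - star c • (vecMulVec m k - vecMulVec k m)

lemma frameResidue_mulVec (m k : V7) (c : ℂ) (x : V7) : frameResidue m k c *ᵥ x =
    (m ⬝ᵥ x) • star m + (k ⬝ᵥ x) • star k - star c • ((k ⬝ᵥ x) • m - (m ⬝ᵥ x) • k) := by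
  simp [frameResidue, add_mulVec, sub_mulVec, smul_mulVec, vecMulVec_mulVec]

lemma IsCoassociativeFrame.simpleElement_mul_simpleElement_eq_frameResidue {m k : V7}
    (h : IsCoassociativeFrame m k) (c : ℂ) {u : ℂ} (hu : u ≠ 0) :
    simpleElement (m + c • star k) u * simpleElement k u =
      1 + ((u - 1) / (1 + c * star c)) • frameResidue m k c +
        ((u⁻¹ - 1) / (1 + c * star c)) • frameResidue (star m) (star k) (star c) := by
  have hnorm := one_add_mul_star_ne_zero c
  refine Matrix.mulVec_injective (funext fun x => ?_)
  rw [← mulVec_mulVec]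
  simp only [simpleElement_mulVec _ u, add_mulVec, smul_mulVec, one_mulVec, frameResidue_mulVec,
    star_add, star_smul, star_star, dotProduct_add, add_dotProduct, smul_dotProduct,
    dotProduct_smul, h.dot_lk, h.dot_kl, h.dot_kk, h.star_dot_ll, h.star_dot_kk, h.star_dot_lk,
    h.dot_star_lk, h.dot_star_kk, h.star.dot_lk, h.star.dot_kk, smul_eq_mul, mul_zero, mul_one,
    add_zero, zero_add]
  generalize star c = c' at *
  match_scalars <;> field_simp <;> ring

namespace IsAdaptedFrame

variable {A B : Mat7} {m k : V7} {κ : ℂ}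

lemma frameResidue_mul (h : IsAdaptedFrame A B m k κ) (c : ℂ) : frameResidue m k c * A = 0 := by
  refine Matrix.mulVec_injective (funext fun x => ?_)
  have hm : m ⬝ᵥ A *ᵥ x = 0 := by
    rw [h.mulVec_eq]
    simp [h.frame.dot_ll, h.frame.dot_lk]
  have hk : k ⬝ᵥ A *ᵥ x = 0 := by
    rw [h.mulVec_eq]
    simp [h.frame.dot_kl, h.frame.dot_kk]
  rw [← mulVec_mulVec, frameResidue_mulVec, hm, hk]
  simp

-- This cancellation is what determines the coefficient `κ * δ` of the simple element.
lemma sub_frameResidue_mul_add (h : IsAdaptedFrame A B m k κ) {δ N : ℂ}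
    (hN : N = 1 + κ * δ * star (κ * δ)) (hN0 : N ≠ 0) :
    (1 - N⁻¹ • frameResidue (star m) (star k) (star (κ * δ))) * A +
      (δ / N) • frameResidue m k (κ * δ) * B = 0 := by
  refine Matrix.mulVec_injective (funext fun x => ?_)
  rw [add_mulVec, ← mulVec_mulVec, ← mulVec_mulVec]
  simp only [sub_mulVec, smul_mulVec, one_mulVec, zero_mulVec, frameResidue_mulVec, star_star,
    h.dot_fst, h.dot_snd]
  nth_rw 1 [h.mulVec_eq]
  generalize star (κ * δ) = c' at *
  match_scalars <;> field_simp <;> rw [hN] <;> ring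

end IsAdaptedFrame

lemma PoleLE.of_mul_cancel {m n p : Type*} [Fintype m] {P Q : ℂ → Matrix p m ℂ}
    {g R : ℂ → Matrix m n ℂ} {A B : Matrix m n ℂ} {Q₀ Y : Matrix p m ℂ} {α : ℂ} {k : ℕ}
    (hP : ∀ᶠ z in nhdsOpenDense α, P z = Q₀ + (z - α) • Q z + (z - α)⁻¹ • Y)
    (hQ : MatrixRegularAt (nhdsOpenDense α) Q α) (hR : MatrixRegularAt (nhdsOpenDense α) R α)
    (hg : ∀ᶠ z in nhdsOpenDense α,
      (z - α) ^ (k + 1) • g z = A + (z - α) • B + (z - α) ^ 2 • R z)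
    (hYA : Y * A = 0) (hQAYB : Q₀ * A + Y * B = 0) : PoleLE (fun z => P z * g z) α k := by
  have hreg : MatrixRegularAt (nhdsOpenDense α)
      (fun z => Q z * ((z - α) ^ (k + 1) • g z) + Q₀ * (B + (z - α) • R z) + Y * R z) α := by
    have hexp := (((MatrixRegularAt.const A).add (.smul (.sub_const α) (.const B))).add
      (.smul (.sub_pow α 2) hR)).congr hg
    exact ((hQ.mul hexp).add ((MatrixRegularAt.const Q₀).mul
      ((MatrixRegularAt.const B).add (.smul (.sub_const α) hR)))).add
      ((MatrixRegularAt.const Y).mul hR)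
  refine hreg.congr ?_
  filter_upwards [hP, hg, eventually_nhdsOpenDense_ne α α] with z hPz hgz hz
  have ht : z - α ≠ 0 := sub_ne_zero.2 hz
  refine smul_right_injective _ ht ?_
  calc (z - α) • (z - α) ^ k • (P z * g z) = P z * ((z - α) ^ (k + 1) • g z) := by
        rw [smul_smul, ← pow_succ', Matrix.mul_smul]
    _ = (z - α) • (Q z * ((z - α) ^ (k + 1) • g z)) + (Q₀ + (z - α)⁻¹ • Y) *
          (A + (z - α) • B + (z - α) ^ 2 • R z) := by
        rw [hPz, ← hgz]
        simp only [Matrix.add_mul, Matrix.smul_mul]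
        abel
    _ = (z - α) • (Q z * ((z - α) ^ (k + 1) • g z)) + (Q₀ * A + Y * B) + (z - α)⁻¹ • (Y * A) +
          (z - α) • (Q₀ * (B + (z - α) • R z) + Y * R z) := by
        simp only [Matrix.add_mul, Matrix.mul_add, Matrix.smul_mul, Matrix.mul_smul]
        match_scalars <;> field_simp
    _ = _ := by
        rw [hYA, hQAYB]
        module

lemma ne_conj_of_im_ne_zero {α : ℂ} (hα : α.im ≠ 0) : α ≠ conj α := fun h =>
  hα (Complex.conj_eq_iff_im.1 h.symm)

lemma matSub_sMat_line {x : V7} (hx : sConj x = x) : matSub sMat (line x) = conjSub (line x) := by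
  have hstar : sMat *ᵥ x = star x := by
    conv_lhs => rw [← hx]
    rw [sConj, sMat_mulVec_sMat_mulVec]
  rw [matSub_line, conjSub_line, hstar]

lemma IsAdaptedFrame.poleLE_pPair_mul {g R : ℂ → Mat7} {A B : Mat7} {m k : V7} {κ α : ℂ} {n : ℕ}
    (h : IsAdaptedFrame A B m k κ) (hα : α.im ≠ 0) (hR : MatrixRegularAt (nhdsOpenDense α) R α)
    (hg : ∀ᶠ z in nhdsOpenDense α,
      (z - α) ^ (n + 1) • g z = A + (z - α) • B + (z - α) ^ 2 • R z) :
    PoleLE (fun z => pPair α (line (m + (κ * (α - conj α)) • star k)) (line k) z * g z) α n := by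
  have hne := ne_conj_of_im_ne_zero hα
  set δ := α - conj α with hδ
  set c := κ * δ
  set X := frameResidue (star m) (star k) (star c)
  have hN := one_add_mul_star_ne_zero c
  refine PoleLE.of_mul_cancel (Q₀ := 1 - (1 + c * star c)⁻¹ • X)
    (Q := fun z => (z - conj α)⁻¹ • (1 + c * star c)⁻¹ • X)
    (Y := (δ / (1 + c * star c)) • frameResidue m k c) ?_ (.smul (.inv_sub hne) (.const _)) hR hg
    (by rw [Matrix.smul_mul, h.frameResidue_mul, smul_zero])
    (h.sub_frameResidue_mul_add rfl hN)
  filter_upwards [eventually_nhdsOpenDense_ne α α, eventually_nhdsOpenDense_ne (conj α) α]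
    with z hzα hzα'
  have hz : z - α ≠ 0 := sub_ne_zero.2 hzα
  have hz' : z - conj α ≠ 0 := sub_ne_zero.2 hzα'
  rw [pPair_line_line (h.frame.swap.add_smul_star_ne_zero c)
    (h.frame.swap.add_smul_star_isotropic c) (ne_zero_of_star_dotProduct_self h.frame.star_dot_kk)
    h.frame.dot_kk, h.frame.simpleElement_mul_simpleElement_eq_frameResidue c (div_ne_zero hz' hz),
    hδ]
  match_scalars <;> field_simp <;> ring

theorem exists_pair_lowering {g : ℂ → Mat7} {α : ℂ} (hα : α.im ≠ 0) {n : ℕ}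
    (hg : ∀ᶠ z in nhdsOpenDense α, IsG2 (g z)) (hpole : PoleLE g α (n + 1))
    (hpole' : ¬PoleLE g α n) :
    ∃ L K, IsPair L K ∧ PoleLE (fun z => pPair α L K z * g z) α n ∧
      (α.re = 0 → (∀ᶠ z in nhdsOpenDense α, (g (-conj z)).map star = sMat * g z * sMat) →
        matSub sMat L = conjSub L ∧ matSub sMat K = conjSub K) := by
  obtain ⟨A, B, R, hR, hR_cont, hexp⟩ := MatrixRegularAt.exists_expansion hpole
  have hexpansion : HasExpansionAt (fun z => (z - α) ^ (n + 1) • g z) α A B := ⟨R, hR_cont, hexp⟩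
  have hA : A ≠ 0 := by
    rintro rfl
    exact hpole' (hpole.of_tendsto_zero hexpansion.tendsto)
  obtain ⟨m, k, κ, hadapted, hreal⟩ :=
    (isLeading_of_hasExpansionAt hg hexpansion hA).exists_isAdaptedFrame
  refine ⟨_, _, hadapted.frame.isPair_add_smul_star (κ * (α - conj α)),
    hadapted.poleLE_pPair_mul hα hR hexp, fun hre htwist => ?_⟩
  obtain ⟨hA_real, hB_real⟩ := isSConjSemiinvariant_of_hasExpansionAt hre htwist hexpansion
  obtain ⟨hm, hk, hκ⟩ := hreal _ (by rw [← mul_pow]; simp) hA_real hB_real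
  have hc : star (κ * (α - conj α)) = κ * (α - conj α) := by
    simp only [RCLike.star_def, map_mul, map_sub, Complex.conj_conj] at hκ ⊢
    rw [hκ]
    ring
  refine ⟨matSub_sMat_line ?_, matSub_sMat_line hk⟩
  have hk_star : sConj (star k) = star k := by rw [sConj, ← star_sMat_mulVec, ← sConj, hk]
  rw [sConj_add, sConj_smul, hc, hm, hk_star]

/-! ### Orthogonal loops -/

lemma transpose_sMat : sMatᵀ = sMat := diagonal_transpose _

lemma map_star_sMat : sMat.map star = sMat := by
  rw [sMat, diagonal_map (star_zero ℂ)]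
  congr 1
  ext i
  fin_cases i <;> simp

lemma map_star_mul {l m n : Type*} [Fintype m] (A : Matrix l m ℂ) (B : Matrix m n ℂ) :
    (A * B).map star = A.map star * B.map star :=
  Matrix.map_mul (f := starRingEnd ℂ)

lemma eventually_notMem_nhdsNE {P : Set ℂ} (hP : P.Finite) (b : ℂ) : ∀ᶠ z in 𝓝[≠] b, z ∉ P :=
  nhdsNE_le_cofinite b hP.compl_mem_cofinite

lemma transpose_mul_self_of_tendsto {n : Type*} [Fintype n] [DecidableEq n] {l : Filter ℂ} [l.NeBot]
    {F : ℂ → Matrix n n ℂ} {A : Matrix n n ℂ} (hF : ∀ᶠ z in l, (F z)ᵀ * F z = 1)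
    (hA : Tendsto F l (𝓝 A)) : Aᵀ * A = 1 := by
  have hcont : Continuous fun M : Matrix n n ℂ => Mᵀ * M := by fun_prop
  exact tendsto_nhds_unique_of_eventuallyEq ((hcont.tendsto A).comp hA) tendsto_const_nhds hF

/-- A real orthogonal loop with value `1` at `∞` that is analytic outside of `P`; regularity along
`⊤` is analyticity. -/
structure IsOrthogonalLoop {n : Type*} [Fintype n] [DecidableEq n] (F : ℂ → Matrix n n ℂ)
    (P : Set ℂ) : Prop where
  regular : ∀ b ∉ P, MatrixRegularAt ⊤ F b
  real : ∀ z, (F (conj z)).map star = F z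
  tendsto_cocompact : Tendsto F (cocompact ℂ) (𝓝 1)
  transpose_mul_self : ∀ z ∉ P, (F z)ᵀ * F z = 1

namespace IsOrthogonalLoop

variable {n : Type*} [Fintype n] [DecidableEq n] {F G : ℂ → Matrix n n ℂ} {P Q : Set ℂ}

lemma one : IsOrthogonalLoop (fun _ => (1 : Matrix n n ℂ)) P where
  regular _ _ := .const 1
  real _ := Matrix.map_one _ (star_zero ℂ) (star_one ℂ)
  tendsto_cocompact := tendsto_const_nhds
  transpose_mul_self _ _ := by rw [transpose_one, Matrix.one_mul]

lemma mul (hF : IsOrthogonalLoop F P) (hG : IsOrthogonalLoop G Q) :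
    IsOrthogonalLoop (fun z => F z * G z) (P ∪ Q) where
  regular b hb := (hF.regular b fun h => hb (.inl h)).mul (hG.regular b fun h => hb (.inr h))
  real z := by rw [map_star_mul, hF.real, hG.real]
  tendsto_cocompact := by simpa using hF.tendsto_cocompact.mul hG.tendsto_cocompact
  transpose_mul_self z hz := by
    rw [transpose_mul, Matrix.mul_assoc, ← Matrix.mul_assoc _ (F z),
      hF.transpose_mul_self z fun h => hz (.inl h), Matrix.one_mul,
      hG.transpose_mul_self z fun h => hz (.inr h)]

lemma mono (hF : IsOrthogonalLoop F P) (hPQ : P ⊆ Q) : IsOrthogonalLoop F Q :=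
  ⟨fun b hb => hF.regular b fun h => hb (hPQ h), hF.real, hF.tendsto_cocompact,
    fun z hz => hF.transpose_mul_self z fun h => hz (hPQ h)⟩

lemma transpose (hF : IsOrthogonalLoop F P) : IsOrthogonalLoop (fun z => (F z)ᵀ) P where
  regular b hb := (hF.regular b hb).transpose
  real z := by rw [transpose_map, hF.real]
  tendsto_cocompact := by
    have h := (continuous_id.matrix_transpose.tendsto _).comp hF.tendsto_cocompact
    rwa [id, transpose_one] at h
  transpose_mul_self z hz := by
    rw [transpose_transpose, mul_eq_one_comm.1 (hF.transpose_mul_self z hz)]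

lemma twist {F : ℂ → Mat7} (hF : IsOrthogonalLoop F P) : IsOrthogonalLoop (twist F) {z | -z ∈ P}
    where
  regular b hb := by simpa using (hF.regular (-b) hb).twist (l' := ⊤) tendsto_top
  real z := by
    rw [G2Loop.twist, map_star_mul, map_star_mul, map_star_sMat, ← map_neg, hF.real, G2Loop.twist]
  tendsto_cocompact := by
    have hneg : Tendsto (fun z : ℂ => -z) (cocompact ℂ) (cocompact ℂ) :=
      (Homeomorph.neg ℂ).isClosedEmbedding.tendsto_cocompact
    have h := ((hF.tendsto_cocompact.comp hneg).const_mul sMat).mul_const sMat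
    rwa [Matrix.mul_one, sMat_mul_self] at h
  transpose_mul_self z hz := by
    rw [G2Loop.twist, transpose_mul, transpose_mul, transpose_sMat]
    calc sMat * ((F (-z))ᵀ * sMat) * (sMat * F (-z) * sMat)
        = sMat * ((F (-z))ᵀ * (sMat * sMat) * F (-z)) * sMat := by simp only [Matrix.mul_assoc]
      _ = 1 := by
        rw [sMat_mul_self, Matrix.mul_one, hF.transpose_mul_self _ hz, Matrix.mul_one,
          sMat_mul_self]

lemma tendsto_nhdsNE (hF : IsOrthogonalLoop F P) {b : ℂ} (hb : b ∉ P) :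
    Tendsto F (𝓝[≠] b) (𝓝 (F b)) :=
  (hF.regular b hb).continuousAt.tendsto.mono_left nhdsWithin_le_nhds

lemma eventually_transpose_mul_self (hF : IsOrthogonalLoop F P) (hP : P.Finite) (b : ℂ) :
    ∀ᶠ z in 𝓝[≠] b, (F z)ᵀ * F z = 1 :=
  (eventually_notMem_nhdsNE hP b).mono hF.transpose_mul_self

lemma regular_conj (hF : IsOrthogonalLoop F P) {b : ℂ}
    (h : MatrixRegularAt (nhdsOpenDense b) F b) :
    MatrixRegularAt (nhdsOpenDense (conj b)) F (conj b) :=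
  h.conj_conj.congr (.of_forall fun z => (hF.real z).symm)

lemma eventually_eq_one (hF : IsOrthogonalLoop F P)
    (h : ∀ b ∈ P, MatrixRegularAt (nhdsOpenDense b) F b) : ∀ᶠ z in openDense, F z = 1 :=
  MatrixRegularAt.eventually_eq_one
    (fun b => (em (b ∈ P)).elim (h b) fun hb => (hF.regular b hb).mono le_top)
    (hF.tendsto_cocompact.mono_left inf_le_left)

lemma eventually_eq_of_mul_transpose (hF : IsOrthogonalLoop F P) (hG : IsOrthogonalLoop G P)
    (hP : P.Finite) (h : ∀ b ∈ P, MatrixRegularAt (nhdsOpenDense b) (fun z => F z * (G z)ᵀ) b) :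
    F =ᶠ[openDense] G := by
  have hquot := (hF.mul hG.transpose).mono (Set.union_self P).subset
  filter_upwards [hquot.eventually_eq_one h, compl_mem_openDense_of_finite hP] with z hz hzP
  rw [← Matrix.mul_one (F z), ← hG.transpose_mul_self z hzP, ← Matrix.mul_assoc, hz, Matrix.one_mul]

end IsOrthogonalLoop

/-! ### Simple loops -/

/-- A spanning vector of an isotropic line. -/
structure IsNullVector {n : Type*} [Fintype n] (w : n → ℂ) : Prop where
  ne_zero : w ≠ 0
  dotProduct_self : w ⬝ᵥ w = 0

lemma IsNullVector.mulVec {n : Type*} [Fintype n] [DecidableEq n] {w : n → ℂ} (hw : IsNullVector w)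
    {A : Matrix n n ℂ} (hA : Aᵀ * A = 1) : IsNullVector (A *ᵥ w) where
  ne_zero h := hw.ne_zero (by rw [← one_mulVec w, ← hA, ← mulVec_mulVec, h, mulVec_zero])
  dotProduct_self := by
    rw [(forall_mulVec_dotProduct_mulVec_iff A).2 hA, hw.dotProduct_self]

namespace IsCoassociativeFrame

variable {l k : V7}

lemma isNullVector_fst (h : IsCoassociativeFrame l k) : IsNullVector l :=
  ⟨ne_zero_of_star_dotProduct_self h.star_dot_ll, h.dot_ll⟩

lemma isNullVector_add_smul_star (h : IsCoassociativeFrame l k) (c : ℂ) :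
    IsNullVector (k + c • star l) :=
  ⟨h.add_smul_star_ne_zero c, h.add_smul_star_isotropic c⟩

end IsCoassociativeFrame

lemma RegularAt.div_sub {l : Filter ℂ} {a' b : ℂ} (a : ℂ) (h : b ≠ a') :
    RegularAt l (fun z => (z - a) / (z - a')) b :=
  (RegularAt.sub_const a).mul (.inv_sub h)

lemma tendsto_div_cocompact (a a' : ℂ) :
    Tendsto (fun z : ℂ => (z - a) / (z - a')) (cocompact ℂ) (𝓝 1) := by
  have hinv : Tendsto (fun z : ℂ => (z - a')⁻¹) (cocompact ℂ) (𝓝 0) :=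
    (tendsto_inv₀_cobounded.mono_left Metric.cobounded_eq_cocompact.ge).comp
      (Homeomorph.subRight a').isClosedEmbedding.tendsto_cocompact
  have hlim := (hinv.const_mul (a' - a)).const_add 1
  rw [mul_zero, add_zero] at hlim
  refine hlim.congr' ?_
  filter_upwards [isCompact_singleton.compl_mem_cocompact (s := {a'})] with z hz
  have hz' : z - a' ≠ 0 := sub_ne_zero.2 hz
  field_simp
  ring

section SimpleLoop

variable {n : Type*} [Fintype n] [DecidableEq n]

lemma continuousAt_simpleElement (w : n → ℂ) {u : ℂ} (hu : u ≠ 0) :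
    ContinuousAt (simpleElement w) u := by
  unfold simpleElement
  fun_prop (disch := assumption)

lemma MatrixRegularAt.simpleElement {l : Filter ℂ} {b : ℂ} {u : ℂ → ℂ} (hu : RegularAt l u b)
    (hu' : RegularAt l (fun z => (u z)⁻¹) b) (w : n → ℂ) :
    MatrixRegularAt l (fun z => simpleElement w (u z)) b := by
  have hcoeff {f : ℂ → ℂ} (hf : RegularAt l f b) :
      RegularAt l (fun z => (f z - 1) / (star w ⬝ᵥ w)) b := by
    simpa only [sub_eq_add_neg, div_eq_mul_inv] using (hf.add (.const (-1))).mul (.const _)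
  exact ((MatrixRegularAt.const 1).add (.smul (hcoeff hu) (.const _))).add
    (.smul (hcoeff hu') (.const _))

/-- The loop `p_{α,L}` of the isotropic line `L` spanned by `w`, in any dimension. -/
def simpleLoop (w : n → ℂ) (α z : ℂ) : Matrix n n ℂ := simpleElement w ((z - conj α) / (z - α))

lemma isOrthogonalLoop_simpleLoop {w : n → ℂ} (hw : IsNullVector w) (α : ℂ) :
    IsOrthogonalLoop (simpleLoop w α) {α, conj α} where
  regular b hb := by
    rw [Set.mem_insert_iff, Set.mem_singleton_iff, not_or] at hb
    refine .simpleElement (.div_sub _ hb.1) ?_ w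
    simpa only [inv_div] using RegularAt.div_sub α hb.2
  real z := by
    rw [simpleLoop, map_star_simpleElement, simpleLoop]
    congr 1
    simp [RCLike.star_def]
  tendsto_cocompact := by
    have h := (continuousAt_simpleElement w one_ne_zero).tendsto.comp
      (tendsto_div_cocompact (conj α) α)
    rwa [simpleElement_one] at h
  transpose_mul_self z hz := by
    rw [Set.mem_insert_iff, Set.mem_singleton_iff, not_or] at hz
    have hu : (z - conj α) / (z - α) ≠ 0 := div_ne_zero (sub_ne_zero.2 hz.2) (sub_ne_zero.2 hz.1)
    rw [simpleLoop, transpose_simpleElement, simpleElement_mul_simpleElement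
      hw.ne_zero hw.dotProduct_self (inv_ne_zero hu) hu, inv_mul_cancel₀ hu, simpleElement_one]

/-- The loop `p_{α,L,K}` of the isotropic lines `L` and `K` spanned by `v` and `w`, in any
dimension and without an admissibility condition. -/
def simplePairLoop (v w : n → ℂ) (α z : ℂ) : Matrix n n ℂ := simpleLoop v α z * simpleLoop w α z

lemma isOrthogonalLoop_simplePairLoop {v w : n → ℂ} (hv : IsNullVector v) (hw : IsNullVector w)
    (α : ℂ) : IsOrthogonalLoop (simplePairLoop v w α) {α, conj α} :=
  ((isOrthogonalLoop_simpleLoop hv α).mul (isOrthogonalLoop_simpleLoop hw α)).mono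
    (Set.union_self _).subset

end SimpleLoop

lemma twist_simpleLoop (w : V7) (α : ℂ) : twist (simpleLoop w α) = simpleLoop (sMat *ᵥ w) (-α) := by
  funext z
  have hu : (-z - conj α) / (-z - α) = (z - conj (-α)) / (z - -α) := by
    rw [← neg_div_neg_eq, map_neg]
    ring
  rw [twist, simpleLoop, simpleLoop, ← hu,
    ← mul_simpleElement_mul_transpose isG2_sMat.transpose_mul map_star_sMat, transpose_sMat]

lemma twist_simplePairLoop (v w : V7) (α : ℂ) :
    twist (simplePairLoop v w α) = simplePairLoop (sMat *ᵥ v) (sMat *ᵥ w) (-α) := by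
  unfold simplePairLoop
  rw [twist_mul, twist_simpleLoop, twist_simpleLoop]

lemma pPair_line {v w : V7} (hv : IsNullVector v) (hw : IsNullVector w) (α : ℂ) :
    pPair α (line v) (line w) = simplePairLoop v w α :=
  funext fun z => pPair_line_line hv.ne_zero hv.dotProduct_self hw.ne_zero hw.dotProduct_self α z

namespace IsCoassociativeFrame

variable {l k : V7}

lemma isOrthogonalLoop_simplePairLoop (h : IsCoassociativeFrame l k) (c α : ℂ) :
    IsOrthogonalLoop (simplePairLoop l (k + c • star l) α) {α, conj α} :=
  G2Loop.isOrthogonalLoop_simplePairLoop h.isNullVector_fst (h.isNullVector_add_smul_star c) α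

lemma eventually_isG2_simplePairLoop (h : IsCoassociativeFrame l k) (c α : ℂ) :
    ∀ᶠ z in openDense, IsG2 (simplePairLoop l (k + c • star l) α z) := by
  filter_upwards [compl_mem_openDense_of_finite (Set.toFinite {α, conj α})] with z hz
  rw [Set.mem_compl_iff, Set.mem_insert_iff, Set.mem_singleton_iff, not_or] at hz
  exact h.isG2_simpleElement_mul_simpleElement c
    (div_ne_zero (sub_ne_zero.2 hz.2) (sub_ne_zero.2 hz.1))

lemma poleLE_simpleLoop_mul_simpleLoop (h : IsCoassociativeFrame l k) (c : ℂ) {α : ℂ}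
    (hα : α.im ≠ 0) : PoleLE (simplePairLoop (l + c • star k) k α) α 1 := by
  obtain ⟨N, hN_def⟩ : ∃ N, N = 1 + c * star c := ⟨_, rfl⟩
  have hN : N ≠ 0 := hN_def ▸ one_add_mul_star_ne_zero c
  have hinv : RegularAt (nhdsOpenDense α)
      (fun z => (z - α) * (((z - α) * (z - conj α)⁻¹ + -1) * N⁻¹)) α :=
    (RegularAt.sub_const α).mul ((((RegularAt.sub_const α).mul
      (.inv_sub (ne_conj_of_im_ne_zero hα))).add (.const (-1))).mul (.const N⁻¹))
  refine (((MatrixRegularAt.smul (.sub_const α) (.const 1)).add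
    (.const (((α - conj α) / N) • frameResidue l k c))).add
    (.smul hinv (.const (frameResidue (star l) (star k) (star c))))).congr ?_
  filter_upwards [eventually_nhdsOpenDense_ne α α, eventually_nhdsOpenDense_ne (conj α) α]
    with z hzα hzα'
  have hz : z - α ≠ 0 := sub_ne_zero.2 hzα
  have hz' : z - conj α ≠ 0 := sub_ne_zero.2 hzα'
  rw [simplePairLoop, simpleLoop, simpleLoop,
    h.simpleElement_mul_simpleElement_eq_frameResidue c (div_ne_zero hz' hz), ← hN_def]
  match_scalars <;> field_simp <;> ring

lemma poleLE_simplePairLoop (h : IsCoassociativeFrame l k) (c : ℂ) {α : ℂ} (hα : α.im ≠ 0) :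
    PoleLE (simplePairLoop l (k + c • star l) α) α 1 := by
  obtain ⟨r, hr, hrc⟩ := exists_ofReal_sq_eq_one_add_mul_star c
  have hrotate := h.rotate (c := -c) hr (by rw [hrc, star_neg, neg_mul_neg])
  have hsnd : (r : ℂ)⁻¹ • (k - -c • star l) = (r : ℂ)⁻¹ • (k + c • star l) := by
    rw [neg_smul, sub_neg_eq_add]
  have hfst : (r : ℂ)⁻¹ • (l + -c • star k) + c • star ((r : ℂ)⁻¹ • (k + c • star l)) =
      (r : ℂ) • l := by
    simp only [star_smul, star_inv₀, RCLike.star_def, Complex.conj_ofReal, star_add, star_star]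
    rw [RCLike.star_def] at hrc
    match_scalars
    · field_simp
      rw [hrc]
    · ring
  rw [hsnd] at hrotate
  have hpole := hrotate.poleLE_simpleLoop_mul_simpleLoop c hα
  rw [hfst] at hpole
  refine hpole.congr (.of_forall fun z => ?_)
  simp only [simplePairLoop, simpleLoop, simpleElement_smul hr, simpleElement_smul (inv_ne_zero hr)]

end IsCoassociativeFrame

/-! ### Dressing -/

lemma MatrixRegularAt.add_inv_sub_smul_mul_mul {m n p q : Type*} [Fintype n] [Fintype p]
    {l : Filter ℂ} [l.NeBot] {b : ℂ} {X : ℂ → Matrix m n ℂ} {F R : ℂ → Matrix n p ℂ}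
    {Y : ℂ → Matrix p q ℂ} {X₀ C : Matrix m n ℂ} {A B : Matrix n p ℂ} {Y₀ D : Matrix p q ℂ}
    (hl : l ≤ 𝓝[≠] b) (hX : MatrixRegularAt l X b) (hF : MatrixRegularAt l F b)
    (hY : MatrixRegularAt l Y b) (hR : MatrixRegularAt l R b) (hX₀ : Tendsto X l (𝓝 X₀))
    (hA : Tendsto F l (𝓝 A)) (hY₀ : Tendsto Y l (𝓝 Y₀))
    (hFR : ∀ᶠ z in l, F z = A + (z - b) • B + (z - b) ^ 2 • R z) (hCY : C * (A * Y₀) = 0)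
    (hXD : X₀ * A * D = 0) (hCAD : C * A * D = 0) (hCBD : C * B * D = 0) :
    MatrixRegularAt l (fun z => (X z + (z - b)⁻¹ • C) * F z * (Y z + (z - b)⁻¹ • D)) b := by
  have hCFY : Tendsto (fun z => C * (F z * Y z)) l (𝓝 0) := by
    have hcont : Continuous fun M : Matrix n p ℂ × Matrix p q ℂ => C * (M.1 * M.2) := by fun_prop
    have hprod := (hcont.tendsto (A, Y₀)).comp (hA.prodMk_nhds hY₀)
    rwa [hCY] at hprod
  have hXFD : Tendsto (fun z => X z * F z * D) l (𝓝 0) := by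
    have hcont : Continuous fun M : Matrix m n ℂ × Matrix n p ℂ => M.1 * M.2 * D := by fun_prop
    have hprod := (hcont.tendsto (X₀, A)).comp (hX₀.prodMk_nhds hA)
    rwa [hXD] at hprod
  refine ((((hX.mul hF).mul hY).add (((MatrixRegularAt.const C).mul (hF.mul hY)).inv_sub_smul hl
    hCFY)).add (((hX.mul hF).mul (.const D)).inv_sub_smul hl hXFD) |>.add
    (((MatrixRegularAt.const C).mul hR).mul (.const D))).congr ?_
  filter_upwards [hFR, hl self_mem_nhdsWithin] with z hz hzb
  have hCFD : C * F z * D = (z - b) ^ 2 • (C * R z * D) := by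
    simp only [hz, Matrix.mul_add, Matrix.add_mul, Matrix.mul_smul, Matrix.smul_mul, hCAD, hCBD,
      smul_zero, zero_add]
  have hCRD : (z - b)⁻¹ • (z - b)⁻¹ • (C * F z * D) = C * R z * D := by
    rw [hCFD, smul_smul, smul_smul, ← sq, ← mul_pow, inv_mul_cancel₀ (sub_ne_zero.2 hzb), one_pow,
      one_smul]
  simp only [Matrix.mul_assoc] at hCRD
  simp only [Matrix.add_mul, Matrix.mul_add, Matrix.smul_mul, Matrix.mul_smul, smul_add,
    Matrix.mul_assoc, hCRD]
  abel

section Dressing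

variable {n : Type*} [Fintype n] {k w : n → ℂ} {β : ℂ}

/-- The residue at `α` of the loop `p_{α,L}` of the isotropic line `L` spanned by `w`. -/
def simpleLoopResidue (w : n → ℂ) (α : ℂ) : Matrix n n ℂ :=
  ((α - conj α) / (star w ⬝ᵥ w)) • vecMulVec (star w) w

lemma simpleLoopResidue_mul_eq_zero (α : ℂ) {m : Type*} {M : Matrix n m ℂ} (hM : w ᵥ* M = 0) :
    simpleLoopResidue w α * M = 0 := by
  ext i j
  simp [simpleLoopResidue, Matrix.smul_mul, vecMulVec_mul, hM, vecMulVec_apply]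

lemma mul_transpose_simpleLoopResidue (α : ℂ) {m : Type*} (M : Matrix m n ℂ) :
    M * (simpleLoopResidue w α)ᵀ =
      ((α - conj α) / (star w ⬝ᵥ w)) • vecMulVec (M *ᵥ w) (star w) := by
  rw [simpleLoopResidue, transpose_smul, transpose_vecMulVec, Matrix.mul_smul, mul_vecMulVec]

variable [DecidableEq n]

/-- The loop `p_{α,L}` of the isotropic line `L` spanned by `w`, without its principal part at
`α`. -/
def simpleLoopRegularPart (w : n → ℂ) (α z : ℂ) : Matrix n n ℂ :=
  1 + (-((α - conj α) / (star w ⬝ᵥ w)) * (z - conj α)⁻¹) • vecMulVec w (star w)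

lemma simpleLoop_eq_add_residue (w : n → ℂ) {α z : ℂ} (hα : z ≠ α) (hα' : z ≠ conj α) :
    simpleLoop w α z = simpleLoopRegularPart w α z + (z - α)⁻¹ • simpleLoopResidue w α := by
  have hz : z - α ≠ 0 := sub_ne_zero.2 hα
  have hz' : z - conj α ≠ 0 := sub_ne_zero.2 hα'
  rw [simpleLoop, simpleElement, simpleLoopRegularPart, simpleLoopResidue, inv_div]
  match_scalars <;> field_simp <;> ring

lemma simpleLoopRegularPart_mulVec_self (hw : w ≠ 0) (hβ : β.im ≠ 0) :
    simpleLoopRegularPart w β β *ᵥ w = 0 := by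
  have hnorm : star w ⬝ᵥ w ≠ 0 := star_dotProduct_self_ne_zero hw
  have hβ' : β - conj β ≠ 0 := sub_ne_zero.2 (ne_conj_of_im_ne_zero hβ)
  rw [simpleLoopRegularPart, add_mulVec, one_mulVec, smul_mulVec, vecMulVec_mulVec,
    op_smul_eq_smul]
  match_scalars
  field_simp
  ring

lemma matrixRegularAt_simpleLoopRegularPart (w : n → ℂ) (hβ : β.im ≠ 0) :
    MatrixRegularAt ⊤ (simpleLoopRegularPart w β) β :=
  (MatrixRegularAt.const 1).add
    (.smul ((RegularAt.const _).mul (.inv_sub (ne_conj_of_im_ne_zero hβ))) (.const _))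

lemma mulVec_dotProduct_mulVec_eq_zero_of_expansion {h : ℂ → Matrix n n ℂ} {A B : Matrix n n ℂ}
    (horth : ∀ᶠ z in nhdsOpenDense β, (h z)ᵀ * h z = 1) (hexp : HasExpansionAt h β A B)
    (x : n → ℂ) : A *ᵥ x ⬝ᵥ B *ᵥ x = 0 := by
  have hdot := (hexp.mulVec x).bilin (dotProductBilin ℂ ℂ)
    (by simp only [dotProductBilin_apply_apply]; fun_prop) (hexp.mulVec x)
  have hconst := hdot.unique ((HasExpansionAt.const (x ⬝ᵥ x)).congr (horth.mono fun z hz =>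
    (forall_mulVec_dotProduct_mulVec_iff _).2 hz x x))
  have htwice := hconst.2
  simp only [dotProductBilin_apply_apply, dotProduct_comm (B *ᵥ x), ← two_mul] at htwice
  exact (mul_eq_zero.1 htwice).resolve_left two_ne_zero

theorem matrixRegularAt_dress {h : ℂ → Matrix n n ℂ} {V : Matrix n n ℂ} (hβ : β.im ≠ 0)
    (hreg : MatrixRegularAt (𝓝[≠] β) h β) (hV : Tendsto h (𝓝[≠] β) (𝓝 V))
    (horth : ∀ᶠ z in 𝓝[≠] β, (h z)ᵀ * h z = 1) (hk : IsNullVector k) :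
    MatrixRegularAt (𝓝[≠] β)
      (fun z => simpleLoop (V *ᵥ k) β z * h z * (simpleLoop k β z)ᵀ) β := by
  obtain ⟨A, B, R, hR, hR_cont, hexp⟩ := hreg.exists_expansion
  obtain rfl : A = V := by
    have hcont : ContinuousAt (fun z => A + (z - β) • B + (z - β) ^ 2 • R z) β := by fun_prop
    simpa using (tendsto_nhds_unique_of_eventuallyEq hV
      (hcont.tendsto.mono_left nhdsWithin_le_nhds) hexp).symm
  have hA : Aᵀ * A = 1 := transpose_mul_self_of_tendsto horth hV
  have hAk : IsNullVector (A *ᵥ k) := hk.mulVec hA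
  have hAB : A *ᵥ k ⬝ᵥ B *ᵥ k = 0 := mulVec_dotProduct_mulVec_eq_zero_of_expansion
    (nhdsOpenDense_le_nhdsNE β horth) ⟨R, hR_cont, nhdsOpenDense_le_nhdsNE β hexp⟩ k
  have hregular (w : n → ℂ) := matrixRegularAt_simpleLoopRegularPart w hβ
  have hlim (w : n → ℂ) : Tendsto (simpleLoopRegularPart w β) (𝓝[≠] β) _ :=
    (hregular w).continuousAt.tendsto.mono_left nhdsWithin_le_nhds
  have hdressed := MatrixRegularAt.add_inv_sub_smul_mul_mul le_rfl
    ((hregular (A *ᵥ k)).mono le_top) hreg ((hregular k).transpose.mono le_top) hR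
    (hlim (A *ᵥ k)) hV ((continuous_id.matrix_transpose.tendsto _).comp (hlim k)) hexp
    (C := simpleLoopResidue (A *ᵥ k) β) (D := (simpleLoopResidue k β)ᵀ) ?_ ?_ ?_ ?_
  · refine hdressed.congr ?_
    filter_upwards [eventually_notMem_nhdsNE (Set.toFinite {β, conj β}) β] with z hz
    rw [Set.mem_insert_iff, Set.mem_singleton_iff, not_or] at hz
    simp only [simpleLoop_eq_add_residue _ hz.1 hz.2, transpose_add, transpose_smul]
  · refine simpleLoopResidue_mul_eq_zero β ?_
    rw [← vecMul_vecMul, ← mulVec_transpose A, mulVec_mulVec, hA, one_mulVec, id, vecMul_transpose,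
      simpleLoopRegularPart_mulVec_self hk.ne_zero hβ]
  · rw [mul_transpose_simpleLoopResidue, ← mulVec_mulVec,
      simpleLoopRegularPart_mulVec_self hAk.ne_zero hβ, zero_vecMulVec, smul_zero]
  all_goals
    rw [Matrix.mul_assoc, mul_transpose_simpleLoopResidue]
    refine simpleLoopResidue_mul_eq_zero β ?_
    rw [vecMul_smul, vecMul_vecMulVec]
    simp only [hAk.dotProduct_self, hAB, zero_smul, smul_zero]

end Dressing

/-! ### The elements `q_{α,L,K}` -/

namespace IsOrthogonalLoop

variable {p : ℂ → Mat7} {P : Set ℂ} {β : ℂ} {k l : V7}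

lemma dress_line_eventuallyEq (hp : IsOrthogonalLoop p P) (hβ : β ∉ P) (hk : IsNullVector k) :
    dress β (line (p β *ᵥ k)) p =ᶠ[𝓝[≠] β]
      fun z => simpleLoop (p β *ᵥ k) β z * p z * (simpleLoop k β z)ᵀ := by
  have horth := hp.transpose_mul_self β hβ
  have hpk := hk.mulVec horth
  have hline : matSub (p β)⁻¹ (line (p β *ᵥ k)) = line k := by
    rw [matSub_line, mulVec_mulVec, inv_eq_left_inv horth, horth, one_mulVec]
  filter_upwards [(isOrthogonalLoop_simpleLoop hk β).eventually_transpose_mul_self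
    (Set.toFinite _) β] with z hz
  rw [dress, hline, pLine_line hpk.ne_zero hpk.dotProduct_self,
    pLine_line hk.ne_zero hk.dotProduct_self]
  exact congrArg _ (inv_eq_left_inv hz)

lemma matrixRegularAt_dress_line (hp : IsOrthogonalLoop p P) (hP : P.Finite) (hβ : β ∉ P)
    (hβ' : β.im ≠ 0) (hk : IsNullVector k) :
    MatrixRegularAt (𝓝[≠] β)
      (fun z => simpleLoop (p β *ᵥ k) β z * p z * (simpleLoop k β z)ᵀ) β :=
  matrixRegularAt_dress hβ' ((hp.regular β hβ).mono le_top) (hp.tendsto_nhdsNE hβ)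
    (hp.eventually_transpose_mul_self hP β) hk

lemma tendsto_dressAt_line (hp : IsOrthogonalLoop p P) (hP : P.Finite) (hβ : β ∉ P)
    (hβ' : β.im ≠ 0) (hk : IsNullVector k) :
    Tendsto (fun z => simpleLoop (p β *ᵥ k) β z * p z * (simpleLoop k β z)ᵀ) (𝓝[≠] β)
      (𝓝 (dressAt β (line (p β *ᵥ k)) p)) := by
  obtain ⟨V, hV⟩ :=
    (hp.matrixRegularAt_dress_line hP hβ hβ' hk).exists_tendsto nhdsWithin_le_nhds
  have hlim : dressAt β (line (p β *ᵥ k)) p = V :=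
    (hV.congr' (hp.dress_line_eventuallyEq hβ hk).symm).limUnder_eq
  rwa [hlim]

lemma eventually_dress_transpose_mul_self (hp : IsOrthogonalLoop p P) (hP : P.Finite)
    (hβ : β ∉ P) (hk : IsNullVector k) :
    ∀ᶠ z in 𝓝[≠] β, (simpleLoop (p β *ᵥ k) β z * p z * (simpleLoop k β z)ᵀ)ᵀ *
      (simpleLoop (p β *ᵥ k) β z * p z * (simpleLoop k β z)ᵀ) = 1 :=
  IsOrthogonalLoop.eventually_transpose_mul_self
    (((isOrthogonalLoop_simpleLoop (hk.mulVec (hp.transpose_mul_self β hβ)) β).mul hp).mul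
      (isOrthogonalLoop_simpleLoop hk β).transpose)
    (((Set.toFinite _).union hP).union (Set.toFinite _)) β

lemma dressAt_line_transpose_mul_self (hp : IsOrthogonalLoop p P) (hP : P.Finite) (hβ : β ∉ P)
    (hβ' : β.im ≠ 0) (hk : IsNullVector k) :
    (dressAt β (line (p β *ᵥ k)) p)ᵀ * dressAt β (line (p β *ᵥ k)) p = 1 :=
  transpose_mul_self_of_tendsto (hp.eventually_dress_transpose_mul_self hP hβ hk)
    (hp.tendsto_dressAt_line hP hβ hβ' hk)

lemma matrixRegularAt_dress_line_line (hp : IsOrthogonalLoop p P) (hP : P.Finite) (hβ : β ∉ P)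
    (hβ' : β.im ≠ 0) (hl : IsNullVector l) (hk : IsNullVector k) :
    MatrixRegularAt (𝓝[≠] β)
      (fun z => simplePairLoop (dressAt β (line (p β *ᵥ k)) p *ᵥ l) (p β *ᵥ k) β z * p z *
        (simplePairLoop l k β z)ᵀ) β := by
  refine (matrixRegularAt_dress hβ' (hp.matrixRegularAt_dress_line hP hβ hβ' hk)
    (hp.tendsto_dressAt_line hP hβ hβ' hk) (hp.eventually_dress_transpose_mul_self hP hβ hk)
    hl).congr (.of_forall fun z => ?_)
  simp only [simplePairLoop, transpose_mul, Matrix.mul_assoc]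

end IsOrthogonalLoop

lemma neg_notMem_pair_conj {α : ℂ} (hre : α.re ≠ 0) (him : α.im ≠ 0) :
    -α ∉ ({α, conj α} : Set ℂ) := by
  rintro (h | h)
  · exact him (self_eq_neg.1 (congrArg Complex.im h).symm)
  · exact hre (self_eq_neg.1 (congrArg Complex.re h).symm)

section QPair

variable {l k : V7} {α : ℂ}

lemma exists_qPair_line_eq (hl : IsNullVector l) (hk : IsNullVector k) (hre : α.re ≠ 0)
    (him : α.im ≠ 0) :
    ∃ v w, IsNullVector v ∧ IsNullVector w ∧ qPair α (line l) (line k) =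
        (fun z => simplePairLoop v w (-α) z * simplePairLoop l k α z) ∧
      MatrixRegularAt (nhdsOpenDense (-α)) (fun z => simplePairLoop v w (-α) z *
        simplePairLoop l k α z * (simplePairLoop (sMat *ᵥ l) (sMat *ᵥ k) (-α) z)ᵀ) (-α) := by
  have hp := isOrthogonalLoop_simplePairLoop hl hk α
  have hα := neg_notMem_pair_conj hre him
  have him' : (-α).im ≠ 0 := neg_ne_zero.2 him
  have hsl := hl.mulVec isG2_sMat.transpose_mul
  have hsk := hk.mulVec isG2_sMat.transpose_mul
  have hw := hsk.mulVec (hp.transpose_mul_self _ hα)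
  have hv := hsl.mulVec (hp.dressAt_line_transpose_mul_self (Set.toFinite _) hα him' hsk)
  refine ⟨_, _, hv, hw, funext fun z => ?_,
    (hp.matrixRegularAt_dress_line_line (Set.toFinite _) hα him' hsl hsk).mono
      (nhdsOpenDense_le_nhdsNE _)⟩
  rw [qPair, sLPrime, sKPrime, pPair_line hl hk, matSub_line, matSub_line, matSub_line,
    matSub_line, pPair_line hv hw]

lemma eventually_isG2_of_matrixRegularAt_mul {F h : ℂ → Mat7} {β : ℂ} (hβ : β.im ≠ 0)
    (hF : IsOrthogonalLoop F {β, conj β}) (hh : ∀ᶠ z in nhdsOpenDense β, IsG2 (h z))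
    (hpole : PoleLE h β 1) (hreg : MatrixRegularAt (nhdsOpenDense β) (fun z => F z * h z) β) :
    ∀ᶠ z in openDense, IsG2 (F z) := by
  obtain ⟨G, hG, hG_isG2, hG_reg⟩ : ∃ G, IsOrthogonalLoop G {β, conj β} ∧
      (∀ᶠ z in openDense, IsG2 (G z)) ∧
      MatrixRegularAt (nhdsOpenDense β) (fun z => G z * h z) β := by
    by_cases h_reg : PoleLE h β 0
    · exact ⟨fun _ => 1, .one, .of_forall fun _ => .one, by simpa using PoleLE.zero_iff.1 h_reg⟩
    · obtain ⟨L, K, hLK, hlower, -⟩ := exists_pair_lowering hβ hh hpole h_reg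
      obtain ⟨l, k, c, hlk, rfl, rfl⟩ := exists_frame_of_isPair hLK
      rw [pPair_line hlk.isNullVector_fst (hlk.isNullVector_add_smul_star c)] at hlower
      exact ⟨_, hlk.isOrthogonalLoop_simplePairLoop c β, hlk.eventually_isG2_simplePairLoop c β,
        PoleLE.zero_iff.1 hlower⟩
  have hquot : MatrixRegularAt (nhdsOpenDense β) (fun z => F z * (G z)ᵀ) β := by
    refine (hreg.mul hG_reg.transpose).congr (hh.mono fun z hz => ?_)
    rw [transpose_mul, Matrix.mul_assoc, ← Matrix.mul_assoc (h z), hz.mul_transpose,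
      Matrix.one_mul]
  have hFG : F =ᶠ[openDense] G := by
    refine hF.eventually_eq_of_mul_transpose hG (Set.toFinite _) ?_
    rintro b (rfl | rfl)
    · exact hquot
    · exact ((hF.mul hG.transpose).regular_conj hquot)
  filter_upwards [hFG, hG_isG2] with z hz hz_isG2
  rwa [hz]

lemma twist_eventuallyEq_of_matrixRegularAt {F : ℂ → Mat7}
    (hF : IsOrthogonalLoop F {α, conj α, -α, -conj α})
    (hreg : MatrixRegularAt (nhdsOpenDense (-α)) (fun z => F z * (twist F z)ᵀ) (-α)) :
    twist F =ᶠ[openDense] F := by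
  have htwist : IsOrthogonalLoop (twist F) {α, conj α, -α, -conj α} := by
    refine hF.twist.mono fun z hz => ?_
    simp only [Set.mem_ofPred_eq, Set.mem_insert_iff, Set.mem_singleton_iff, neg_inj,
      neg_eq_iff_eq_neg (a := z)] at hz ⊢
    tauto
  have hquot := hF.mul htwist.transpose
  have hquot_twist : (fun z => F z * (twist F z)ᵀ) =
      fun z => (twist (fun z => F z * (twist F z)ᵀ) z)ᵀ := by
    funext z
    simp only [twist, transpose_mul, transpose_sMat, transpose_transpose, Matrix.mul_assoc,
      neg_neg]
    rw [← Matrix.mul_assoc sMat sMat, sMat_mul_self, Matrix.one_mul]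
  have hreg_neg : MatrixRegularAt (nhdsOpenDense α) (fun z => F z * (twist F z)ᵀ) α := by
    have h := (hreg.twist (tendsto_neg_nhdsOpenDense (-α))).transpose
    rwa [neg_neg, ← hquot_twist] at h
  refine (hF.eventually_eq_of_mul_transpose htwist (Set.toFinite _) ?_).symm
  rintro b (rfl | rfl | rfl | rfl)
  · exact hreg_neg
  · exact hquot.regular_conj hreg_neg
  · exact hreg
  · simpa only [map_neg] using hquot.regular_conj hreg

lemma isOrthogonalLoop_simplePairLoop_neg_mul {v w : V7} (hv : IsNullVector v)
    (hw : IsNullVector w) (hl : IsNullVector l) (hk : IsNullVector k) (α : ℂ) :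
    IsOrthogonalLoop (fun z => simplePairLoop v w (-α) z * simplePairLoop l k α z)
      {α, conj α, -α, -conj α} := by
  refine ((isOrthogonalLoop_simplePairLoop hv hw (-α)).mul
    (isOrthogonalLoop_simplePairLoop hl hk α)).mono fun z hz => ?_
  rw [map_neg] at hz
  simp only [Set.mem_union, Set.mem_insert_iff, Set.mem_singleton_iff] at hz ⊢
  tauto

lemma twist_qPair_line_eventuallyEq (hl : IsNullVector l) (hk : IsNullVector k) (hre : α.re ≠ 0)
    (him : α.im ≠ 0) :
    twist (qPair α (line l) (line k)) =ᶠ[openDense] qPair α (line l) (line k) := by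
  obtain ⟨v, w, hv, hw, hq, hreg⟩ := exists_qPair_line_eq hl hk hre him
  have hP := isOrthogonalLoop_simplePairLoop hv hw (-α)
  have htwist : MatrixRegularAt (nhdsOpenDense (-α)) (twist (simplePairLoop v w (-α))) (-α) := by
    refine (hP.twist.regular _ fun h => ?_).mono le_top
    rw [Set.mem_ofPred_eq, ← neg_neg (-α)] at h
    refine neg_notMem_pair_conj (α := -α) (neg_ne_zero.2 hre) (neg_ne_zero.2 him) ?_
    simpa only [neg_neg] using h
  rw [hq]
  refine twist_eventuallyEq_of_matrixRegularAt
    (isOrthogonalLoop_simplePairLoop_neg_mul hv hw hl hk α)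
    ((hreg.mul htwist.transpose).congr (.of_forall fun z => ?_))
  rw [twist_mul, twist_simplePairLoop l k, transpose_mul]
  simp only [Matrix.mul_assoc]

end QPair

namespace IsCoassociativeFrame

variable {l k : V7} {α : ℂ}

lemma mulVec_sMat (h : IsCoassociativeFrame l k) :
    IsCoassociativeFrame (sMat *ᵥ l) (sMat *ᵥ k) :=
  h.mulVec isG2_sMat star_sMat_mulVec

lemma eventually_isG2_qPair_line (h : IsCoassociativeFrame l k) (c : ℂ) (hre : α.re ≠ 0)
    (him : α.im ≠ 0) :
    ∀ᶠ z in openDense, IsG2 (qPair α (line l) (line (k + c • star l)) z) := by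
  obtain ⟨v, w, hv, hw, hq, hreg⟩ := exists_qPair_line_eq h.isNullVector_fst
    (h.isNullVector_add_smul_star c) hre him
  have him' : (-α).im ≠ 0 := neg_ne_zero.2 him
  have hsMat : sMat *ᵥ (k + c • star l) = sMat *ᵥ k + c • star (sMat *ᵥ l) := by
    rw [mulVec_add, mulVec_smul, star_sMat_mulVec]
  rw [hsMat] at hreg
  have hp_isG2 := h.eventually_isG2_simplePairLoop c α
  have hs_isG2 := h.mulVec_sMat.eventually_isG2_simplePairLoop c (-α)
  have hP_isG2 := eventually_isG2_of_matrixRegularAt_mul him'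
    (G2Loop.isOrthogonalLoop_simplePairLoop hv hw (-α))
    (((hp_isG2.and hs_isG2).filter_mono (nhdsOpenDense_le_openDense _)).mono
      fun z hz => hz.1.mul hz.2.transpose)
    ((h.mulVec_sMat.poleLE_simplePairLoop c him').transpose.mul_left
      (((h.isOrthogonalLoop_simplePairLoop c α).regular _
        (neg_notMem_pair_conj hre him)).mono le_top))
    (hreg.congr (.of_forall fun z => (Matrix.mul_assoc _ _ _).symm))
  filter_upwards [hP_isG2, hp_isG2] with z hP hp
  rw [hq]
  exact hP.mul hp

end IsCoassociativeFrame

lemma twist_simpleLoop_of_re_eq_zero {w : V7} (hw : w ≠ 0)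
    (h : matSub sMat (line w) = conjSub (line w)) {β : ℂ} (hβ : β.re = 0) :
    twist (simpleLoop w β) = simpleLoop w β := by
  rw [matSub_line, conjSub_line] at h
  have hsw : sMat *ᵥ w ≠ 0 := fun h0 => hw (by rw [← sMat_mulVec_sMat_mulVec w, h0, mulVec_zero])
  obtain ⟨a, ha, hwa⟩ := exists_smul_of_line_eq hsw h
  have hconj : conj β = -β := Complex.ext (by simp [hβ]) (by simp)
  funext z
  rw [twist_simpleLoop, hwa, simpleLoop, simpleLoop, simpleElement_smul ha, simpleElement_star,
    inv_div, map_neg, hconj, neg_neg]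

/-! ### Membership in the loop group -/

/-- All entries of `F` are meromorphic at `b`. -/
def MatrixMeromorphicAt {m n : Type*} (F : ℂ → Matrix m n ℂ) (b : ℂ) : Prop :=
  ∀ i j, MeromorphicAt (fun z => F z i j) b

lemma MatrixMeromorphicAt.mul {m n p : Type*} [Fintype n] {F : ℂ → Matrix m n ℂ}
    {G : ℂ → Matrix n p ℂ} {b : ℂ} (hF : MatrixMeromorphicAt F b) (hG : MatrixMeromorphicAt G b) :
    MatrixMeromorphicAt (fun z => F z * G z) b := fun i j => by
  simp only [mul_apply]
  exact MeromorphicAt.fun_sum fun k _ => (hF i k).mul (hG k j)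

section SimpleLoopMeromorphic

variable {n : Type*} [Fintype n] [DecidableEq n]

lemma matrixMeromorphicAt_simpleLoop (w : n → ℂ) (α b : ℂ) :
    MatrixMeromorphicAt (simpleLoop w α) b := fun i j => by
  simp only [simpleLoop, simpleElement, Matrix.add_apply, Matrix.smul_apply, smul_eq_mul]
  fun_prop

lemma matrixMeromorphicAt_simplePairLoop (v w : n → ℂ) (α b : ℂ) :
    MatrixMeromorphicAt (simplePairLoop v w α) b :=
  (matrixMeromorphicAt_simpleLoop v α b).mul (matrixMeromorphicAt_simpleLoop w α b)

lemma regularAt_inv_sub_div_inv_sub (a a' : ℂ) :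
    RegularAt (𝓝[≠] 0) (fun z : ℂ => (z⁻¹ - a) / (z⁻¹ - a')) 0 := by
  refine ⟨fun z => (1 - a * z) / (1 - a' * z),
    AnalyticAt.div (by fun_prop) (by fun_prop) (by simp), ?_⟩
  filter_upwards [self_mem_nhdsWithin] with z (hz : z ≠ 0)
  rw [← mul_div_mul_left _ _ hz, mul_sub, mul_sub, mul_inv_cancel₀ hz, mul_comm z, mul_comm z]

lemma matrixRegularAt_simpleLoop_inv (w : n → ℂ) (α : ℂ) :
    MatrixRegularAt (𝓝[≠] 0) (fun z => simpleLoop w α z⁻¹) 0 := by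
  refine .simpleElement (regularAt_inv_sub_div_inv_sub _ _) ?_ w
  simpa only [inv_div] using regularAt_inv_sub_div_inv_sub α (conj α)

lemma matrixRegularAt_simplePairLoop_inv (v w : n → ℂ) (α : ℂ) :
    MatrixRegularAt (𝓝[≠] 0) (fun z => simplePairLoop v w α z⁻¹) 0 :=
  (matrixRegularAt_simpleLoop_inv v α).mul (matrixRegularAt_simpleLoop_inv w α)

end SimpleLoopMeromorphic

open Classical in
/-- A complex orthogonal matrix as an element of the general linear group. All other matrices are
sent to `1`. -/
def toGL {n : Type*} [Fintype n] [DecidableEq n] (A : Matrix n n ℂ) : GL n ℂ :=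
  if h : Aᵀ * A = 1 then ⟨A, Aᵀ, mul_eq_one_comm.1 h, h⟩ else 1

lemma val_toGL {n : Type*} [Fintype n] [DecidableEq n] {A : Matrix n n ℂ} (h : Aᵀ * A = 1) :
    (toGL A).val = A := by
  rw [toGL, dif_pos h]

lemma val_tau (A : GL (Fin 7) ℂ) : (tau A).val = A.val.map star := rfl

lemma val_sigma (A : GL (Fin 7) ℂ) : (sigma A).val = sMat * A.val * sMat := rfl

lemma represents_coe {F : ℂ → Mat7} {f : ℂ → GL (Fin 7) ℂ} :
    Represents F (f : Loop) ↔ ∀ᶠ z in openDense, (f z).val = F z := Germ.coe_eq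

lemma tendsto_inv_nhdsNE_cocompact : Tendsto (fun w : ℂ => w⁻¹) (𝓝[≠] 0) (cocompact ℂ) :=
  tendsto_inv₀_nhdsNE_zero.mono_right Metric.cobounded_eq_cocompact.le

lemma tendsto_inv_cocompact : Tendsto (fun z : ℂ => z⁻¹) (cocompact ℂ) (𝓝 0) :=
  tendsto_inv₀_cobounded.mono_left Metric.cobounded_eq_cocompact.ge

lemma atInfty_of_ne_zero (f : ℂ → GL (Fin 7) ℂ) {w : ℂ} (hw : w ≠ 0) : atInfty f w = f w⁻¹ :=
  Function.update_of_ne hw _ _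

lemma atInfty_zero (f : ℂ → GL (Fin 7) ℂ) : atInfty f 0 = 1 := Function.update_self _ _ _

lemma isNegative_of_matrixRegularAt {f : ℂ → GL (Fin 7) ℂ}
    (hf : MatrixRegularAt (𝓝[≠] 0) (fun w => (f w⁻¹).val) 0)
    (hlim : Tendsto (fun z => (f z).val) (cocompact ℂ) (𝓝 1)) : IsNegative f := by
  intro i j
  obtain ⟨u, hu, hfu⟩ := hf i j
  have hlim_ij : Tendsto (fun w => (f w⁻¹).val i j) (𝓝[≠] 0) (𝓝 ((1 : Mat7) i j)) :=
    ((continuous_id.matrix_elem i j).tendsto (1 : Mat7)).comp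
      (hlim.comp tendsto_inv_nhdsNE_cocompact)
  have hu_zero : u 0 = (atInfty f 0).val i j := by
    rw [atInfty_zero]
    exact tendsto_nhds_unique_of_eventuallyEq
      (hu.continuousAt.tendsto.mono_left nhdsWithin_le_nhds) hlim_ij hfu.symm
  refine hu.congr ?_
  filter_upwards [eventually_nhdsWithin_iff.1 hfu] with w hw
  by_cases h0 : w = 0
  · rw [h0, hu_zero]
  · rw [atInfty_of_ne_zero f h0, hw h0]

lemma isHolomorphicLoop_of_matrixRegularAt {f : ℂ → GL (Fin 7) ℂ} {P : Set ℂ} (hP : P.Finite)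
    (hf : ∀ b ∉ P, MatrixRegularAt (𝓝 b) (fun z => (f z).val) b)
    (hG2 : ∀ᶠ z in openDense, f z ∈ G2) : IsHolomorphicLoop f := by
  obtain ⟨U, hU, hUo, hUd⟩ : {z | f z ∈ G2} ∩ Pᶜ ∈ openDense :=
    inter_mem hG2 (compl_mem_openDense_of_finite hP)
  refine ⟨U, hUo, hUd, fun z hz => (hU hz).1, fun i j z hz => ?_⟩
  obtain ⟨u, hu, hfu⟩ := hf z (hU hz).2 i j
  exact (hu.differentiableAt.congr_of_eventuallyEq hfu).differentiableWithinAt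

lemma IsOrthogonalLoop.exists_represents {F : ℂ → Mat7} {P : Set ℂ} (hF : IsOrthogonalLoop F P)
    (hP : P.Finite) (hF_mero : ∀ b, MatrixMeromorphicAt F b)
    (hF_infty : MatrixRegularAt (𝓝[≠] 0) (fun w => F w⁻¹) 0)
    (hF_isG2 : ∀ᶠ z in openDense, IsG2 (F z)) (hF_twist : G2Loop.twist F =ᶠ[openDense] F) :
    ∃ γ ∈ twistedLoopGroup, Represents F γ := by
  let f : ℂ → GL (Fin 7) ℂ := fun z => toGL (F z)
  have hval : ∀ z ∉ P, (f z).val = F z := fun z hz => val_toGL (hF.transpose_mul_self z hz)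
  have hval_openDense : ∀ᶠ z in openDense, (f z).val = F z :=
    mem_of_superset (compl_mem_openDense_of_finite hP) hval
  have hval_cocompact : ∀ᶠ z in cocompact ℂ, (f z).val = F z :=
    mem_of_superset hP.isCompact.compl_mem_cocompact hval
  have hf_mero (b : ℂ) : MatrixMeromorphicAt (fun z => (f z).val) b := fun i j =>
    (hF_mero b i j).congr ((eventually_notMem_nhdsNE hP b).mono fun z hz => by
      simp only [hval z hz])
  have hf_negative : IsNegative f := isNegative_of_matrixRegularAt
    (hF_infty.congr (tendsto_inv_nhdsNE_cocompact.eventually hval_cocompact))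
    (hF.tendsto_cocompact.congr' (hval_cocompact.mono fun z hz => hz.symm))
  have hf_infty : ∀ i j, MeromorphicAt (fun w => (f w⁻¹).val i j) 0 := fun i j =>
    (hf_negative i j).meromorphicAt.congr (by
      filter_upwards [self_mem_nhdsWithin] with w hw
      rw [atInfty_of_ne_zero f hw])
  have hf_holo : IsHolomorphicLoop f := isHolomorphicLoop_of_matrixRegularAt hP
    (fun b hb => ((hF.regular b hb).mono le_top).congr
      (mem_of_superset (hP.isClosed.isOpen_compl.mem_nhds hb) hval))
    (by
      filter_upwards [hF_isG2, hval_openDense] with z hz hz_val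
      rwa [mem_G2_iff, hz_val])
  have hf_real : IsReal f := by
    filter_upwards [hval_openDense, tendsto_conj_openDense.eventually hval_openDense]
      with z hz hz_conj
    exact Units.ext (by rw [val_tau, hz_conj, hz, hF.real])
  have hf_twisted : IsTwisted f := by
    filter_upwards [hval_openDense, tendsto_neg_openDense.eventually hval_openDense, hF_twist]
      with z hz hz_neg hz_twist
    exact Units.ext (by rw [val_sigma, hz_neg, hz, ← hz_twist, G2Loop.twist])
  exact ⟨f, ⟨f, rfl, hf_holo, ⟨hf_mero, hf_infty⟩, hf_real, hf_twisted, hf_negative⟩,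
    represents_coe.2 hval_openDense⟩

lemma exists_represents_of_mem_pFamily {F : ℂ → Mat7} (h : F ∈ pFamily) :
    ∃ γ ∈ twistedLoopGroup, Represents F γ := by
  obtain ⟨β, M, N, hβ, -, hMN, hM, hN, rfl⟩ := h
  obtain ⟨l, k, c, hlk, rfl, rfl⟩ := exists_frame_of_isPair hMN
  have hl := hlk.isNullVector_fst
  have hk := hlk.isNullVector_add_smul_star c
  rw [pPair_line hl hk]
  refine (hlk.isOrthogonalLoop_simplePairLoop c β).exists_represents (Set.toFinite _)
    (matrixMeromorphicAt_simplePairLoop _ _ _) (matrixRegularAt_simplePairLoop_inv _ _ _)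
    (hlk.eventually_isG2_simplePairLoop c β) (EventuallyEq.of_eq ?_)
  unfold simplePairLoop
  rw [twist_mul, twist_simpleLoop_of_re_eq_zero hl.ne_zero hM hβ,
    twist_simpleLoop_of_re_eq_zero hk.ne_zero hN hβ]

lemma exists_represents_of_mem_qFamily {F : ℂ → Mat7} (h : F ∈ qFamily) :
    ∃ γ ∈ twistedLoopGroup, Represents F γ := by
  obtain ⟨α, L, K, hre, him, hLK, rfl⟩ := h
  obtain ⟨l, k, c, hlk, rfl, rfl⟩ := exists_frame_of_isPair hLK
  have hl := hlk.isNullVector_fst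
  have hk := hlk.isNullVector_add_smul_star c
  have hisG2 := hlk.eventually_isG2_qPair_line c hre him
  have htwist := twist_qPair_line_eventuallyEq hl hk hre him
  obtain ⟨v, w, hv, hw, hq, -⟩ := exists_qPair_line_eq hl hk hre him
  rw [hq] at hisG2 htwist ⊢
  exact (isOrthogonalLoop_simplePairLoop_neg_mul hv hw hl hk α).exists_represents (Set.toFinite _)
    (fun b => (matrixMeromorphicAt_simplePairLoop _ _ _ b).mul
      (matrixMeromorphicAt_simplePairLoop _ _ _ b))
    ((matrixRegularAt_simplePairLoop_inv _ _ _).mul (matrixRegularAt_simplePairLoop_inv _ _ _))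
    hisG2 htwist

lemma exists_represents_of_mem_families {F : ℂ → Mat7} (hF : F ∈ pFamily ∪ qFamily) :
    ∃ γ ∈ twistedLoopGroup, Represents F γ :=
  hF.elim exists_represents_of_mem_pFamily exists_represents_of_mem_qFamily

/-! ### Poles of loops -/

lemma eq_zero_of_map_star_eq_of_dotProduct_eq_zero {m n : Type*} [Fintype m] [Fintype n]
    {A : Matrix m n ℂ} (hreal : A.map star = A) (hdot : ∀ x y, A *ᵥ x ⬝ᵥ A *ᵥ y = 0) : A = 0 := by
  classical
  have hcol (j : n) : A *ᵥ Pi.single j 1 = 0 := by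
    by_contra h
    refine star_dotProduct_self_ne_zero h ?_
    have hstar : star (A *ᵥ Pi.single j 1) = A *ᵥ Pi.single j 1 := by
      ext i
      simpa using congrFun (congrFun hreal i) j
    rw [hstar, hdot]
  ext i j
  simpa using congrFun (hcol j) i

lemma PoleLE.of_real_of_im_eq_zero {n : Type*} [Fintype n] [DecidableEq n] {g : ℂ → Matrix n n ℂ}
    {a : ℂ} {k : ℕ} (ha : a.im = 0) (horth : ∀ᶠ z in openDense, (g z)ᵀ * g z = 1)
    (hreal : ∀ᶠ z in openDense, (g (conj z)).map star = g z) (hpole : PoleLE g a (k + 1)) :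
    PoleLE g a k := by
  obtain ⟨A, B, R, -, hR_cont, hexp⟩ := MatrixRegularAt.exists_expansion hpole
  have hexpansion : HasExpansionAt (fun z => (z - a) ^ (k + 1) • g z) a A B := ⟨R, hR_cont, hexp⟩
  have hconj : conj a = a := Complex.conj_eq_iff_im.2 ha
  have hdot := dotProduct_eq_zero_of_hasExpansionAt
    (((horth.filter_mono (nhdsOpenDense_le_openDense a))).mono fun z hz =>
      (forall_mulVec_dotProduct_mulVec_iff (g z)).2 hz) hexpansion
  have hA_real : A.map star = A := by
    have hstar := hexpansion.transpose.star
    rw [hconj] at hstar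
    refine (hstar.unique (hexpansion.congr ?_)).1
    filter_upwards [nhdsOpenDense_le_openDense a hreal] with z hz
    rw [← hz]
    ext i j
    simp [hconj]
  obtain rfl := eq_zero_of_map_star_eq_of_dotProduct_eq_zero hA_real fun x y => (hdot x y).1
  exact hpole.of_tendsto_zero hexpansion.tendsto

lemma exists_poleLE {m n : Type*} [Finite m] [Finite n] {g : ℂ → Matrix m n ℂ} {b : ℂ}
    (h : MatrixMeromorphicAt g b) : ∃ k, PoleLE g b k := by
  cases nonempty_fintype m
  cases nonempty_fintype n
  choose k hk using h
  refine ⟨∑ i, ∑ j, k i j, fun i j => ?_⟩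
  have hle : k i j ≤ ∑ i, ∑ j, k i j :=
    (Finset.single_le_sum_of_canonicallyOrdered (f := k i) (Finset.mem_univ j)).trans
      (Finset.single_le_sum_of_canonicallyOrdered (f := fun i => ∑ j, k i j) (Finset.mem_univ i))
  refine ((RegularAt.sub_pow b (∑ i, ∑ j, k i j - k i j)).mul (.of_analyticAt (hk i j))).congr
    (.of_forall fun z => ?_)
  simp only [Matrix.smul_apply, smul_eq_mul]
  rw [← mul_assoc, ← pow_add, Nat.sub_add_cancel hle]

lemma eventually_analyticAt_cocompact {f u : ℂ → ℂ} (hu : AnalyticAt ℂ u 0)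
    (hfu : ∀ w ≠ 0, u w = f w⁻¹) : ∀ᶠ z in cocompact ℂ, AnalyticAt ℂ f z := by
  filter_upwards [tendsto_inv_cocompact.eventually hu.eventually_analyticAt,
    isCompact_singleton.compl_mem_cocompact] with z hz (hz0 : z ≠ 0)
  refine (AnalyticAt.comp (g := u) hz (analyticAt_id.inv hz0)).congr ?_
  filter_upwards [isOpen_compl_singleton.mem_nhds hz0] with w hw
  exact (hfu w⁻¹ (inv_ne_zero hw)).trans (by rw [inv_inv])

lemma finite_not_analyticAt {f : ℂ → ℂ} (hf : ∀ b, MeromorphicAt f b)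
    (hf_infty : ∀ᶠ z in cocompact ℂ, AnalyticAt ℂ f z) : {b | ¬AnalyticAt ℂ f b}.Finite := by
  obtain ⟨K, hK, hKf⟩ := mem_cocompact.1 hf_infty
  have hf_K : MeromorphicOn f K := fun b _ => hf b
  refine (hK.finite_sdiff_of_mem_codiscreteWithin hf_K.analyticAt_mem_codiscreteWithin).subset
    fun b hb => ⟨?_, hb⟩
  by_contra hbK
  exact hb (hKf hbK)

lemma exists_multiset_poleLE {f : ℂ → GL (Fin 7) ℂ} (hf : IsRational f) (hf' : IsNegative f) :
    ∃ S : Multiset ℂ, ∀ b, PoleLE (fun z => (f z).val) b (S.count b) := by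
  classical
  have hfinite : {b | ¬PoleLE (fun z => (f z).val) b 0}.Finite := by
    refine (Set.finite_iUnion fun i => Set.finite_iUnion fun j =>
      finite_not_analyticAt (fun b => hf.1 b i j)
        (eventually_analyticAt_cocompact (hf' i j) fun w hw => by
          rw [atInfty_of_ne_zero f hw])).subset fun b hb => ?_
    simp only [Set.mem_iUnion]
    by_contra! hana
    exact hb (PoleLE.zero_iff.2 fun i j => .of_analyticAt (not_not.1 (hana i j)))
  choose N hN using fun b => exists_poleLE (g := fun z => (f z).val) (b := b) (hf.1 b)
  refine ⟨∑ b ∈ hfinite.toFinset, Multiset.replicate (N b) b, fun b => ?_⟩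
  rw [Multiset.count_sum']
  simp only [Multiset.count_replicate, Finset.sum_ite_eq', Set.Finite.mem_toFinset]
  split_ifs with h
  · exact hN b
  · exact not_not.1 h

/-! ### Generation -/

/-- The properties, invariant under changes outside of an open and dense set, of the matrix valued
functions that represent elements of the loop group, except for the finiteness of their poles. -/
structure IsLoop (g : ℂ → Mat7) : Prop where
  isG2 : ∀ᶠ z in openDense, IsG2 (g z)
  real : ∀ᶠ z in openDense, (g (conj z)).map star = g z
  twisted : twist g =ᶠ[openDense] g
  tendsto : Tendsto g (cocompact ℂ ⊓ openDense) (𝓝 1)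

lemma IsNegative.tendsto_cocompact {f : ℂ → GL (Fin 7) ℂ} (hf : IsNegative f) :
    Tendsto (fun z => (f z).val) (cocompact ℂ) (𝓝 1) := by
  refine tendsto_pi_nhds.2 fun i => tendsto_pi_nhds.2 fun j => ?_
  have hlim := (hf i j).continuousAt.tendsto.comp tendsto_inv_cocompact
  rw [atInfty_zero] at hlim
  refine hlim.congr' ?_
  filter_upwards [(isCompact_singleton (x := (0 : ℂ))).compl_mem_cocompact] with z (hz : z ≠ 0)
  simp only [Function.comp, atInfty_of_ne_zero f (inv_ne_zero hz), inv_inv]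

lemma exists_isLoop {γ : Loop} (hγ : γ ∈ twistedLoopGroup) : ∃ g, Represents g γ ∧ IsLoop g ∧
    ∃ S : Multiset ℂ, ∀ b, PoleLE g b (S.count b) := by
  obtain ⟨f, rfl, ⟨U, hUo, hUd, hU, -⟩, hrational, hreal, htwisted, hnegative⟩ := hγ
  refine ⟨fun z => (f z).val, represents_coe.2 (.of_forall fun _ => rfl), ⟨?_, ?_, ?_, ?_⟩,
    exists_multiset_poleLE hrational hnegative⟩
  · exact ⟨U, fun z hz => (mem_G2_iff _).1 (hU z hz), hUo, hUd⟩
  · filter_upwards [hreal] with z hz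
    rw [← hz, val_tau]
  · filter_upwards [htwisted] with z hz
    rw [← hz, val_sigma, twist]
  · exact hnegative.tendsto_cocompact.mono_left inf_le_left

namespace Represents

variable {F G : ℂ → Mat7} {γ δ : Loop}

lemma one : Represents (fun _ => 1) 1 := represents_coe.2 (.of_forall fun _ => rfl)

lemma mul (hF : Represents F γ) (hG : Represents G δ) :
    Represents (fun z => F z * G z) (γ * δ) := by
  induction γ using Germ.inductionOn with | _ f
  induction δ using Germ.inductionOn with | _ g
  rw [represents_coe] at hF hG
  refine represents_coe.2 ?_
  filter_upwards [hF, hG] with z hFz hGz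
  rw [Units.val_mul, hFz, hGz]

lemma eventuallyEq (hF : Represents F γ) (hG : Represents G γ) : F =ᶠ[openDense] G :=
  Germ.coe_eq.1 (hF.symm.trans hG)

lemma eq_of_eventuallyEq (hF : Represents F γ) (hG : Represents G δ) (h : F =ᶠ[openDense] G) :
    γ = δ := by
  induction γ using Germ.inductionOn with | _ f
  induction δ using Germ.inductionOn with | _ g
  rw [represents_coe] at hF hG
  refine Germ.coe_eq.2 ?_
  filter_upwards [hF, hG, h] with z hFz hGz hz
  exact Units.ext (hFz.trans (hz.trans hGz.symm))

end Represents

lemma IsLoop.congr {g g' : ℂ → Mat7} (h : IsLoop g) (hgg' : g =ᶠ[openDense] g') : IsLoop g' where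
  isG2 := by
    filter_upwards [h.isG2, hgg'] with z hz hgz
    rwa [← hgz]
  real := by
    filter_upwards [h.real, hgg', tendsto_conj_openDense.eventually hgg'] with z hz hgz hgz'
    rw [← hgz, ← hgz', hz]
  twisted := by
    filter_upwards [h.twisted, hgg', tendsto_neg_openDense.eventually hgg'] with z hz hgz hgz'
    rw [twist, ← hgz', ← hgz, ← hz, twist]
  tendsto := h.tendsto.congr' (hgg'.filter_mono inf_le_right)

lemma IsLoop.of_represents {g : ℂ → Mat7} {γ : Loop} (hγ : γ ∈ twistedLoopGroup)
    (hg : Represents g γ) : IsLoop g := by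
  obtain ⟨g', hg'γ, hg', -⟩ := exists_isLoop hγ
  exact hg'.congr (hg'γ.eventuallyEq hg)

section Lowering

variable {g : ℂ → Mat7} {α : ℂ} {n : ℕ}

lemma IsLoop.map_star_neg_conj (hg : IsLoop g) :
    ∀ᶠ z in openDense, (g (-conj z)).map star = sMat * g z * sMat := by
  filter_upwards [tendsto_neg_openDense.eventually hg.real, hg.twisted] with z hz hz_twist
  rw [map_neg] at hz
  rw [hz, ← hz_twist, twist]
  simp only [Matrix.mul_assoc, sMat_mul_self, Matrix.mul_one]
  rw [← Matrix.mul_assoc, sMat_mul_self, Matrix.one_mul]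

lemma IsLoop.exists_mem_pFamily_lowering (hg : IsLoop g) (hre : α.re = 0) (him : α.im ≠ 0)
    (hpole : PoleLE g α (n + 1)) (hpole' : ¬PoleLE g α n) :
    ∃ F ∈ pFamily, PoleLE (fun z => F z * g z) α n ∧
      ∀ b ∉ ({α, conj α} : Set ℂ), MatrixRegularAt (nhdsOpenDense b) F b := by
  obtain ⟨L, K, hLK, hlower, hreal⟩ :=
    exists_pair_lowering him (nhdsOpenDense_le_openDense α hg.isG2) hpole hpole'
  obtain ⟨hL, hK⟩ := hreal hre (nhdsOpenDense_le_openDense α hg.map_star_neg_conj)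
  refine ⟨pPair α L K, ⟨α, L, K, hre, him, hLK, hL, hK, rfl⟩, hlower, fun b hb => ?_⟩
  obtain ⟨l, k, c, hlk, rfl, rfl⟩ := exists_frame_of_isPair hLK
  rw [pPair_line hlk.isNullVector_fst (hlk.isNullVector_add_smul_star c)]
  exact ((hlk.isOrthogonalLoop_simplePairLoop c α).regular b hb).mono le_top

lemma exists_mem_qFamily_lowering (hg : ∀ᶠ z in openDense, IsG2 (g z)) (hre : α.re ≠ 0)
    (him : α.im ≠ 0) (hpole : PoleLE g α (n + 1)) (hpole' : ¬PoleLE g α n) :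
    ∃ F ∈ qFamily, PoleLE (fun z => F z * g z) α n ∧
      ∀ b ∉ ({α, conj α, -α, -conj α} : Set ℂ), MatrixRegularAt (nhdsOpenDense b) F b := by
  obtain ⟨L, K, hLK, hlower, -⟩ :=
    exists_pair_lowering him (nhdsOpenDense_le_openDense α hg) hpole hpole'
  refine ⟨qPair α L K, ⟨α, L, K, hre, him, hLK, rfl⟩, ?_⟩
  obtain ⟨l, k, c, hlk, rfl, rfl⟩ := exists_frame_of_isPair hLK
  have hl := hlk.isNullVector_fst
  have hk := hlk.isNullVector_add_smul_star c
  obtain ⟨v, w, hv, hw, hq, -⟩ := exists_qPair_line_eq hl hk hre him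
  rw [hq]
  refine ⟨?_, fun b hb => ((isOrthogonalLoop_simplePairLoop_neg_mul hv hw hl hk α).regular b
    hb).mono le_top⟩
  have hα : α ∉ ({-α, conj (-α)} : Set ℂ) := by
    simpa only [neg_neg] using
      neg_notMem_pair_conj (α := -α) (neg_ne_zero.2 hre) (neg_ne_zero.2 him)
  rw [pPair_line hl hk] at hlower
  exact (hlower.mul_left (((isOrthogonalLoop_simplePairLoop hv hw (-α)).regular α hα).mono
    le_top)).congr (.of_forall fun z => Matrix.mul_assoc _ _ _)

lemma IsLoop.exists_mem_families_lowering (hg : IsLoop g) (hα : α.im ≠ 0)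
    (hpole : PoleLE g α (n + 1)) (hpole' : ¬PoleLE g α n) :
    ∃ F ∈ pFamily ∪ qFamily, PoleLE (fun z => F z * g z) α n ∧
      ∀ b ∉ ({α, conj α, -α, -conj α} : Set ℂ), MatrixRegularAt (nhdsOpenDense b) F b := by
  by_cases hre : α.re = 0
  · obtain ⟨F, hF, hlower, hreg⟩ := hg.exists_mem_pFamily_lowering hre hα hpole hpole'
    exact ⟨F, .inl hF, hlower, fun b hb => hreg b fun h => hb (h.imp_right .inl)⟩
  · obtain ⟨F, hF, hlower, hreg⟩ := exists_mem_qFamily_lowering hg.isG2 hre hα hpole hpole'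
    exact ⟨F, .inr hF, hlower, hreg⟩

lemma IsLoop.poleLE_iff_of_mem_orbit (hg : IsLoop g) {b : ℂ}
    (hb : b ∈ ({α, conj α, -α, -conj α} : Set ℂ)) : PoleLE g b n ↔ PoleLE g α n := by
  have hconj (a : ℂ) : PoleLE g (conj a) n ↔ PoleLE g a n :=
    ⟨fun h => by simpa using h.at_conj hg.real, fun h => h.at_conj hg.real⟩
  have hneg (a : ℂ) : PoleLE g (-a) n ↔ PoleLE g a n :=
    ⟨fun h => by simpa using h.at_neg hg.twisted, fun h => h.at_neg hg.twisted⟩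
  rcases hb with rfl | rfl | rfl | rfl
  · rfl
  · exact hconj α
  · exact hneg α
  · rw [hneg, hconj]

end Lowering

/-- The loops of the two families. -/
def simpleLoops : Set Loop := {γ | ∃ F ∈ pFamily ∪ qFamily, Represents F γ}

/-- `S` bounds the pole divisor of the loop `γ`. -/
def PolesLE (γ : Loop) (S : Multiset ℂ) : Prop :=
  ∃ g, Represents g γ ∧ ∀ b, PoleLE g b (S.count b)

lemma exists_simpleLoop_mul_polesLE {γ : Loop} {S : Multiset ℂ} {α : ℂ}
    (hγ : γ ∈ twistedLoopGroup) (hα : α ∈ S) (hS : PolesLE γ S) :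
    ∃ θ ∈ Subgroup.closure simpleLoops, θ * γ ∈ twistedLoopGroup ∧
      PolesLE (θ * γ) (S.erase α) := by
  obtain ⟨g, hgγ, hpole⟩ := hS
  have hg : IsLoop g := .of_represents hγ hgγ
  obtain ⟨n, hn⟩ := Nat.exists_eq_add_one.2 (Multiset.count_pos.2 hα)
  have hcount : (S.erase α).count α = n := by rw [Multiset.count_erase_self, hn, Nat.add_sub_cancel]
  have hpole_α : PoleLE g α (n + 1) := hn ▸ hpole α
  by_cases hpole' : PoleLE g α n
  · refine ⟨1, one_mem _, by rwa [one_mul], g, by rwa [one_mul], fun b => ?_⟩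
    by_cases hb : b = α
    · rwa [hb, hcount]
    · rw [Multiset.count_erase_of_ne hb]
      exact hpole b
  have him : α.im ≠ 0 := fun him => hpole' <|
    .of_real_of_im_eq_zero him (hg.isG2.mono fun z hz => hz.transpose_mul) hg.real hpole_α
  obtain ⟨F, hF, hlower, hreg⟩ := hg.exists_mem_families_lowering him hpole_α hpole'
  obtain ⟨θ, hθ, hFθ⟩ := exists_represents_of_mem_families hF
  have hFg : IsLoop fun z => F z * g z := .of_represents (mul_mem hθ hγ) (hFθ.mul hgγ)
  refine ⟨θ, Subgroup.subset_closure ⟨F, hF, hFθ⟩, mul_mem hθ hγ, _, hFθ.mul hgγ, fun b => ?_⟩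
  by_cases hb : b ∈ ({α, conj α, -α, -conj α} : Set ℂ)
  · refine ((hFg.poleLE_iff_of_mem_orbit hb).2 hlower).mono ?_
    by_cases hbα : b = α
    · rw [hbα, hcount]
    · rw [Multiset.count_erase_of_ne hbα]
      by_contra! hlt
      exact hpole' ((hg.poleLE_iff_of_mem_orbit hb).1 ((hpole b).mono hlt.le))
  · rw [Multiset.count_erase_of_ne fun h => hb (.inl h)]
    exact (hpole b).mul_left (hreg b hb)

lemma eq_one_of_polesLE_zero {γ : Loop} (hγ : γ ∈ twistedLoopGroup) (h : PolesLE γ 0) :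
    γ = 1 := by
  obtain ⟨g, hgγ, hpole⟩ := h
  refine hgγ.eq_of_eventuallyEq .one (MatrixRegularAt.eventually_eq_one (fun b => ?_)
    (IsLoop.of_represents hγ hgγ).tendsto)
  exact PoleLE.zero_iff.1 (by simpa only [Multiset.count_zero] using hpole b)

lemma mem_closure_simpleLoops_of_polesLE (S : Multiset ℂ) {γ : Loop} (hγ : γ ∈ twistedLoopGroup)
    (hS : PolesLE γ S) : γ ∈ Subgroup.closure simpleLoops := by
  induction S using Multiset.strongInductionOn generalizing γ with | ih S ih
  obtain rfl | ⟨α, hα⟩ := S.empty_or_exists_mem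
  · rw [eq_one_of_polesLE_zero hγ hS]
    exact one_mem _
  · obtain ⟨θ, hθ, hθγ, hS'⟩ := exists_simpleLoop_mul_polesLE hγ hα hS
    exact (Subgroup.mul_mem_cancel_left _ hθ).1 (ih _ (Multiset.erase_lt.2 hα) hθγ hS')

theorem closure_simpleLoops : Subgroup.closure simpleLoops = twistedLoopGroup := by
  refine le_antisymm ((Subgroup.closure_le _).2 ?_) fun γ hγ => ?_
  · rintro γ ⟨F, hF, hFγ⟩
    obtain ⟨δ, hδ, hFδ⟩ := exists_represents_of_mem_families hF
    rwa [hFγ.eq_of_eventuallyEq hFδ .rfl]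
  · obtain ⟨g, hgγ, -, S, hS⟩ := exists_isLoop hγ
    exact mem_closure_simpleLoops_of_polesLE S hγ ⟨g, hgγ, hS⟩

end G2Loop

end

theorem mainTheorem6 :
    (∀ F ∈ G2Loop.pFamily ∪ G2Loop.qFamily, ∃ γ ∈ G2Loop.twistedLoopGroup, G2Loop.Represents F γ) ∧
    Subgroup.closure {γ : G2Loop.Loop | ∃ F ∈ G2Loop.pFamily ∪ G2Loop.qFamily, G2Loop.Represents F γ}
      = G2Loop.twistedLoopGroup :=
  ⟨fun _ hF => G2Loop.exists_represents_of_mem_families hF, G2Loop.closure_simpleLoops⟩
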